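/- Let $d>2$ and $2\le K\le d$ be integers, let $I=[a,b]$ with $a<b$, let $\gamma:I\to\mathbb R^d$ be $C^\infty$, and let $\chi\in C^\infty(\mathbb R;\mathbb C)$ be supported in the interior of $I$. Put $$\widehat\mu(\xi)=\int e^{-i\langle\xi,\gamma(t)\rangle}\chi(t)\,dt,\qquad G_q(R)=\Big(\int_{S^{d-1}}|\widehat\mu(R\omega)|^q\,d\omega\Big)^{1/q}$$ (for $q=\infty$, the supremum of $|\widehat\mu(R\omega)|$ over $\omega\in S^{d-1}$), where $d\omega$ is surface measure on the unit sphere. For integers $k\ge1$ let $q_k=\frac{k^2+k+2}{2}$, and for $1\le q\le\infty$ let $$\sigma_d(q)=\min_{2\le k\le d}\Big(\frac1k+\frac{k^2-k-2}{2kq}\Big),\qquad \sigma_K(q)=\min\Big\{\min_{2\le k\le K}\Big(\frac1k+\frac{k^2-k-2}{2kq}\Big),\ \frac Kq\Big\}\quad(2\le K<d).$$ Suppose that either $\gamma$ is of finite type (for every $t\in I$ the derivatives $\gamma^{(n)}(t)$, $n\ge1$, span $\mathbb R^d$) or the coordinate functions of $\gamma$ are polynomials. Suppose moreover that $\gamma'(t),\dots,\gamma^{(K)}(t)$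 are linearly independent for every $t\in I$. Then the following hold, where the constants $C_q$ may depend on $d,K,\gamma,\chi,q$ but not on $R$. (i) If $K=d$, then for all $R\ge2$ $$G_q(R)\le C_qR^{-\sigma_d(q)}\quad\text{if } 2\le q\le\infty,\ q\notin\{q_k: k=2,\dots,d-1\},$$ $$G_q(R)\le C_qR^{-\sigma_d(q)}(\log R)^{1/q}\quad\text{if } q\in\{q_k: k=2,\dots,d-1\}.$$ (ii) If $2\le K\le d-1$, then for all $R\ge2$ $$G_q(R)\le C_qR^{-\sigma_K(q)}\quad\text{if } 2\le q\le\infty,\ q\notin\{q_k: k=2,\dots,K\},$$ $$G_q(R)\le C_qR^{-\sigma_K(q)}(\log R)^{1/q}\quad\text{if } q\in\{q_k: k=2,\dots,K\}.$$ -/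

import Mathlib

open scoped ContDiff

noncomputable section

namespace CurveDecay

open MeasureTheory

/-- The Fourier transform `μ̂(ξ) = ∫ exp(-i⟨ξ, γ(t)⟩) χ(t) dt` of the measure
`⟨μ, f⟩ = ∫ f(γ(t)) χ(t) dt`. The values of `γ` off the support of `χ` do not matter. -/
def muHat {d : ℕ} (γ : ℝ → EuclideanSpace ℝ (Fin d)) (χ : ℝ → ℂ)
    (ξ : EuclideanSpace ℝ (Fin d)) : ℂ :=
  ∫ t : ℝ, Complex.exp (-(Complex.I * ((inner ℝ ξ (γ t) : ℝ) : ℂ))) * χ t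

/-- `G_q(R) = (∫_{S^{d-1}} |μ̂(Rθ)|^q dθ)^{1/q}` for `q < ∞`, and the essential supremum of
`|μ̂(Rθ)|` over the sphere for `q = ∞`. Here `dθ` is the surface measure induced by
Lebesgue measure. -/
def G {d : ℕ} (γ : ℝ → EuclideanSpace ℝ (Fin d)) (χ : ℝ → ℂ) (q : ENNReal) (R : ℝ) : ENNReal :=
  eLpNorm
    (fun θ : Metric.sphere (0 : EuclideanSpace ℝ (Fin d)) 1 =>
      muHat γ χ (R • (θ : EuclideanSpace ℝ (Fin d))))
    q (volume : Measure (EuclideanSpace ℝ (Fin d))).toSphere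

/-- `1/k + (k² - k - 2) / (2 k q)`, with `1/∞ = 0`. -/
def sigmaLine (k : ℕ) (q : ENNReal) : ℝ :=
  1 / (k : ℝ) + (((k : ℝ) ^ 2 - k - 2) / (2 * k)) * (q⁻¹).toReal

/-- The exponent `σ_K(q) = σ_K^d(q)`, for `2 ≤ K ≤ d` and `1 ≤ q ≤ ∞`. Each infimum is a minimum
over a finite nonempty index set. -/
def sigma (d K : ℕ) (q : ENNReal) : ℝ :=
  if K = d then ⨅ k : Finset.Icc 2 d, sigmaLine k q
  else min (⨅ k : Finset.Icc 2 K, sigmaLine k q) (K * (q⁻¹).toReal)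

/-- The breakpoints `q_k = (k² + k + 2) / 2`; the numerator is even. -/
def breakpoint (k : ℕ) : ℕ := (k ^ 2 + k + 2) / 2

/-- `γ` is of finite type on `[a, b]`: at every point its derivatives of order `≥ 1`
span the whole space. -/
def IsFiniteType {d : ℕ} (γ : ℝ → EuclideanSpace ℝ (Fin d)) (a b : ℝ) : Prop :=
  ∀ t ∈ Set.Icc a b,
    Submodule.span ℝ {v | ∃ n : ℕ, 1 ≤ n ∧ v = iteratedDerivWithin n γ (Set.Icc a b) t} = ⊤

/-- The coordinate functions of `γ` on `[a, b]` are polynomials. -/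
def IsPolynomialCurve {d : ℕ} (γ : ℝ → EuclideanSpace ℝ (Fin d)) (a b : ℝ) : Prop :=
  ∃ p : Fin d → Polynomial ℝ, ∀ t ∈ Set.Icc a b, ∀ i, γ t i = (p i).eval t

end CurveDecay

end

/-!
The theorem follows from three estimates for `μ̂` on the sphere of radius `R`, all of them derived
from a description of `μ̂(Rθ)` by the derivatives of the phase `t ↦ R⟨θ, γ(t)⟩`.

*Pointwise decay at all scales.* If at every point `t` some derivative of order `1 ≤ j ≤ N` of the
phase exceeds `H ^ j`, then the oscillatory integral is `O(1 / H)`, uniformly in `θ` and `R`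
(`HasMultiscaleDecay`). The interval is cut, by repeated use of monotonicity, into boundedly many
pieces on which the derivatives involved keep their signs and each is either everywhere `≥ H ^ j` or
everywhere `≤ H ^ j` in absolute value. Where the first derivative is large, the first-derivative
test applies; where it is small but a derivative of higher order is large, the piece has length
`O(1 / H)`. The cutting starts from a derivative of the phase that has a sign: the derivative of
order `N + 1` vanishes for a polynomial curve, and for a curve of finite type some derivative of
order `≤ N` is locally bounded below, uniformly in `θ` by compactness.

*Level sets.* Hence, where `|μ̂(Rθ)| > l`, there is a point `t` at which all derivatives of the
phase of order `1 ≤ j ≤ N` are `≤ Λ ^ j` with `Λ ≈ 1 / l`, and by Taylor's formula the same holds up to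
constants for all `s` with `|s - t| ≤ 1 / Λ` (`HasMultiscaleStability`). So `t` may be taken from a
set of about `Λ` points, and each of these accounts for the `θ` with
`R |⟨θ, γ⁽ʲ⁾(t)⟩| ≲ Λ ^ j` for `j ≤ k`, a set of measure
`≲ R ^ (-k) * Λ ^ (1 + 2 + ⋯ + k)` as long as the first `k` derivatives are independent. Since
`1 + (1 + 2 + ⋯ + k) = q_k`, the level set has measure `≲ R ^ (-k) * l ^ (-q_k)`, for each `k ≤ K`
(`exists_toSphere_level_le`). When `K = d` the same description gives `|μ̂(Rθ)| ≲ R ^ (-1 / d)`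
(`exists_norm_muHat_le_rpow`).

*Mean square.* At `q = 2 = q_1` the level set bound for `k = 1` is only of weak type, and the
strong bound `∫ |μ̂(Rθ)|² dθ ≲ 1 / R` is proved separately (`exists_lintegral_arcHat_le`). On a
short arc the directions nearly parallel to the tangent see a phase without stationary point. The
other directions have a component across the tangent in some coordinate plane; averaging over the
rotations of this plane by a small angle and expanding the square turns the estimate into a bound
`≲ (1 + R |t - s|)⁻²` for an oscillatory integral over the angle, which is integrated in `s`.

Integrating the level set bounds for `k` and `k + 1` gives the mean of order `q` strictly between
`q_k` and `q_(k+1)`, the two bounds meeting at the height `R ^ (-1 / (k + 1))`; at `q = q_(k+1)` the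
integral `∫ dl / l` above this height yields the logarithm. Above the last breakpoint that is
available, the integral is cut off at the uniform bound, which is `R ^ (-1 / d)` if `K = d` and a
constant if `K < d`; in the latter case the exponent is `K / q`.
-/

namespace CurveDecay

open MeasureTheory Set Filter Topology

/-! ### Chains of successive derivatives and oscillatory integrals -/

/-- `F 0, F 1, F 2, …` is a sequence of functions each of which is the derivative of the previous
one on `[a, b]`, one-sided at the end points. -/
def IsDerivChain {E : Type*} [NormedAddCommGroup E] [NormedSpace ℝ E] (F : ℕ → ℝ → E)
    (a b : ℝ) : Prop :=
  ∀ j, ∀ t ∈ Icc a b, HasDerivWithinAt (F j) (F (j + 1) t) (Icc a b) t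

namespace IsDerivChain

section Vector

variable {E : Type*} [NormedAddCommGroup E] [NormedSpace ℝ E] {F : ℕ → ℝ → E} {a b u v : ℝ}

theorem mono (hF : IsDerivChain F a b) (h : Icc u v ⊆ Icc a b) : IsDerivChain F u v :=
  fun j t ht => (hF j t (h ht)).mono h

theorem shift (hF : IsDerivChain F a b) : IsDerivChain (fun j => F (j + 1)) a b :=
  fun j t ht => hF (j + 1) t ht

theorem continuousOn (hF : IsDerivChain F a b) (j : ℕ) : ContinuousOn (F j) (Icc a b) :=
  fun t ht => (hF j t ht).continuousWithinAt

theorem hasDerivAt (hF : IsDerivChain F a b) (j : ℕ) {t : ℝ} (ht : t ∈ Ioo a b) :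
    HasDerivAt (F j) (F (j + 1) t) t :=
  (hF j t (Ioo_subset_Icc_self ht)).hasDerivAt (Icc_mem_nhds ht.1 ht.2)

end Vector

variable {F : ℕ → ℝ → ℝ} {a b u v : ℝ}

theorem abs_sub_ge (hF : IsDerivChain F a b) {j : ℕ} {μ : ℝ}
    (hμ : ∀ t ∈ Icc a b, μ ≤ |F (j + 1) t|) {s t : ℝ} (hs : s ∈ Icc a b) (ht : t ∈ Icc a b)
    (hst : s ≤ t) : μ * (t - s) ≤ |F j t - F j s| := by
  rcases hst.eq_or_lt with rfl | hlt
  · simp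
  obtain ⟨c, hc, hc'⟩ := exists_hasDerivAt_eq_slope (F j) (F (j + 1)) hlt
    ((hF.continuousOn j).mono (Icc_subset_Icc hs.1 ht.2))
    (fun x hx => hF.hasDerivAt j ⟨hs.1.trans_lt hx.1, hx.2.trans_le ht.2⟩)
  have hpos : 0 < t - s := sub_pos.2 hlt
  have h1 := hμ c ⟨hs.1.trans hc.1.le, hc.2.le.trans ht.2⟩
  rw [hc', abs_div, abs_of_pos hpos, le_div_iff₀ hpos] at h1
  exact h1

theorem abs_sub_le (hF : IsDerivChain F a b) {j : ℕ} {M : ℝ}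
    (hM : ∀ t ∈ Icc a b, |F (j + 1) t| ≤ M) {s t : ℝ} (hs : s ∈ Icc a b) (ht : t ∈ Icc a b) :
    |F j t - F j s| ≤ M * |t - s| := by
  have := (convex_Icc a b).norm_image_sub_le_of_norm_hasDerivWithin_le
    (f := F j) (f' := F (j + 1)) (C := M) (fun x hx => hF j x hx) (fun x hx => hM x hx) hs ht
  simpa using this

/-- If the `m`-th derivative is bounded below by `μ` in absolute value on an interval, the function
is bounded below by a multiple of `μ` on an interval of comparable length: at each order one of the
outer quarters will do. -/
theorem exists_subinterval (m : ℕ) : ∀ {F : ℕ → ℝ → ℝ} {u v : ℝ}, IsDerivChain F u v → u ≤ v →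
    ∀ {μ : ℝ}, 0 ≤ μ → (∀ t ∈ Icc u v, μ ≤ |F m t|) →
    ∃ u' v', u ≤ u' ∧ u' ≤ v' ∧ v' ≤ v ∧ v' - u' = (v - u) / 4 ^ m ∧
      ∀ t ∈ Icc u' v', μ * ((v - u) / 4 ^ m) ^ m ≤ |F 0 t| := by
  induction m with
  | zero =>
    intro F u v _ huv μ _ h
    exact ⟨u, v, le_rfl, huv, le_rfl, by simp, fun t ht => by simpa using h t ht⟩
  | succ m ih =>
    intro F u v hF huv μ hμ h
    obtain ⟨p, q, hp, hpq, hq, hlen, hlow⟩ := ih hF.shift huv hμ h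
    set l := q - p with hl
    have hl0 : 0 ≤ l := sub_nonneg.2 hpq
    have hl4 : (v - u) / 4 ^ (m + 1) = l / 4 := by rw [hlen, pow_succ]; ring
    have hF' := hF.mono (Icc_subset_Icc hp hq)
    have hκ : μ * ((v - u) / 4 ^ (m + 1)) ^ (m + 1) ≤ μ * l ^ m * (l / 4) := by
      rw [hl4, pow_succ, ← mul_assoc]
      gcongr
      linarith
    rw [← hlen] at hlow
    set ν := μ * l ^ m with hν
    -- if the left quarter fails at `s`, the right quarter is at distance at least `l / 2` from
    -- `s`, and `F 0` changes in between by twice the required amount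
    by_cases hleft : ∀ t ∈ Icc p (p + l / 4), ν * (l / 4) ≤ |F 0 t|
    · exact ⟨p, p + l / 4, hp, by linarith, by linarith, by rw [hl4]; ring,
        fun t ht => hκ.trans (hleft t ht)⟩
    · push Not at hleft
      obtain ⟨s, hs, hs'⟩ := hleft
      refine ⟨q - l / 4, q, by linarith, by linarith, hq, by rw [hl4]; ring, fun t ht => ?_⟩
      refine hκ.trans ?_
      have h1 := hF'.abs_sub_ge (j := 0) (μ := ν) hlow (s := s) (t := t)
        ⟨hs.1, by linarith [hs.2]⟩ ⟨by linarith [ht.1], ht.2⟩ (by linarith [hs.2, ht.1])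
      have h2 : ν * (l / 2) ≤ ν * (t - s) :=
        mul_le_mul_of_nonneg_left (by linarith [hs.2, ht.1]) (by positivity)
      have h3 := abs_sub (F 0 t) (F 0 s)
      nlinarith

theorem exists_ge (m : ℕ) (hF : IsDerivChain F u v) (huv : u ≤ v) {μ : ℝ} (hμ : 0 ≤ μ)
    (h : ∀ t ∈ Icc u v, μ ≤ |F m t|) : ∃ t ∈ Icc u v, μ * ((v - u) / 4 ^ m) ^ m ≤ |F 0 t| := by
  obtain ⟨p, q, hp, hpq, hq, -, hlow⟩ := exists_subinterval m hF huv hμ h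
  exact ⟨p, ⟨hp, hpq.trans hq⟩, hlow p ⟨le_rfl, hpq⟩⟩

/-- One integration by parts in an oscillatory integral whose phase has no critical point. -/
theorem norm_integral_exp_le (hF : IsDerivChain F u v) (huv : u ≤ v)
    (h1 : ∀ t ∈ Icc u v, F 1 t ≠ 0) :
    ‖∫ t in u..v, Complex.exp (Complex.I * (F 0 t : ℂ))‖ ≤
      1 / |F 1 u| + 1 / |F 1 v| + ∫ t in u..v, |F 2 t| / F 1 t ^ 2 := by
  have hc0 := hF.continuousOn 0
  have hc1 := hF.continuousOn 1
  have hc2 := hF.continuousOn 2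
  have hC0 : ContinuousOn (fun t => (F 0 t : ℂ)) (Icc u v) :=
    Complex.continuous_ofReal.comp_continuousOn hc0
  have hC1 : ContinuousOn (fun t => (F 1 t : ℂ)) (Icc u v) :=
    Complex.continuous_ofReal.comp_continuousOn hc1
  have hC2 : ContinuousOn (fun t => (F 2 t : ℂ)) (Icc u v) :=
    Complex.continuous_ofReal.comp_continuousOn hc2
  have hne : ∀ t ∈ Icc u v, (F 1 t : ℂ) ≠ 0 := fun t ht => by exact_mod_cast h1 t ht
  have hcE : ContinuousOn (fun t => Complex.exp (Complex.I * (F 0 t : ℂ))) (Icc u v) :=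
    Complex.continuous_exp.comp_continuousOn (continuousOn_const.mul hC0)
  set A : ℝ → ℂ := fun t => Complex.exp (Complex.I * (F 0 t : ℂ)) / (Complex.I * (F 1 t : ℂ)) with hA
  set B : ℝ → ℂ := fun t => Complex.exp (Complex.I * (F 0 t : ℂ)) *
    ((F 2 t : ℂ) / (Complex.I * (F 1 t : ℂ) ^ 2)) with hB
  have hcB : ContinuousOn B (Icc u v) := hcE.mul (hC2.div (continuousOn_const.mul (hC1.pow 2))
    (fun t ht => mul_ne_zero Complex.I_ne_zero (pow_ne_zero _ (hne t ht))))
  have hcA : ContinuousOn A (Icc u v) := hcE.div (continuousOn_const.mul hC1)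
    (fun t ht => mul_ne_zero Complex.I_ne_zero (hne t ht))
  have hint1 : IntervalIntegrable (fun t => Complex.exp (Complex.I * (F 0 t : ℂ))) volume u v :=
    hcE.intervalIntegrable_of_Icc huv
  have hint2 : IntervalIntegrable B volume u v := hcB.intervalIntegrable_of_Icc huv
  have hderiv : ∀ t ∈ Ioo u v,
      HasDerivAt A (Complex.exp (Complex.I * (F 0 t : ℂ)) - B t) t := by
    intro t ht
    have h0 := (hF.hasDerivAt 0 ht).ofReal_comp
    have h1' := (hF.hasDerivAt 1 ht).ofReal_comp
    have hn := hne t (Ioo_subset_Icc_self ht)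
    have := ((h0.const_mul Complex.I).cexp).div (h1'.const_mul Complex.I)
      (mul_ne_zero Complex.I_ne_zero hn)
    refine this.congr_deriv ?_
    simp only [hB]
    have hI := Complex.I_ne_zero
    field_simp
  have hFTC := intervalIntegral.integral_eq_sub_of_hasDerivAt_of_le huv hcA hderiv
    (hint1.sub hint2)
  rw [intervalIntegral.integral_sub hint1 hint2] at hFTC
  have hEq : ∫ t in u..v, Complex.exp (Complex.I * (F 0 t : ℂ)) =
      A v - A u + ∫ t in u..v, B t := by rw [← hFTC]; ring
  have hnormexp : ∀ t, ‖Complex.exp (Complex.I * (F 0 t : ℂ))‖ = 1 := fun t => by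
    rw [mul_comm]; exact Complex.norm_exp_ofReal_mul_I _
  have hnA : ∀ t, ‖A t‖ = 1 / |F 1 t| := fun t => by
    simp [hA, hnormexp]
  have hnB : ∀ t, ‖B t‖ = |F 2 t| / F 1 t ^ 2 := fun t => by
    simp [hB, hnormexp]
  rw [hEq]
  have h3 : ‖∫ t in u..v, B t‖ ≤ ∫ t in u..v, |F 2 t| / F 1 t ^ 2 := by
    refine (intervalIntegral.norm_integral_le_integral_norm huv).trans_eq ?_
    simp_rw [hnB]
  calc _ ≤ ‖A v - A u‖ + ‖∫ t in u..v, B t‖ := norm_add_le _ _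
    _ ≤ (‖A v‖ + ‖A u‖) + ‖∫ t in u..v, B t‖ := by gcongr; exact norm_sub_le _ _
    _ ≤ _ := by rw [hnA, hnA]; linarith

theorem norm_integral_exp_le_of_bound (hF : IsDerivChain F u v) (huv : u ≤ v) {μ M : ℝ}
    (hμ : 0 < μ) (h1 : ∀ t ∈ Icc u v, μ ≤ |F 1 t|) (h2 : ∀ t ∈ Icc u v, |F 2 t| ≤ M) :
    ‖∫ t in u..v, Complex.exp (Complex.I * (F 0 t : ℂ))‖ ≤ 2 / μ + M / μ ^ 2 * (v - u) := by
  have hne : ∀ t ∈ Icc u v, F 1 t ≠ 0 := fun t ht h => by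
    have := h1 t ht; rw [h, abs_zero] at this; linarith
  refine (hF.norm_integral_exp_le huv hne).trans ?_
  have hu : 1 / |F 1 u| ≤ 1 / μ := one_div_le_one_div_of_le hμ (h1 u ⟨le_rfl, huv⟩)
  have hv : 1 / |F 1 v| ≤ 1 / μ := one_div_le_one_div_of_le hμ (h1 v ⟨huv, le_rfl⟩)
  have hI : ∫ t in u..v, |F 2 t| / F 1 t ^ 2 ≤ M / μ ^ 2 * (v - u) := by
    have : ∫ t in u..v, |F 2 t| / F 1 t ^ 2 ≤ ∫ _ in u..v, M / μ ^ 2 := by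
      refine intervalIntegral.integral_mono_on huv ?_ (by simp) fun t ht => ?_
      · exact (((hF.continuousOn 2).abs).div ((hF.continuousOn 1).pow 2)
          (fun t ht => pow_ne_zero _ (hne t ht))).intervalIntegrable_of_Icc huv
      · have hM : 0 ≤ M := (abs_nonneg _).trans (h2 t ht)
        rw [← sq_abs (F 1 t)]
        have := h1 t ht
        have := h2 t ht
        gcongr
    refine this.trans_eq ?_
    rw [intervalIntegral.integral_const, smul_eq_mul]
    ring
  have : (2 : ℝ) / μ = 1 / μ + 1 / μ := by ring
  linarith

/-- The first-derivative test for oscillatory integrals: no factor depends on the length of the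
interval when the derivative of the phase is monotone. -/
theorem norm_integral_exp_le_of_sign (hF : IsDerivChain F u v) (huv : u ≤ v) {μ : ℝ}
    (hμ : 0 < μ) (h1 : ∀ t ∈ Icc u v, μ ≤ |F 1 t|)
    (h2 : (∀ t ∈ Icc u v, 0 ≤ F 2 t) ∨ ∀ t ∈ Icc u v, F 2 t ≤ 0) :
    ‖∫ t in u..v, Complex.exp (Complex.I * (F 0 t : ℂ))‖ ≤ 4 / μ := by
  have hne : ∀ t ∈ Icc u v, F 1 t ≠ 0 := fun t ht h => by
    have := h1 t ht; rw [h, abs_zero] at this; linarith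
  refine (hF.norm_integral_exp_le huv hne).trans ?_
  have hu : 1 / |F 1 u| ≤ 1 / μ := one_div_le_one_div_of_le hμ (h1 u ⟨le_rfl, huv⟩)
  have hv : 1 / |F 1 v| ≤ 1 / μ := one_div_le_one_div_of_le hμ (h1 v ⟨huv, le_rfl⟩)
  have hcI : ContinuousOn (fun t => (F 1 t)⁻¹) (Icc u v) := (hF.continuousOn 1).inv₀ hne
  have hint : IntervalIntegrable (fun t => F 2 t / F 1 t ^ 2) volume u v :=
    ((hF.continuousOn 2).div ((hF.continuousOn 1).pow 2)
      (fun t ht => pow_ne_zero _ (hne t ht))).intervalIntegrable_of_Icc huv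
  have hFTC : ∫ t in u..v, -(F 2 t / F 1 t ^ 2) = (F 1 v)⁻¹ - (F 1 u)⁻¹ := by
    refine intervalIntegral.integral_eq_sub_of_hasDerivAt_of_le huv hcI (fun t ht => ?_) hint.neg
    exact ((hF.hasDerivAt 1 ht).inv (hne t (Ioo_subset_Icc_self ht))).congr_deriv (by ring)
  have hE : |∫ t in u..v, F 2 t / F 1 t ^ 2| ≤ 2 / μ := by
    rw [intervalIntegral.integral_neg] at hFTC
    rw [← abs_neg, hFTC]
    refine (abs_sub _ _).trans ?_
    rw [abs_inv, abs_inv, ← one_div, ← one_div]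
    have : (2 : ℝ) / μ = 1 / μ + 1 / μ := by ring
    linarith
  have hI : ∫ t in u..v, |F 2 t| / F 1 t ^ 2 ≤ 2 / μ := by
    rcases h2 with h2 | h2
    · have : ∫ t in u..v, |F 2 t| / F 1 t ^ 2 = ∫ t in u..v, F 2 t / F 1 t ^ 2 := by
        refine intervalIntegral.integral_congr fun t ht => ?_
        rw [uIcc_of_le huv] at ht
        simp only [abs_of_nonneg (h2 t ht)]
      rw [this]; exact (le_abs_self _).trans hE
    · have : ∫ t in u..v, |F 2 t| / F 1 t ^ 2 = -∫ t in u..v, F 2 t / F 1 t ^ 2 := by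
        rw [← intervalIntegral.integral_neg]
        refine intervalIntegral.integral_congr fun t ht => ?_
        rw [uIcc_of_le huv] at ht
        simp only [abs_of_nonpos (h2 t ht), neg_div]
      rw [this]; exact (neg_le_abs _).trans hE
  have : (4 : ℝ) / μ = 1 / μ + 1 / μ + 2 / μ := by ring
  linarith

end IsDerivChain

/-! ### Splitting an interval according to the size of the derivatives -/

theorem exists_split_of_monotoneOn {f : ℝ → ℝ} {u v : ℝ} (huv : u ≤ v)
    (hf : MonotoneOn f (Ioo u v)) (c : ℝ) :
    ∃ p ∈ Icc u v, (∀ t ∈ Ioo u p, f t ≤ c) ∧ ∀ t ∈ Ioo p v, c ≤ f t := by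
  set S : Set ℝ := {t | t ∈ Icc u v ∧ (t = u ∨ t ∈ Ioo u v ∧ f t ≤ c)} with hS
  have hu : u ∈ S := ⟨⟨le_rfl, huv⟩, Or.inl rfl⟩
  have hbdd : BddAbove S := ⟨v, fun t ht => ht.1.2⟩
  have hup : u ≤ sSup S := le_csSup hbdd hu
  have hpv : sSup S ≤ v := csSup_le ⟨u, hu⟩ fun t ht => ht.1.2
  refine ⟨sSup S, ⟨hup, hpv⟩, fun t ht => ?_, fun t ht => ?_⟩
  · obtain ⟨s, hs, hts⟩ := exists_lt_of_lt_csSup ⟨u, hu⟩ ht.2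
    rcases hs.2 with rfl | ⟨hs1, hs2⟩
    · exact absurd ht.1 (not_lt.2 hts.le)
    · exact (hf ⟨ht.1, ht.2.trans_le hpv⟩ hs1 hts.le).trans hs2
  · by_contra hlt
    have hmem : t ∈ S := ⟨⟨hup.trans ht.1.le, ht.2.le⟩,
      Or.inr ⟨⟨hup.trans_lt ht.1, ht.2⟩, (not_le.1 hlt).le⟩⟩
    exact absurd (le_csSup hbdd hmem) (not_le.2 ht.1)

/-- `Φ` is subadditive under the splitting of subintervals of `[a, b]`. -/
def IsSplitSubadditive (Φ : ℝ → ℝ → ℝ) (a b : ℝ) : Prop :=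
  ∀ u p v, a ≤ u → u ≤ p → p ≤ v → v ≤ b → Φ u v ≤ Φ u p + Φ p v

/-- A bound for all intervals of length at most `δ` gives one for all intervals. -/
theorem IsSplitSubadditive.le_of_short {Φ : ℝ → ℝ → ℝ} {a b δ B : ℝ}
    (h : IsSplitSubadditive Φ a b) (hδ : 0 < δ)
    (hB : ∀ u v, a ≤ u → u ≤ v → v ≤ b → v - u ≤ δ → Φ u v ≤ B) (m : ℕ) :
    ∀ u v, a ≤ u → u ≤ v → v ≤ b → v - u ≤ (m + 1) * δ → Φ u v ≤ (m + 1) * B := by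
  induction m with
  | zero => intro u v h1 h2 h3 h4; simpa using hB u v h1 h2 h3 (by simpa using h4)
  | succ m ih =>
    intro u v h1 h2 h3 h4
    push_cast at h4 ⊢
    have hm : u ≤ max u (v - δ) := le_max_left _ _
    have hm' : max u (v - δ) ≤ v := max_le h2 (by linarith)
    have hr : v - max u (v - δ) ≤ δ := by have := le_max_right u (v - δ); linarith
    have hl : max u (v - δ) - u ≤ (m + 1) * δ := by
      rcases max_cases u (v - δ) with ⟨h, -⟩ | ⟨h, -⟩ <;> rw [h]
      · rw [sub_self]; positivity
      · linarith
    have e1 := h u _ v h1 hm hm' h3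
    have e2 := ih u _ h1 hm (hm'.trans h3) hl
    have e3 := hB _ v (h1.trans hm) hm' h3 hr
    linarith

theorem isSplitSubadditive_norm_integral {f : ℝ → ℂ} {a b : ℝ} (hf : ContinuousOn f (Icc a b)) :
    IsSplitSubadditive (fun u v => ‖∫ t in u..v, f t‖) a b := by
  intro u p v h1 h2 h3 h4
  have i1 : IntervalIntegrable f volume u p :=
    (hf.mono (Icc_subset_Icc h1 (h3.trans h4))).intervalIntegrable_of_Icc h2
  have i2 : IntervalIntegrable f volume p v :=
    (hf.mono (Icc_subset_Icc (h1.trans h2) h4)).intervalIntegrable_of_Icc h3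
  simp only
  rw [← intervalIntegral.integral_add_adjacent_intervals i1 i2]
  exact norm_add_le _ _

/-- Inside `(u, v)`, each `F i` with `m ≤ i ≤ n` keeps its sign, and each `|F i|` with `m ≤ i < n`
stays on one side of the level `h i`. Open intervals make degenerate pieces harmless. -/
def IsSorted (F : ℕ → ℝ → ℝ) (h : ℕ → ℝ) (m n : ℕ) (u v : ℝ) : Prop :=
  ∀ i, m ≤ i → i ≤ n →
    ((∀ t ∈ Ioo u v, 0 ≤ F i t) ∨ ∀ t ∈ Ioo u v, F i t ≤ 0) ∧
      (i < n → (∀ t ∈ Ioo u v, h i ≤ |F i t|) ∨ ∀ t ∈ Ioo u v, |F i t| ≤ h i)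

theorem IsSorted.mono {F : ℕ → ℝ → ℝ} {h : ℕ → ℝ} {m n : ℕ} {u v u' v' : ℝ}
    (H : IsSorted F h m n u v) (hsub : Ioo u' v' ⊆ Ioo u v) : IsSorted F h m n u' v' := by
  intro i h1 h2
  obtain ⟨hs, hl⟩ := H i h1 h2
  exact ⟨hs.imp (fun H t ht => H t (hsub ht)) (fun H t ht => H t (hsub ht)),
    fun hi => (hl hi).imp (fun H t ht => H t (hsub ht)) (fun H t ht => H t (hsub ht))⟩

/-- Four pieces suffice to sort a monotone function by sign and by the size of its absolute
value. -/
theorem exists_four_split {f : ℝ → ℝ} {u v : ℝ} (huv : u ≤ v)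
    (hf : MonotoneOn f (Ioo u v) ∨ AntitoneOn f (Ioo u v)) {c : ℝ} (hc : 0 ≤ c) :
    ∃ p q r, u ≤ p ∧ p ≤ q ∧ q ≤ r ∧ r ≤ v ∧
      ∀ s t, ((s = u ∧ t = p) ∨ (s = p ∧ t = q) ∨ (s = q ∧ t = r) ∨ (s = r ∧ t = v)) →
        ((∀ x ∈ Ioo s t, 0 ≤ f x) ∨ ∀ x ∈ Ioo s t, f x ≤ 0) ∧
          ((∀ x ∈ Ioo s t, c ≤ |f x|) ∨ ∀ x ∈ Ioo s t, |f x| ≤ c) := by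
  wlog hmono : MonotoneOn f (Ioo u v) generalizing f
  · have hanti := hf.resolve_left hmono
    obtain ⟨p, q, r, h1, h2, h3, h4, H⟩ := this (f := fun x => -f x) (Or.inl hanti.neg) hanti.neg
    refine ⟨p, q, r, h1, h2, h3, h4, fun s t hst => ?_⟩
    obtain ⟨hs, hl⟩ := H s t hst
    simp only [abs_neg, Left.nonneg_neg_iff, Left.neg_nonpos_iff] at hs hl
    exact ⟨hs.symm, hl⟩
  obtain ⟨q, hq, hq1, hq2⟩ := exists_split_of_monotoneOn huv hmono 0
  obtain ⟨p, hp, hp1, hp2⟩ := exists_split_of_monotoneOn hq.1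
    (hmono.mono (Ioo_subset_Ioo_right hq.2)) (-c)
  obtain ⟨r, hr, hr1, hr2⟩ := exists_split_of_monotoneOn hq.2
    (hmono.mono (Ioo_subset_Ioo_left hq.1)) c
  refine ⟨p, q, r, hp.1, hp.2, hr.1, hr.2, fun s t hst => ?_⟩
  rcases hst with ⟨rfl, rfl⟩ | ⟨rfl, rfl⟩ | ⟨rfl, rfl⟩ | ⟨rfl, rfl⟩
  · have hneg : ∀ x ∈ Ioo s t, f x ≤ -c := hp1
    exact ⟨Or.inr fun x hx => (hneg x hx).trans (by linarith),
      Or.inl fun x hx => by have := hneg x hx; rw [le_abs]; right; linarith⟩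
  · have hneg : ∀ x ∈ Ioo s t, f x ≤ 0 := fun x hx => hq1 x ⟨hp.1.trans_lt hx.1, hx.2⟩
    exact ⟨Or.inr hneg, Or.inr fun x hx => by
      rw [abs_le]; exact ⟨hp2 x hx, (hneg x hx).trans hc⟩⟩
  · have hpos : ∀ x ∈ Ioo s t, 0 ≤ f x := fun x hx => hq2 x ⟨hx.1, hx.2.trans_le hr.2⟩
    exact ⟨Or.inl hpos, Or.inr fun x hx => by
      rw [abs_le]; exact ⟨(by linarith : -c ≤ 0).trans (hpos x hx), hr1 x hx⟩⟩
  · exact ⟨Or.inl fun x hx => hc.trans (hr2 x hx),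
      Or.inl fun x hx => (hr2 x hx).trans (le_abs_self _)⟩

theorem IsDerivChain.monotoneOn_or_antitoneOn {F : ℕ → ℝ → ℝ} {a b u v : ℝ} {j : ℕ}
    (hF : IsDerivChain F a b) (hu : a ≤ u) (hv : v ≤ b)
    (h : (∀ t ∈ Ioo u v, 0 ≤ F (j + 1) t) ∨ ∀ t ∈ Ioo u v, F (j + 1) t ≤ 0) :
    MonotoneOn (F j) (Ioo u v) ∨ AntitoneOn (F j) (Ioo u v) := by
  have hsub : Ioo u v ⊆ Ioo a b := Ioo_subset_Ioo hu hv
  have hd : ∀ t ∈ Ioo u v, HasDerivAt (F j) (F (j + 1) t) t := fun t ht => hF.hasDerivAt j (hsub ht)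
  have hc : ContinuousOn (F j) (Ioo u v) := fun t ht => (hd t ht).continuousAt.continuousWithinAt
  refine h.imp (fun h => ?_) (fun h => ?_)
  · refine monotoneOn_of_deriv_nonneg (convex_Ioo u v) hc ?_ ?_
    · rw [interior_Ioo]; exact fun t ht => (hd t ht).differentiableAt.differentiableWithinAt
    · rw [interior_Ioo]; intro t ht; rw [(hd t ht).deriv]; exact h t ht
  · refine antitoneOn_of_deriv_nonpos (convex_Ioo u v) hc ?_ ?_
    · rw [interior_Ioo]; exact fun t ht => (hd t ht).differentiableAt.differentiableWithinAt
    · rw [interior_Ioo]; intro t ht; rw [(hd t ht).deriv]; exact h t ht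

/-- A bound on sorted intervals propagates, at the cost of a factor `4` for each derivative, to
intervals on which only the derivative of the highest order is known to keep its sign. -/
theorem le_of_isSorted {F : ℕ → ℝ → ℝ} {Φ : ℝ → ℝ → ℝ} {h : ℕ → ℝ} {a b B : ℝ} {n : ℕ}
    (hF : IsDerivChain F a b) (hΦ : IsSplitSubadditive Φ a b) (hh : ∀ i, 0 ≤ h i)
    (hB : ∀ u v, a ≤ u → u ≤ v → v ≤ b → IsSorted F h 1 n u v → Φ u v ≤ B) (m : ℕ) :
    m + 1 ≤ n → ∀ u v, a ≤ u → u ≤ v → v ≤ b → IsSorted F h (m + 1) n u v →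
      Φ u v ≤ 4 ^ m * B := by
  induction m with
  | zero => intro _ u v h1 h2 h3 h4; simpa using hB u v h1 h2 h3 h4
  | succ m ih =>
    intro hmn u v h1 h2 h3 hs
    -- `F (m + 2)` keeps its sign, so `F (m + 1)` is monotone and can be sorted
    obtain ⟨p, q, r, hup, hpq, hqr, hrv, H⟩ := exists_four_split h2
      (hF.monotoneOn_or_antitoneOn h1 h3 (hs (m + 2) le_rfl hmn).1) (hh (m + 1))
    have key : ∀ s t, u ≤ s → s ≤ t → t ≤ v →
        ((s = u ∧ t = p) ∨ (s = p ∧ t = q) ∨ (s = q ∧ t = r) ∨ (s = r ∧ t = v)) →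
        Φ s t ≤ 4 ^ m * B := by
      intro s t hus hst htv hcase
      refine ih (by omega) s t (h1.trans hus) hst (htv.trans h3) fun i hi hin => ?_
      rcases hi.eq_or_lt with rfl | hi
      · exact ⟨(H s t hcase).1, fun _ => (H s t hcase).2⟩
      · exact hs.mono (Ioo_subset_Ioo hus htv) i hi hin
    have k1 := key u p le_rfl hup (hpq.trans (hqr.trans hrv)) (by simp)
    have k2 := key p q hup hpq (hqr.trans hrv) (by simp)
    have k3 := key q r (hup.trans hpq) hqr hrv (by simp)
    have k4 := key r v (hup.trans (hpq.trans hqr)) hrv le_rfl (by simp)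
    have s1 := hΦ u q v h1 (hup.trans hpq) (hqr.trans hrv) h3
    have s2 := hΦ u p q h1 hup hpq ((hqr.trans hrv).trans h3)
    have s3 := hΦ q r v (h1.trans (hup.trans hpq)) hqr hrv h3
    rw [pow_succ]
    linarith

/-- Weak inequalities on an open interval extend to its closure. -/
theorem forall_Icc_of_forall_Ioo {f g : ℝ → ℝ} {u v : ℝ} (huv : u < v)
    (hf : ContinuousOn f (Icc u v)) (hg : ContinuousOn g (Icc u v))
    (h : ∀ t ∈ Ioo u v, f t ≤ g t) : ∀ t ∈ Icc u v, f t ≤ g t := by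
  intro t ht
  rw [← closure_Ioo huv.ne] at ht hf hg
  exact ContinuousWithinAt.closure_le ht ((hf t ht).mono subset_closure)
    ((hg t ht).mono subset_closure) h

/-- On an interval where the size of the first derivative is at most `H` while a derivative of
higher order `m + 1` is at least `c H ^ (m + 1)`, the length is `O(1 / H)`. -/
theorem IsDerivChain.length_le {F : ℕ → ℝ → ℝ} {u v H c : ℝ} {m : ℕ} (hF : IsDerivChain F u v)
    (huv : u ≤ v) (hH : 0 < H) (hm : m ≠ 0) (hc : 0 < c) (hc1 : c ≤ 1)
    (h1 : ∀ t ∈ Icc u v, |F 1 t| ≤ H)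
    (h2 : ∀ t ∈ Icc u v, c * H ^ (m + 1) ≤ |F (m + 1) t|) : v - u ≤ 4 ^ m / c / H := by
  obtain ⟨t, ht, hlow⟩ := hF.shift.exists_ge m huv (by positivity) h2
  have h3 : c * H ^ (m + 1) * ((v - u) / 4 ^ m) ^ m ≤ H := hlow.trans (h1 t ht)
  set x := H * ((v - u) / 4 ^ m) with hx
  have h4 : c * x ^ m ≤ 1 := by
    have : c * H ^ (m + 1) * ((v - u) / 4 ^ m) ^ m = H * (c * x ^ m) := by
      rw [hx, mul_pow]; ring
    rw [this] at h3
    exact le_of_mul_le_mul_left (by linarith) hH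
  have hx0 : 0 ≤ x := by have := sub_nonneg.2 huv; positivity
  have h5 : c * x ≤ 1 := by
    by_contra hcon
    have h6 : (1 : ℝ) < (c * x) ^ m := one_lt_pow₀ (not_le.1 hcon) hm
    have h7 : c ^ m ≤ c := pow_le_of_le_one hc.le hc1 hm
    rw [mul_pow] at h6
    have : c ^ m * x ^ m ≤ c * x ^ m := by gcongr
    linarith
  rw [hx] at h5
  rw [le_div_iff₀ hH, le_div_iff₀ hc]
  have h8 : c * (H * ((v - u) / 4 ^ m)) * 4 ^ m = (v - u) * H * c := by
    field_simp
  rw [← h8]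
  have : (0:ℝ) < 4 ^ m := by positivity
  nlinarith

/-- The multiscale van der Corput estimate: an oscillatory integral is `O(1 / H)` once this is known
on the intervals where each derivative of order `1 ≤ i < n` is at most `H ^ i`. -/
theorem IsDerivChain.norm_integral_exp_le_of_terminal {F : ℕ → ℝ → ℝ} {a b H B : ℝ} {n : ℕ}
    (hF : IsDerivChain F a b) (hab : a ≤ b) (hn : 1 ≤ n) (hH : 0 < H)
    (hsign : (∀ t ∈ Ioo a b, 0 ≤ F n t) ∨ ∀ t ∈ Ioo a b, F n t ≤ 0)
    (hB4 : 4 ^ n ≤ B)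
    (hB : ∀ u v, a ≤ u → u < v → v ≤ b → (∀ i, 1 ≤ i → i < n → ∀ t ∈ Icc u v, |F i t| ≤ H ^ i) →
      ‖∫ t in u..v, Complex.exp (Complex.I * (F 0 t : ℂ))‖ ≤ B / H) :
    ‖∫ t in a..b, Complex.exp (Complex.I * (F 0 t : ℂ))‖ ≤ 4 ^ n * B / H := by
  have hcont : ContinuousOn (fun t => Complex.exp (Complex.I * (F 0 t : ℂ))) (Icc a b) :=
    Complex.continuous_exp.comp_continuousOn (continuousOn_const.mul
      (Complex.continuous_ofReal.comp_continuousOn (hF.continuousOn 0)))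
  have hB0 : 0 ≤ B := le_trans (by positivity) hB4
  have h4B : 4 ≤ B := le_trans (by simpa using pow_le_pow_right₀ (by norm_num : (1:ℝ) ≤ 4) hn) hB4
  have key := le_of_isSorted (B := B / H) (h := fun i => H ^ i) (n := n) hF
    (isSplitSubadditive_norm_integral hcont) (fun i => by positivity) ?_ (n - 1) (by omega)
    a b le_rfl hab le_rfl ?_
  · refine key.trans ?_
    rw [mul_div_assoc]
    have : 0 ≤ B / H := by positivity
    gcongr
    · norm_num
    · omega
  · intro u v h1 h2 h3 hs
    rcases h2.eq_or_lt with rfl | huv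
    · simp; positivity
    have hF' : IsDerivChain F u v := hF.mono (Icc_subset_Icc h1 h3)
    by_cases hall : ∀ i, 1 ≤ i → i < n → ∀ t ∈ Ioo u v, |F i t| ≤ H ^ i
    · exact hB u v h1 huv h3 fun i hi hin =>
        forall_Icc_of_forall_Ioo huv (hF'.continuousOn i).abs continuousOn_const (hall i hi hin)
    push Not at hall
    obtain ⟨i, hi1, hin, t, ht, hti⟩ := hall
    have hlarge : ∀ t ∈ Icc u v, H ^ i ≤ |F i t| := by
      refine forall_Icc_of_forall_Ioo huv continuousOn_const (hF'.continuousOn i).abs ?_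
      exact ((hs i hi1 hin.le).2 hin).resolve_right fun h => absurd (h t ht) (not_le.2 hti)
    -- a large first derivative is monotone here: the first-derivative test applies
    have hone : (∀ t ∈ Icc u v, H ≤ |F 1 t|) →
        ‖∫ t in u..v, Complex.exp (Complex.I * (F 0 t : ℂ))‖ ≤ B / H := by
      intro h
      refine (hF'.norm_integral_exp_le_of_sign huv.le hH h ?_).trans (by gcongr)
      exact (hs 2 (by norm_num) (by omega)).1.imp
        (fun h => forall_Icc_of_forall_Ioo huv continuousOn_const (hF'.continuousOn 2) h)
        (fun h => forall_Icc_of_forall_Ioo huv (hF'.continuousOn 2) continuousOn_const h)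
    obtain ⟨m, rfl⟩ : ∃ m, i = m + 1 := ⟨i - 1, by omega⟩
    rcases Nat.eq_zero_or_pos m with rfl | hm
    · exact hone fun t ht => by simpa using hlarge t ht
    rcases (hs 1 le_rfl (by omega)).2 (by omega) with h | h
    · refine hone (forall_Icc_of_forall_Ioo huv continuousOn_const (hF'.continuousOn 1).abs ?_)
      simpa using h
    -- the first derivative is small but one of higher order is large: the interval is short, and
    -- the trivial bound for the integral suffices
    have hlen := hF'.length_le huv.le hH hm.ne' one_pos le_rfl
      (forall_Icc_of_forall_Ioo huv (hF'.continuousOn 1).abs continuousOn_const (by simpa using h))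
      (by simpa using hlarge)
    have hnorm := intervalIntegral.norm_integral_le_of_norm_le_const (a := u) (b := v) (C := 1)
      (f := fun t => Complex.exp (Complex.I * (F 0 t : ℂ))) fun t _ => by
        rw [mul_comm]; exact (Complex.norm_exp_ofReal_mul_I _).le
    rw [one_mul, abs_of_nonneg (sub_nonneg.2 huv.le)] at hnorm
    refine hnorm.trans (hlen.trans ?_)
    rw [div_one]
    gcongr
    refine le_trans ?_ hB4
    gcongr
    · norm_num
    · omega
  · intro i hi hin
    obtain rfl : i = n := by omega
    exact ⟨hsign, fun h => absurd h (lt_irrefl _)⟩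

/-! ### Uniform decay in terms of the derivatives of the phase -/

namespace IsDerivChain

variable {d : ℕ} {Γ : ℕ → ℝ → EuclideanSpace ℝ (Fin d)} {a b : ℝ}

theorem inner_left (hΓ : IsDerivChain Γ a b) (r : ℝ) (θ : EuclideanSpace ℝ (Fin d)) :
    IsDerivChain (fun j t => r * inner ℝ θ (Γ j t)) a b := by
  intro j t ht
  have h := ((innerSL ℝ θ).hasFDerivAt.comp_hasDerivWithinAt t (hΓ j t ht)).const_mul r
  exact h

theorem exists_norm_le (hΓ : IsDerivChain Γ a b) (N : ℕ) :
    ∃ C : ℝ, 1 ≤ C ∧ ∀ j ≤ N, ∀ t ∈ Icc a b, ‖Γ j t‖ ≤ C := by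
  have h : ∀ j, ∃ C : ℝ, ∀ t ∈ Icc a b, ‖Γ j t‖ ≤ C := fun j =>
    isCompact_Icc.exists_bound_of_continuousOn (hΓ.continuousOn j)
  choose C hC using h
  refine ⟨1 + ∑ j ∈ Finset.range (N + 1), |C j|, ?_, fun j hj t ht => ?_⟩
  · have : 0 ≤ ∑ j ∈ Finset.range (N + 1), |C j| := Finset.sum_nonneg fun _ _ => abs_nonneg _
    linarith
  · have h1 := Finset.single_le_sum (f := fun j => |C j|) (fun j _ => abs_nonneg _)
      (Finset.mem_range.2 (Nat.lt_succ_of_le hj))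
    have := hC j t ht
    have := le_abs_self (C j)
    linarith

/-- Nondegeneracy of the derivatives at every point is uniform in the point and the direction. -/
theorem exists_uniform_lower_bound (hΓ : IsDerivChain Γ a b) (S : Set ℕ)
    (h : ∀ t ∈ Icc a b, ∀ θ, ‖θ‖ = 1 → ∃ n ∈ S, inner ℝ θ (Γ n t) ≠ 0) :
    ∃ N : ℕ, ∃ c > 0, ∀ t ∈ Icc a b, ∀ θ : EuclideanSpace ℝ (Fin d), ‖θ‖ = 1 →
      ∃ n ∈ S, n ≤ N ∧ c ≤ |inner ℝ θ (Γ n t)| := by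
  have hcpt : IsCompact (Icc a b ×ˢ Metric.sphere (0 : EuclideanSpace ℝ (Fin d)) 1) :=
    isCompact_Icc.prod (isCompact_sphere 0 1)
  have key : ∃ N : ℕ, ∃ c > 0, ∀ x ∈ Icc a b ×ˢ Metric.sphere (0 : EuclideanSpace ℝ (Fin d)) 1,
      ∃ n ∈ S, n ≤ N ∧ c ≤ |inner ℝ x.2 (Γ n x.1)| := by
    refine hcpt.induction_on (p := fun s => ∃ N : ℕ, ∃ c > 0, ∀ x ∈ s,
      ∃ n ∈ S, n ≤ N ∧ c ≤ |inner ℝ x.2 (Γ n x.1)|) ?_ ?_ ?_ ?_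
    · exact ⟨0, 1, one_pos, by simp⟩
    · rintro s t hst ⟨N, c, hc, H⟩
      exact ⟨N, c, hc, fun x hx => H x (hst hx)⟩
    · rintro s t ⟨N, c, hc, H⟩ ⟨N', c', hc', H'⟩
      refine ⟨max N N', min c c', lt_min hc hc', fun x hx => ?_⟩
      rcases hx with hx | hx
      · obtain ⟨n, hn, h1, h2⟩ := H x hx
        exact ⟨n, hn, h1.trans (le_max_left _ _), (min_le_left _ _).trans h2⟩
      · obtain ⟨n, hn, h1, h2⟩ := H' x hx
        exact ⟨n, hn, h1.trans (le_max_right _ _), (min_le_right _ _).trans h2⟩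
    · rintro ⟨t, θ⟩ ⟨ht, hθ⟩
      obtain ⟨n, hn, hne⟩ := h t ht θ (by simpa using hθ)
      have hc : ContinuousOn (fun x : ℝ × EuclideanSpace ℝ (Fin d) => |inner ℝ x.2 (Γ n x.1)|)
          (Icc a b ×ˢ Metric.sphere 0 1) := by
        refine ContinuousOn.abs (ContinuousOn.inner continuous_snd.continuousOn ?_)
        exact (hΓ.continuousOn n).comp continuous_fst.continuousOn fun x hx => hx.1
      have hpos : 0 < |inner ℝ θ (Γ n t)| := abs_pos.2 hne
      have hev := (hc (t, θ) ⟨ht, hθ⟩).eventually (lt_mem_nhds (half_lt_self hpos))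
      exact ⟨_, hev, n, _, half_pos hpos, fun x hx => ⟨n, hn, le_rfl, le_of_lt hx⟩⟩
  obtain ⟨N, c, hc, H⟩ := key
  exact ⟨N, c, hc, fun t ht θ hθ => H (t, θ) ⟨ht, by simpa using hθ⟩⟩

/-- Stability of multiscale smallness: if at the point `t` every derivative of order `1 ≤ j ≤ N` is
at most `Λ ^ j`, the same holds up to a constant at distance `1 / Λ`, provided the next derivative
is controlled everywhere. -/
theorem abs_le_of_dist_le {F : ℕ → ℝ → ℝ} (hF : IsDerivChain F a b) {Λ C : ℝ} (hΛ : 0 < Λ)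
    {N : ℕ} (hC : 0 ≤ C) (hN : ∀ x ∈ Icc a b, |F (N + 1) x| ≤ C * Λ ^ (N + 1)) {t : ℝ}
    (ht : t ∈ Icc a b) (h : ∀ j, 1 ≤ j → j ≤ N → |F j t| ≤ Λ ^ j) :
    ∀ j, 1 ≤ j → j ≤ N → ∀ s ∈ Icc a b, |s - t| ≤ 1 / Λ → |F j s| ≤ (C + N) * Λ ^ j := by
  have key : ∀ i, i ≤ N → ∀ s ∈ Icc a b, |s - t| ≤ 1 / Λ →
      |F (N + 1 - i) s| ≤ (C + i) * Λ ^ (N + 1 - i) := by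
    intro i
    induction i with
    | zero => intro _ s hs _; simpa using hN s hs
    | succ i ih =>
      intro hi s hs hst
      have hj : N + 1 - i = (N + 1 - (i + 1)) + 1 := by omega
      rw [hj] at ih
      set j := N + 1 - (i + 1) with hjdef
      have hsub : Icc (min s t) (max s t) ⊆ Icc a b :=
        Icc_subset_Icc (le_min hs.1 ht.1) (max_le hs.2 ht.2)
      have h1 := (hF.mono hsub).abs_sub_le (j := j) (M := (C + i) * Λ ^ (j + 1))
        (fun x hx => ih (by omega) x (hsub hx) ((?_ : |x - t| ≤ |s - t|).trans hst))
        (s := t) (t := s) ⟨min_le_right _ _, le_max_right _ _⟩ ⟨min_le_left _ _, le_max_left _ _⟩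
      · have h2 : (C + i) * Λ ^ (j + 1) * |s - t| ≤ (C + i) * Λ ^ j := by
          calc (C + i) * Λ ^ (j + 1) * |s - t| ≤ (C + i) * Λ ^ (j + 1) * (1 / Λ) := by gcongr
            _ = (C + i) * Λ ^ j := by rw [pow_succ]; field_simp
        have h3 := h j (by omega) (by omega)
        have h4 := abs_add_le (F j s - F j t) (F j t)
        rw [sub_add_cancel] at h4
        push_cast
        linarith
      · rcases le_total s t with hle | hle
        · rw [min_eq_left hle, max_eq_right hle] at hx
          rw [abs_of_nonpos (by linarith [hx.2]), abs_of_nonpos (by linarith)]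
          linarith [hx.1]
        · rw [min_eq_right hle, max_eq_left hle] at hx
          rw [abs_of_nonneg (by linarith [hx.1]), abs_of_nonneg (by linarith)]
          linarith [hx.2]
  intro j hj1 hjN s hs hst
  have h1 := key (N + 1 - j) (by omega) s hs hst
  have h2 : N + 1 - (N + 1 - j) = j := by omega
  rw [h2] at h1
  refine h1.trans ?_
  gcongr
  omega

end IsDerivChain

/-- `N` derivatives govern the decay: the oscillatory integrals with phase `R ⟨θ, Γ 0⟩` are
`O(1 / H)` as soon as at each point one of the first `N` derivatives of the phase exceeds the
corresponding power of `H`. -/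
def HasMultiscaleDecay {d : ℕ} (Γ : ℕ → ℝ → EuclideanSpace ℝ (Fin d)) (a b : ℝ) (N : ℕ) : Prop :=
  ∃ A > 0, ∀ R : ℝ, 1 ≤ R → ∀ θ : EuclideanSpace ℝ (Fin d), ‖θ‖ = 1 → ∀ H : ℝ, 0 < H →
    (∀ t ∈ Icc a b, ∃ j, 1 ≤ j ∧ j ≤ N ∧ H ^ j < R * |inner ℝ θ (Γ j t)|) →
    ∀ x ∈ Icc a b,
      ‖∫ t in a..x, Complex.exp (Complex.I * ((-R * inner ℝ θ (Γ 0 t) : ℝ) : ℂ))‖ ≤ A / H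

section Decay

variable {d : ℕ} {Γ : ℕ → ℝ → EuclideanSpace ℝ (Fin d)} {a b : ℝ}

/-- For a polynomial curve the derivative of order `N + 1` trivially keeps its sign, and where all
derivatives of lower order are small the hypothesis on `H` is violated. -/
theorem hasMultiscaleDecay_of_eq_zero (hΓ : IsDerivChain Γ a b) {N : ℕ}
    (hN : ∀ t ∈ Icc a b, Γ (N + 1) t = 0) : HasMultiscaleDecay Γ a b N := by
  refine ⟨4 ^ (N + 1) * 4 ^ (N + 1), by positivity, fun R hR θ hθ H hH h x hx => ?_⟩
  have hF := (hΓ.inner_left (-R) θ).mono (Icc_subset_Icc_right hx.2)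
  refine hF.norm_integral_exp_le_of_terminal hx.1 (by omega : 1 ≤ N + 1) hH
    (Or.inl fun t ht => ?_) le_rfl fun u v hu huv hv hle => ?_
  · simp [hN t ⟨ht.1.le, ht.2.le.trans hx.2⟩]
  · obtain ⟨j, hj1, hjN, hj⟩ := h u ⟨hu, (huv.le.trans hv).trans hx.2⟩
    have h1 := hle j hj1 (by omega) u ⟨le_rfl, huv.le⟩
    rw [abs_mul, abs_neg, abs_of_nonneg (by linarith : 0 ≤ R)] at h1
    exact absurd hj (not_lt.2 h1)

/-- The interval is cut into arcs so short that, for the given direction, one derivative of order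
`n ≤ N` stays of size comparable to `R` and so keeps its sign. -/
theorem hasMultiscaleDecay_of_lower_bound (hΓ : IsDerivChain Γ a b) {N : ℕ} {c : ℝ} (hc : 0 < c)
    (hlow : ∀ t ∈ Icc a b, ∀ θ : EuclideanSpace ℝ (Fin d), ‖θ‖ = 1 →
      ∃ n, 1 ≤ n ∧ n ≤ N ∧ c ≤ |inner ℝ θ (Γ n t)|) : HasMultiscaleDecay Γ a b N := by
  obtain ⟨C₀, hC1, hC⟩ := hΓ.exists_norm_le (N + 1)
  have hC0 : 0 < C₀ := by linarith
  set δ := c / (2 * C₀) with hδ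
  have hδ0 : 0 < δ := by positivity
  set c' := min 1 (c / (2 * C₀)) with hc'
  have hc'0 : 0 < c' := lt_min one_pos hδ0
  set L := |b - a| with hL
  set B := 4 ^ N / c' + C₀ * (4 / c + 4 * C₀ / c ^ 2 * L) with hB
  have hB0 : 0 < B := by positivity
  obtain ⟨M, hM⟩ := exists_nat_ge (L / δ)
  refine ⟨(M + 1) * (4 ^ N * B), by positivity, fun R hR θ hθ H hH h x hx => ?_⟩
  have hR0 : 0 < R := by linarith
  set F : ℕ → ℝ → ℝ := fun j t => -R * inner ℝ θ (Γ j t) with hFdef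
  have hF : IsDerivChain F a b := hΓ.inner_left (-R) θ
  have habsF : ∀ j t, |F j t| = R * |inner ℝ θ (Γ j t)| := fun j t => by
    rw [hFdef]; simp only [abs_mul, abs_neg, abs_of_pos hR0]
  have hFle : ∀ j ≤ N + 1, ∀ t ∈ Icc a b, |F j t| ≤ C₀ * R := fun j hj t ht => by
    rw [habsF, mul_comm]
    gcongr
    exact (abs_real_inner_le_norm _ _).trans (by rw [hθ, one_mul]; exact hC j hj t ht)
  have hcont : ContinuousOn (fun t => Complex.exp (Complex.I * (F 0 t : ℂ))) (Icc a b) :=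
    Complex.continuous_exp.comp_continuousOn (continuousOn_const.mul
      (Complex.continuous_ofReal.comp_continuousOn (hF.continuousOn 0)))
  have hshort : ∀ u v, a ≤ u → u ≤ v → v ≤ b → v - u ≤ δ →
      ‖∫ t in u..v, Complex.exp (Complex.I * (F 0 t : ℂ))‖ ≤ 4 ^ N * B / H := by
    intro u v hu huv hv hlen
    have hu' : u ∈ Icc a b := ⟨hu, huv.trans hv⟩
    obtain ⟨n, hn1, hnN, hn⟩ := hlow u hu' θ hθ
    have hsubs : Icc u v ⊆ Icc a b := Icc_subset_Icc hu hv
    have hF' := hF.mono hsubs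
    have hclose : ∀ t ∈ Icc u v, |F n t - F n u| ≤ c * R / 2 := by
      intro t ht
      refine (hF.abs_sub_le (M := C₀ * R) (hFle (n + 1) (by omega)) hu' (hsubs ht)).trans ?_
      rw [abs_of_nonneg (by linarith [ht.1])]
      calc C₀ * R * (t - u) ≤ C₀ * R * δ := by gcongr; linarith [ht.2]
        _ = c * R / 2 := by rw [hδ]; field_simp
    have hFu : c * R ≤ |F n u| := by rw [habsF, mul_comm]; gcongr
    have hlarge : ∀ t ∈ Icc u v, c * R / 2 ≤ |F n t| := by
      intro t ht
      have h1 := hclose t ht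
      have h2 := abs_sub_abs_le_abs_sub (F n u) (F n t)
      rw [abs_sub_comm] at h1
      linarith
    have hsign : (∀ t ∈ Ioo u v, 0 ≤ F n t) ∨ ∀ t ∈ Ioo u v, F n t ≤ 0 := by
      have hcR : 0 < c * R := by positivity
      rcases le_total 0 (F n u) with h0 | h0
      · refine Or.inl fun t ht => ?_
        rw [abs_of_nonneg h0] at hFu
        have := (abs_le.1 (hclose t (Ioo_subset_Icc_self ht))).1
        linarith
      · refine Or.inr fun t ht => ?_
        rw [abs_of_nonpos h0] at hFu
        have := (abs_le.1 (hclose t (Ioo_subset_Icc_self ht))).2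
        linarith
    have h4 : (4 : ℝ) ^ n ≤ B := by
      have h1 : (4 : ℝ) ^ n ≤ 4 ^ N := pow_le_pow_right₀ (by norm_num) hnN
      have h2 : (4 : ℝ) ^ N ≤ 4 ^ N / c' := by
        rw [le_div_iff₀ hc'0]
        exact mul_le_of_le_one_right (by positivity) (min_le_left _ _)
      have h3 : 0 ≤ C₀ * (4 / c + 4 * C₀ / c ^ 2 * L) := by positivity
      linarith
    refine (hF'.norm_integral_exp_le_of_terminal huv hn1 hH hsign h4
      fun p q hp hpq hq hle => ?_).trans ?_
    swap
    · have : (4 : ℝ) ^ n ≤ 4 ^ N := pow_le_pow_right₀ (by norm_num) hnN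
      gcongr
    have hsub' : Icc p q ⊆ Icc u v := Icc_subset_Icc hp hq
    have hF'' := hF'.mono hsub'
    -- some derivative of order at least `n` is large at `p`, which bounds `H` from above
    obtain ⟨i, hi1, hiN, hi⟩ := h p (hsubs (hsub' ⟨le_rfl, hpq.le⟩))
    rw [← habsF] at hi
    have hni : n ≤ i := by
      by_contra hlt
      exact absurd hi (not_lt.2 (hle i hi1 (not_le.1 hlt) p ⟨le_rfl, hpq.le⟩))
    have hHi : H ^ i ≤ C₀ * R := hi.le.trans (hFle i (by omega) p (hsubs (hsub' ⟨le_rfl, hpq.le⟩)))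
    have hHn : H ^ n ≤ C₀ * R := by
      rcases le_total H 1 with h1 | h1
      · have := pow_le_one₀ (n := n) hH.le h1
        nlinarith
      · exact (pow_le_pow_right₀ h1 hni).trans hHi
    have hlarge' : ∀ t ∈ Icc p q, c * R / 2 ≤ |F n t| := fun t ht => hlarge t (hsub' ht)
    obtain ⟨m, rfl⟩ : ∃ m, n = m + 1 := ⟨n - 1, by omega⟩
    rcases Nat.eq_zero_or_pos m with rfl | hm
    -- for `n = 1` the first derivative is comparable to `R` and the second one is `O(R)`, so the
    -- integral is `O(1 / R)`, and `H ≤ C₀ R`; for `n ≥ 2` the interval has length `O(1 / H)`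
    · have h1 := hF''.norm_integral_exp_le_of_bound hpq.le (by positivity : 0 < c * R / 2) hlarge'
        (fun t ht => hFle 2 (by omega) t (hsubs (hsub' ht)))
      have hqp : q - p ≤ L := by
        rw [hL]; exact (by linarith : q - p ≤ b - a).trans (le_abs_self _)
      have h2 : 2 / (c * R / 2) + C₀ * R / (c * R / 2) ^ 2 * (q - p) ≤
          (4 / c + 4 * C₀ / c ^ 2 * L) / R := by
        have e : (4 / c + 4 * C₀ / c ^ 2 * L) / R =
            2 / (c * R / 2) + C₀ * R / (c * R / 2) ^ 2 * L := by
          field_simp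
          ring
        rw [e]
        gcongr
      have h3 : (4 / c + 4 * C₀ / c ^ 2 * L) / R ≤ C₀ * (4 / c + 4 * C₀ / c ^ 2 * L) / H := by
        rw [div_le_div_iff₀ hR0 hH]
        have h5 : 0 ≤ 4 / c + 4 * C₀ / c ^ 2 * L := by positivity
        have h6 : H ≤ C₀ * R := by simpa using hHn
        nlinarith
      refine (h1.trans (h2.trans h3)).trans ?_
      gcongr
      rw [hB]
      have : 0 ≤ 4 ^ N / c' := by positivity
      linarith
    · have h1 : ∀ t ∈ Icc p q, c' * H ^ (m + 1) ≤ |F (m + 1) t| := fun t ht => by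
        refine le_trans ?_ (hlarge' t ht)
        calc c' * H ^ (m + 1) ≤ c / (2 * C₀) * (C₀ * R) := by
              gcongr
              exact min_le_right _ _
          _ = c * R / 2 := by field_simp
      have hlen := hF''.length_le hpq.le hH hm.ne' hc'0 (min_le_left _ _)
        (fun t ht => by simpa using hle 1 le_rfl (by omega) t ht) h1
      have hnorm := intervalIntegral.norm_integral_le_of_norm_le_const (a := p) (b := q) (C := 1)
        (f := fun t => Complex.exp (Complex.I * (F 0 t : ℂ))) fun t _ => by
          rw [mul_comm]; exact (Complex.norm_exp_ofReal_mul_I _).le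
      rw [one_mul, abs_of_nonneg (sub_nonneg.2 hpq.le)] at hnorm
      refine hnorm.trans (hlen.trans ?_)
      gcongr
      have h2 : (4 : ℝ) ^ m / c' ≤ 4 ^ N / c' := by
        gcongr
        · norm_num
        · omega
      have h3 : 0 ≤ C₀ * (4 / c + 4 * C₀ / c ^ 2 * L) := by positivity
      linarith
  have := (isSplitSubadditive_norm_integral hcont).le_of_short hδ0 hshort M a x le_rfl hx.1 hx.2 ?_
  · rw [mul_div_assoc]; exact this
  · have h1 : L ≤ M * δ := (div_le_iff₀ hδ0).1 hM
    have h2 : x - a ≤ L := (by linarith [hx.2] : x - a ≤ b - a).trans (le_abs_self _)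
    nlinarith

end Decay

/-! ### Surface measure of neighbourhoods of subspaces -/

section Tubes

variable {d : ℕ}

/-- The surface measure of `s` is `d` times the volume of the cone over `s` in the unit ball. -/
theorem toSphere_le_of_forall {s : Set (Metric.sphere (0 : EuclideanSpace ℝ (Fin d)) 1)}
    (hs : MeasurableSet s) {T : Set (EuclideanSpace ℝ (Fin d))}
    (h : ∀ θ ∈ s, ∀ r ∈ Ioo (0 : ℝ) 1, r • (θ : EuclideanSpace ℝ (Fin d)) ∈ T) :
    (volume : Measure (EuclideanSpace ℝ (Fin d))).toSphere s ≤ d * volume T := by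
  rw [Measure.toSphere_apply' _ hs, finrank_euclideanSpace_fin]
  gcongr
  rintro _ ⟨r, hr, _, ⟨θ, hθ, rfl⟩, rfl⟩
  exact h θ hθ r hr

/-- The parallelepiped `{|⟨x, w j⟩| ≤ ε j}` has volume `∏ 2 ε j / |det w|`. -/
theorem volume_setOf_abs_inner_le_of_det_ne_zero {w : Fin d → EuclideanSpace ℝ (Fin d)}
    (hw : (Matrix.of fun i j => w i j).det ≠ 0) {ε : Fin d → ℝ} (hε : ∀ j, 0 ≤ ε j) :
    volume {x : EuclideanSpace ℝ (Fin d) | ∀ j, |inner ℝ x (w j)| ≤ ε j} =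
      ENNReal.ofReal (|(Matrix.of fun i j => w i j).det|⁻¹ * 2 ^ d * ∏ j, ε j) := by
  set M : Matrix (Fin d) (Fin d) ℝ := Matrix.of fun i j => w i j with hM
  have hdet : LinearMap.det (Matrix.toLin' M) ≠ 0 := by rwa [LinearMap.det_toLin']
  have hset : {x : EuclideanSpace ℝ (Fin d) | ∀ j, |inner ℝ x (w j)| ≤ ε j} =
      (@WithLp.ofLp 2 (Fin d → ℝ)) ⁻¹' (Matrix.toLin' M ⁻¹' Icc (-ε) ε) := by
    ext x
    simp only [mem_ofPred_eq, mem_preimage, mem_Icc, Pi.le_def, Pi.neg_apply, ← forall_and]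
    refine forall_congr' fun j => ?_
    rw [abs_le]
    have : inner ℝ x (w j) = (Matrix.toLin' M) x.ofLp j := by
      simp [PiLp.inner_apply, Matrix.toLin'_apply, Matrix.mulVec, dotProduct, hM]
    rw [this]
  have hmeas : MeasurableSet (Matrix.toLin' M ⁻¹' Icc (-ε) ε) :=
    (LinearMap.continuous_of_finiteDimensional (Matrix.toLin' M)).measurable measurableSet_Icc
  rw [hset, (PiLp.volume_preserving_ofLp (Fin d)).measure_preimage hmeas.nullMeasurableSet,
    Measure.addHaar_preimage_linearMap _ hdet, Real.volume_Icc_pi, LinearMap.det_toLin']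
  simp only [Pi.neg_apply, sub_neg_eq_add, ← two_mul]
  rw [← ENNReal.ofReal_prod_of_nonneg (fun j _ => by have := hε j; positivity),
    ← ENNReal.ofReal_mul (abs_nonneg _), Finset.prod_mul_distrib]
  simp [abs_inv, mul_assoc]

/-- The part of the unit ball where `k` linearly independent coordinates are small, with a constant
that is locally uniform in the coordinates. The family is completed to a basis one vector at a
time; the added coordinates are bounded on the ball. -/
theorem eventually_volume_tube_le {S : Set ℝ} {t₀ : ℝ} (n : ℕ) :
    ∀ (k : ℕ), k + n = d → ∀ v : ℝ → Fin k → EuclideanSpace ℝ (Fin d),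
      (∀ j, ContinuousWithinAt (fun t => v t j) S t₀) → LinearIndependent ℝ (v t₀) →
      ∃ C : ℝ, 0 < C ∧ ∀ᶠ t in 𝓝[S] t₀, ∀ ε : Fin k → ℝ, (∀ j, 0 ≤ ε j) →
        volume {x : EuclideanSpace ℝ (Fin d) | ‖x‖ ≤ 1 ∧ ∀ j, |inner ℝ x (v t j)| ≤ ε j} ≤
          ENNReal.ofReal (C * ∏ j, ε j) := by
  induction n with
  | zero =>
    intro k hk v hv hind
    obtain rfl : k = d := by omega
    set D : ℝ → ℝ := fun t => (Matrix.of fun i j => v t i j).det with hD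
    have hD0 : D t₀ ≠ 0 := by
      rw [hD]
      have h1 : LinearIndependent ℝ (Matrix.of fun i j => v t₀ i j).row := by
        have := hind.map' (WithLp.linearEquiv 2 ℝ (Fin k → ℝ)).toLinearMap
          (LinearEquiv.ker _)
        exact this
      have h2 := Matrix.linearIndependent_rows_iff_isUnit.1 h1
      exact ((Matrix.isUnit_iff_isUnit_det _).1 h2).ne_zero
    have hcont : ContinuousWithinAt D S t₀ := by
      have h1 : ContinuousWithinAt (fun t => (Matrix.of fun i j => v t i j)) S t₀ := by
        refine continuousWithinAt_pi.2 fun i => continuousWithinAt_pi.2 fun j => ?_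
        exact (EuclideanSpace.proj (𝕜 := ℝ) j).continuous.continuousAt.comp_continuousWithinAt (hv i)
      have h2 : Continuous fun A : Matrix (Fin k) (Fin k) ℝ => A.det := continuous_id.matrix_det
      exact h2.continuousAt.comp_continuousWithinAt h1
    have hpos : 0 < |D t₀| := abs_pos.2 hD0
    refine ⟨(|D t₀| / 2)⁻¹ * 2 ^ k, by positivity, ?_⟩
    filter_upwards [hcont.abs.eventually (lt_mem_nhds (half_lt_self hpos))] with t ht ε hε
    have hDt : D t ≠ 0 := fun h => by
      simp only [h, abs_zero] at ht
      linarith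
    refine (measure_mono (t := {x | ∀ j, |inner ℝ x (v t j)| ≤ ε j}) fun x hx => hx.2).trans ?_
    rw [volume_setOf_abs_inner_le_of_det_ne_zero hDt hε]
    have hP : 0 ≤ ∏ j, ε j := Finset.prod_nonneg fun j _ => hε j
    have : |D t|⁻¹ ≤ (|D t₀| / 2)⁻¹ := inv_anti₀ (by positivity) (le_of_lt ht)
    gcongr
  | succ n ih =>
    intro k hk v hv hind
    obtain ⟨w, hw⟩ := exists_linearIndependent_snoc_of_lt_finrank hind
      (by rw [finrank_euclideanSpace_fin]; omega)
    obtain ⟨C, hC, hev⟩ := ih (k + 1) (by omega) (fun t => Fin.snoc (v t) w) (fun j => by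
      refine Fin.lastCases ?_ (fun j => ?_) j
      · simpa using continuousWithinAt_const
      · simpa using hv j) hw
    have hC' : 0 < C * (‖w‖ + 1) := by positivity
    refine ⟨C * (‖w‖ + 1), hC', ?_⟩
    filter_upwards [hev] with t ht ε hε
    have h1 := ht (Fin.snoc ε (‖w‖ + 1)) (fun j => by
      refine Fin.lastCases ?_ (fun j => ?_) j
      · simp only [Fin.snoc_last]; positivity
      · simpa using hε j)
    rw [Fin.prod_univ_castSucc] at h1
    simp only [Fin.snoc_castSucc, Fin.snoc_last] at h1
    have h2 : C * (‖w‖ + 1) * ∏ j, ε j = C * ((∏ j, ε j) * (‖w‖ + 1)) := by ring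
    rw [h2]
    refine le_trans (measure_mono ?_) h1
    rintro x ⟨hx1, hx2⟩
    refine ⟨hx1, fun j => ?_⟩
    refine Fin.lastCases ?_ (fun j => ?_) j
    · simp only [Fin.snoc_last]
      refine (abs_real_inner_le_norm _ _).trans ?_
      nlinarith [norm_nonneg w]
    · simpa using hx2 j

/-- The unit vectors nearly orthogonal to `k` linearly independent vectors, with a constant uniform
along a compact family of such vectors. -/
theorem exists_toSphere_tube_le {a b : ℝ} {k : ℕ}
    {v : ℝ → Fin k → EuclideanSpace ℝ (Fin d)}
    (hv : ∀ j, ContinuousOn (fun t => v t j) (Icc a b))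
    (hind : ∀ t ∈ Icc a b, LinearIndependent ℝ (v t)) :
    ∃ C : ℝ, 0 < C ∧ ∀ t ∈ Icc a b, ∀ ε : Fin k → ℝ, (∀ j, 0 ≤ ε j) →
      (volume : Measure (EuclideanSpace ℝ (Fin d))).toSphere
        {θ | ∀ j, |inner ℝ (θ : EuclideanSpace ℝ (Fin d)) (v t j)| ≤ ε j} ≤
          ENNReal.ofReal (C * ∏ j, ε j) := by
  have key : ∃ C : ℝ, 0 < C ∧ ∀ t ∈ Icc a b, ∀ ε : Fin k → ℝ, (∀ j, 0 ≤ ε j) →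
      volume {x : EuclideanSpace ℝ (Fin d) | ‖x‖ ≤ 1 ∧ ∀ j, |inner ℝ x (v t j)| ≤ ε j} ≤
          ENNReal.ofReal (C * ∏ j, ε j) := by
    refine isCompact_Icc.induction_on (p := fun s => ∃ C : ℝ, 0 < C ∧ ∀ t ∈ s,
      ∀ ε : Fin k → ℝ, (∀ j, 0 ≤ ε j) →
      volume {x : EuclideanSpace ℝ (Fin d) | ‖x‖ ≤ 1 ∧ ∀ j, |inner ℝ x (v t j)| ≤ ε j} ≤
          ENNReal.ofReal (C * ∏ j, ε j)) ?_ ?_ ?_ ?_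
    · exact ⟨1, one_pos, by simp⟩
    · rintro s t hst ⟨C, hC, H⟩
      exact ⟨C, hC, fun x hx => H x (hst hx)⟩
    · rintro s t ⟨C, hC, H⟩ ⟨C', hC', H'⟩
      refine ⟨max C C', lt_max_of_lt_left hC, fun x hx ε hε => ?_⟩
      have hP : 0 ≤ ∏ j, ε j := Finset.prod_nonneg fun j _ => hε j
      rcases hx with hx | hx
      · exact (H x hx ε hε).trans (ENNReal.ofReal_le_ofReal
          (mul_le_mul_of_nonneg_right (le_max_left _ _) hP))
      · exact (H' x hx ε hε).trans (ENNReal.ofReal_le_ofReal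
          (mul_le_mul_of_nonneg_right (le_max_right _ _) hP))
    · intro t ht
      have hkd : k ≤ d := by
        have := (hind t ht).fintype_card_le_finrank
        simpa using this
      obtain ⟨C, hC, hev⟩ := eventually_volume_tube_le (S := Icc a b) (t₀ := t) (d - k) k (by omega)
        v (fun j => hv j t ht) (hind t ht)
      exact ⟨_, hev, C, hC, fun x hx => hx⟩
  obtain ⟨C, hC, H⟩ := key
  refine ⟨(d + 1) * C, by positivity, fun t ht ε hε => ?_⟩
  have hmeas : MeasurableSet {θ : Metric.sphere (0 : EuclideanSpace ℝ (Fin d)) 1 |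
      ∀ j, |inner ℝ (θ : EuclideanSpace ℝ (Fin d)) (v t j)| ≤ ε j} := by
    simp only [ofPred_forall]
    refine MeasurableSet.iInter fun j => measurableSet_le ?_ measurable_const
    exact ((continuous_subtype_val.inner continuous_const).abs).measurable
  refine (toSphere_le_of_forall hmeas (T := {x | ‖x‖ ≤ 1 ∧ ∀ j, |inner ℝ x (v t j)| ≤ ε j})
    fun θ hθ r hr => ⟨?_, fun j => ?_⟩).trans ?_
  · rw [norm_smul, norm_eq_of_mem_sphere θ, mul_one, Real.norm_of_nonneg hr.1.le]
    exact hr.2.le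
  · rw [real_inner_smul_left, abs_mul, abs_of_pos hr.1]
    have := hθ j
    nlinarith [hr.1, hr.2, abs_nonneg (inner ℝ (θ : EuclideanSpace ℝ (Fin d)) (v t j))]
  · have hP : 0 ≤ ∏ j, ε j := Finset.prod_nonneg fun j _ => hε j
    calc (d : ENNReal) * volume {x | ‖x‖ ≤ 1 ∧ ∀ j, |inner ℝ x (v t j)| ≤ ε j}
        ≤ ENNReal.ofReal d * ENNReal.ofReal (C * ∏ j, ε j) := by
          rw [ENNReal.ofReal_natCast]
          gcongr
          exact H t ht ε hε
      _ = ENNReal.ofReal (d * (C * ∏ j, ε j)) := (ENNReal.ofReal_mul (by positivity)).symm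
      _ ≤ _ := by
          apply ENNReal.ofReal_le_ofReal
          rw [← mul_assoc]
          gcongr
          linarith

end Tubes

/-! ### Level sets of the Fourier transform -/

theorem breakpoint_succ (k : ℕ) : breakpoint (k + 1) = breakpoint k + (k + 1) := by
  have : (k + 1) ^ 2 + (k + 1) + 2 = k ^ 2 + k + 2 + (k + 1) * 2 := by ring
  rw [breakpoint, breakpoint, this, Nat.add_mul_div_right _ _ two_pos]

/-- The origin of the breakpoints: `q_k = 1 + (1 + 2 + ⋯ + k)`. -/
theorem mul_prod_pow_succ_eq_pow_breakpoint (Λ : ℝ) (k : ℕ) :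
    Λ * ∏ j : Fin k, Λ ^ ((j : ℕ) + 1) = Λ ^ breakpoint k := by
  induction k with
  | zero => simp [breakpoint]
  | succ k ih =>
    rw [Fin.prod_univ_castSucc, ← mul_assoc]
    simp only [Fin.val_castSucc, Fin.val_last]
    rw [ih, ← pow_add, breakpoint_succ]

/-- Smallness at scale `Λ` of the first `N` derivatives of the phase at a point persists, up to a
constant, at distance `1 / Λ`. -/
def HasMultiscaleStability {d : ℕ} (Γ : ℕ → ℝ → EuclideanSpace ℝ (Fin d)) (a b : ℝ)
    (N : ℕ) : Prop :=
  ∃ C > 0, ∀ R : ℝ, 1 ≤ R → ∀ θ : EuclideanSpace ℝ (Fin d), ‖θ‖ = 1 → ∀ Λ : ℝ, 1 ≤ Λ →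
    ∀ t ∈ Icc a b, (∀ j, 1 ≤ j → j ≤ N → R * |inner ℝ θ (Γ j t)| ≤ Λ ^ j) →
    ∀ s ∈ Icc a b, |s - t| ≤ 1 / Λ → ∀ j, 1 ≤ j → j ≤ N → R * |inner ℝ θ (Γ j s)| ≤ C * Λ ^ j

section

variable {d : ℕ} {Γ : ℕ → ℝ → EuclideanSpace ℝ (Fin d)} {a b : ℝ}

theorem hasMultiscaleStability_of_bound (hΓ : IsDerivChain Γ a b) {N : ℕ} {C : ℝ} (hC : 0 ≤ C)
    (h : ∀ R : ℝ, 1 ≤ R → ∀ θ : EuclideanSpace ℝ (Fin d), ‖θ‖ = 1 → ∀ Λ : ℝ, 1 ≤ Λ →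
      ∀ t ∈ Icc a b, (∀ j, 1 ≤ j → j ≤ N → R * |inner ℝ θ (Γ j t)| ≤ Λ ^ j) →
      ∀ s ∈ Icc a b, R * |inner ℝ θ (Γ (N + 1) s)| ≤ C * Λ ^ (N + 1)) :
    HasMultiscaleStability Γ a b N := by
  refine ⟨C + N + 1, by positivity, fun R hR θ hθ Λ hΛ t ht hsmall s hs hst j hj1 hjN => ?_⟩
  have hR0 : 0 ≤ R := by linarith
  have hF := hΓ.inner_left R θ
  have habs : ∀ j t, |R * inner ℝ θ (Γ j t)| = R * |inner ℝ θ (Γ j t)| := fun j t => by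
    rw [abs_mul, abs_of_nonneg hR0]
  have h1 := hF.abs_le_of_dist_le (by linarith : 0 < Λ) hC
    (fun x hx => by rw [habs]; exact h R hR θ hθ Λ hΛ t ht hsmall x hx) ht
    (fun j h1 h2 => by rw [habs]; exact hsmall j h1 h2) j hj1 hjN s hs hst
  rw [habs] at h1
  exact h1.trans (mul_le_mul_of_nonneg_right (by linarith) (by positivity))

theorem hasMultiscaleStability_of_eq_zero (hΓ : IsDerivChain Γ a b) {N : ℕ}
    (hN : ∀ t ∈ Icc a b, Γ (N + 1) t = 0) : HasMultiscaleStability Γ a b N :=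
  hasMultiscaleStability_of_bound hΓ le_rfl fun R _ θ _ Λ _ t _ _ s hs => by simp [hN s hs]

theorem hasMultiscaleStability_of_lower_bound (hΓ : IsDerivChain Γ a b) {N : ℕ} {c : ℝ}
    (hc : 0 < c) (hlow : ∀ t ∈ Icc a b, ∀ θ : EuclideanSpace ℝ (Fin d), ‖θ‖ = 1 →
      ∃ n, 1 ≤ n ∧ n ≤ N ∧ c ≤ |inner ℝ θ (Γ n t)|) : HasMultiscaleStability Γ a b N := by
  obtain ⟨C₀, hC1, hC⟩ := hΓ.exists_norm_le (N + 1)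
  have hC0 : 0 ≤ C₀ := by linarith
  refine hasMultiscaleStability_of_bound hΓ (C := C₀ / c) (by positivity)
    fun R hR θ hθ Λ hΛ t ht hsmall s hs => ?_
  obtain ⟨n, hn1, hnN, hn⟩ := hlow t ht θ hθ
  have h1 : R * c ≤ Λ ^ (N + 1) :=
    calc R * c ≤ R * |inner ℝ θ (Γ n t)| := by gcongr
      _ ≤ Λ ^ n := hsmall n hn1 hnN
      _ ≤ Λ ^ (N + 1) := pow_le_pow_right₀ hΛ (by omega)
  have h2 : |inner ℝ θ (Γ (N + 1) s)| ≤ C₀ :=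
    (abs_real_inner_le_norm _ _).trans (by rw [hθ, one_mul]; exact hC _ le_rfl s hs)
  calc R * |inner ℝ θ (Γ (N + 1) s)| ≤ R * C₀ := by gcongr
    _ = C₀ / c * (R * c) := by field_simp
    _ ≤ C₀ / c * Λ ^ (N + 1) := by gcongr

variable {γ : ℝ → EuclideanSpace ℝ (Fin d)} {χ : ℝ → ℂ}

theorem muHat_smul_eq (hΓ0 : ∀ t ∈ Icc a b, Γ 0 t = γ t) (hab : a ≤ b)
    (hsupp : tsupport χ ⊆ Ioo a b) (R : ℝ) (θ : EuclideanSpace ℝ (Fin d)) :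
    muHat γ χ (R • θ) =
      ∫ t in a..b, χ t * Complex.exp (Complex.I * ((-R * inner ℝ θ (Γ 0 t) : ℝ) : ℂ)) := by
  rw [muHat, ← intervalIntegral.integral_eq_integral_of_support_subset (a := a) (b := b)]
  · refine intervalIntegral.integral_congr fun t ht => ?_
    rw [uIcc_of_le hab] at ht
    simp only [hΓ0 t ht, real_inner_smul_left]
    rw [mul_comm]
    congr 2
    push_cast
    ring
  · refine (Function.support_mul_subset_right _ _).trans ?_
    exact (subset_tsupport χ).trans (hsupp.trans Ioo_subset_Ioc_self)

theorem continuousOn_exp_phase (hΓ : IsDerivChain Γ a b) (R : ℝ) (θ : EuclideanSpace ℝ (Fin d)) :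
    ContinuousOn (fun t => Complex.exp (Complex.I * ((-R * inner ℝ θ (Γ 0 t) : ℝ) : ℂ)))
      (Icc a b) :=
  Complex.continuous_exp.comp_continuousOn (continuousOn_const.mul
    (Complex.continuous_ofReal.comp_continuousOn ((hΓ.inner_left (-R) θ).continuousOn 0)))

/-- An amplitude of bounded variation can be removed from an oscillatory integral. -/
theorem norm_integral_amplitude_le {g : ℝ → ℂ} {u v B : ℝ} (huv : u ≤ v)
    (hg : ContinuousOn g (Icc u v)) (hχ : ContDiff ℝ ∞ χ)
    (hB : ∀ x ∈ Icc u v, ‖∫ t in u..x, g t‖ ≤ B) :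
    ‖∫ t in u..v, χ t * g t‖ ≤ B * (‖χ v‖ + ∫ t in u..v, ‖deriv χ t‖) := by
  have hgi : IntervalIntegrable g volume u v := hg.intervalIntegrable_of_Icc huv
  have hdc : Continuous (deriv χ) := hχ.continuous_deriv (by simp)
  have hprim := intervalIntegral.continuousOn_primitive_interval' hgi left_mem_uIcc
  have hparts := intervalIntegral.integral_mul_deriv_eq_deriv_mul_of_hasDerivAt
    (a := u) (b := v) (u := χ) (v := fun x => ∫ t in u..x, g t) (u' := deriv χ) (v' := g)
    hχ.continuous.continuousOn hprim
    (fun x _ => (hχ.differentiable (by simp) x).hasDerivAt)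
    (fun x hx => by
      rw [min_eq_left huv, max_eq_right huv] at hx
      refine intervalIntegral.integral_hasDerivAt_right ?_ ?_ ?_
      · exact hgi.mono_set (by
          rw [uIcc_of_le hx.1.le, uIcc_of_le huv]; exact Icc_subset_Icc_right hx.2.le)
      · exact ContinuousOn.stronglyMeasurableAtFilter isOpen_Ioo
          (hg.mono Ioo_subset_Icc_self) x hx
      · exact (hg.mono Ioo_subset_Icc_self).continuousAt (Ioo_mem_nhds hx.1 hx.2))
    (hdc.intervalIntegrable _ _) hgi
  rw [uIcc_of_le huv] at hprim
  rw [hparts]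
  simp only [intervalIntegral.integral_same, mul_zero, sub_zero]
  have h1 : ‖∫ t in u..v, deriv χ t * ∫ s in u..t, g s‖ ≤ B * ∫ t in u..v, ‖deriv χ t‖ := by
    refine (intervalIntegral.norm_integral_le_integral_norm huv).trans ?_
    rw [← intervalIntegral.integral_const_mul]
    refine intervalIntegral.integral_mono_on huv ?_ ?_ fun t ht => ?_
    · exact (hdc.continuousOn.mul hprim).norm.intervalIntegrable_of_Icc huv
    · exact (continuous_const.mul hdc.norm).intervalIntegrable _ _
    · rw [norm_mul, mul_comm]
      exact mul_le_mul_of_nonneg_right (hB t ht) (norm_nonneg _)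
  have h2 : ‖χ v * ∫ t in u..v, g t‖ ≤ B * ‖χ v‖ := by
    rw [norm_mul, mul_comm]
    exact mul_le_mul_of_nonneg_right (hB v ⟨huv, le_rfl⟩) (norm_nonneg _)
  calc _ ≤ _ := norm_sub_le _ _
    _ ≤ B * ‖χ v‖ + B * ∫ t in u..v, ‖deriv χ t‖ := add_le_add h2 h1
    _ = _ := by ring

theorem norm_muHat_smul_le (hΓ : IsDerivChain Γ a b) (hΓ0 : ∀ t ∈ Icc a b, Γ 0 t = γ t)
    (hab : a ≤ b) (hχ : ContDiff ℝ ∞ χ) (hsupp : tsupport χ ⊆ Ioo a b) {R B : ℝ}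
    {θ : EuclideanSpace ℝ (Fin d)}
    (hB : ∀ x ∈ Icc a b,
      ‖∫ t in a..x, Complex.exp (Complex.I * ((-R * inner ℝ θ (Γ 0 t) : ℝ) : ℂ))‖ ≤ B) :
    ‖muHat γ χ (R • θ)‖ ≤ B * ∫ t in a..b, ‖deriv χ t‖ := by
  have hχb : χ b = 0 := by
    by_contra h
    exact lt_irrefl b (hsupp (subset_tsupport χ h)).2
  rw [muHat_smul_eq hΓ0 hab hsupp]
  have := norm_integral_amplitude_le hab (continuousOn_exp_phase hΓ R θ) hχ hB
  rwa [hχb, norm_zero, zero_add] at this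

theorem norm_muHat_le (γ : ℝ → EuclideanSpace ℝ (Fin d)) (χ : ℝ → ℂ)
    (ξ : EuclideanSpace ℝ (Fin d)) : ‖muHat γ χ ξ‖ ≤ ∫ t, ‖χ t‖ := by
  refine (norm_integral_le_integral_norm _).trans_eq ?_
  congr 1
  ext t
  rw [norm_mul, ← mul_neg, mul_comm Complex.I, ← Complex.ofReal_neg, Complex.norm_exp_ofReal_mul_I,
    one_mul]

/-- Where the Fourier transform is of size `A / Λ`, the phase is nearly degenerate at scale `Λ` at
some point of the curve. -/
theorem exists_degenerate_point (hΓ : IsDerivChain Γ a b) (hΓ0 : ∀ t ∈ Icc a b, Γ 0 t = γ t)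
    (hab : a ≤ b) (hχ : ContDiff ℝ ∞ χ) (hsupp : tsupport χ ⊆ Ioo a b) {N : ℕ}
    (hdec : HasMultiscaleDecay Γ a b N) :
    ∃ A > 0, ∀ R : ℝ, 1 ≤ R → ∀ θ : EuclideanSpace ℝ (Fin d), ‖θ‖ = 1 → muHat γ χ (R • θ) ≠ 0 →
      1 ≤ A / ‖muHat γ χ (R • θ)‖ ∧ ∃ t ∈ Icc a b, ∀ j, 1 ≤ j → j ≤ N →
        R * |inner ℝ θ (Γ j t)| ≤ (A / ‖muHat γ χ (R • θ)‖) ^ j := by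
  obtain ⟨A, hA, H⟩ := hdec
  set D := ∫ t in a..b, ‖deriv χ t‖ with hD
  have hD0 : 0 ≤ D := intervalIntegral.integral_nonneg hab fun _ _ => norm_nonneg _
  set M := ∫ t, ‖χ t‖ with hM
  have hM0 : 0 ≤ M := integral_nonneg fun _ => norm_nonneg _
  refine ⟨A * D + M + 1, by positivity, fun R hR θ hθ hne => ?_⟩
  set z := ‖muHat γ χ (R • θ)‖ with hz
  have hz0 : 0 < z := norm_pos_iff.2 hne
  have hzM : z ≤ M := norm_muHat_le γ χ _
  have hAD : 0 ≤ A * D := by positivity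
  refine ⟨by rw [one_le_div hz0]; linarith, ?_⟩
  by_contra hcon
  push Not at hcon
  have h1 := norm_muHat_smul_le hΓ hΓ0 hab hχ hsupp
    (H R hR θ hθ ((A * D + M + 1) / z) (by positivity) hcon)
  rw [← hz, ← hD] at h1
  have h2 : A / ((A * D + M + 1) / z) * D = z * (A * D / (A * D + M + 1)) := by
    field_simp
  have h3 : A * D / (A * D + M + 1) < 1 := by rw [div_lt_one (by positivity)]; linarith
  rw [h2] at h1
  nlinarith

/-- Weak-type estimate at the breakpoint `q_k`: the degenerate directions at scale `Λ` are covered by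
`O(Λ)` neighbourhoods of subspaces of codimension `k`. -/
theorem exists_toSphere_level_le (hΓ : IsDerivChain Γ a b) (hΓ0 : ∀ t ∈ Icc a b, Γ 0 t = γ t)
    (hab : a < b) (hχ : ContDiff ℝ ∞ χ) (hsupp : tsupport χ ⊆ Ioo a b) {N k : ℕ}
    (hdec : HasMultiscaleDecay Γ a b N) (hstab : HasMultiscaleStability Γ a b N) (hkN : k ≤ N)
    (hind : ∀ t ∈ Icc a b, LinearIndependent ℝ (fun j : Fin k => Γ ((j : ℕ) + 1) t)) :
    ∃ C : ℝ, 0 < C ∧ ∀ R : ℝ, 1 ≤ R → ∀ l : ℝ, 0 < l →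
      (volume : Measure (EuclideanSpace ℝ (Fin d))).toSphere
        {θ | l < ‖muHat γ χ (R • (θ : EuclideanSpace ℝ (Fin d)))‖} ≤
          ENNReal.ofReal (C * (R ^ k)⁻¹ * (l ^ breakpoint k)⁻¹) := by
  obtain ⟨A, hA, HA⟩ := exists_degenerate_point hΓ hΓ0 hab.le hχ hsupp hdec
  obtain ⟨C₁, hC1, H1⟩ := hstab
  obtain ⟨C₂, hC2, H2⟩ := exists_toSphere_tube_le (v := fun t j => Γ ((j : ℕ) + 1) t)
    (fun j => hΓ.continuousOn _) hind
  have hL : 0 < b - a := sub_pos.2 hab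
  refine ⟨(b - a + 1) * C₂ * C₁ ^ k * A ^ breakpoint k, by positivity, fun R hR l hl => ?_⟩
  have hR0 : 0 < R := by linarith
  set Λ := A / l with hΛ
  have hΛ0 : 0 < Λ := by positivity
  have hstep : ∀ θ : Metric.sphere (0 : EuclideanSpace ℝ (Fin d)) 1,
      l < ‖muHat γ χ (R • (θ : EuclideanSpace ℝ (Fin d)))‖ → 1 ≤ Λ ∧ ∃ t ∈ Icc a b,
        ∀ j, 1 ≤ j → j ≤ N → R * |inner ℝ (θ : EuclideanSpace ℝ (Fin d)) (Γ j t)| ≤ Λ ^ j := by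
    intro θ hθ
    have hz0 : 0 < ‖muHat γ χ (R • (θ : EuclideanSpace ℝ (Fin d)))‖ := hl.trans hθ
    obtain ⟨h1, t, ht, h2⟩ := HA R hR θ (norm_eq_of_mem_sphere θ) (norm_pos_iff.1 hz0)
    have hle : A / ‖muHat γ χ (R • (θ : EuclideanSpace ℝ (Fin d)))‖ ≤ Λ := by
      rw [hΛ]; gcongr
    refine ⟨h1.trans hle, t, ht, fun j hj1 hjN => (h2 j hj1 hjN).trans ?_⟩
    gcongr
  by_cases hΛ1 : 1 ≤ Λ
  swap
  · have : {θ : Metric.sphere (0 : EuclideanSpace ℝ (Fin d)) 1 |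
        l < ‖muHat γ χ (R • (θ : EuclideanSpace ℝ (Fin d)))‖} = ∅ :=
      eq_empty_of_forall_notMem fun θ hθ => hΛ1 (hstep θ hθ).1
    rw [this, measure_empty]
    exact zero_le
  -- the points `a + m / Λ` with `m ≤ n` are a `1 / Λ`-net of `[a, b]`
  set n := ⌊(b - a) * Λ⌋₊ with hn
  set T : ℕ → Set (Metric.sphere (0 : EuclideanSpace ℝ (Fin d)) 1) := fun m =>
    {θ | ∀ j : Fin k, |inner ℝ (θ : EuclideanSpace ℝ (Fin d)) (Γ ((j : ℕ) + 1) (a + m / Λ))| ≤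
      C₁ * Λ ^ ((j : ℕ) + 1) / R} with hT
  have hcover : {θ : Metric.sphere (0 : EuclideanSpace ℝ (Fin d)) 1 |
      l < ‖muHat γ χ (R • (θ : EuclideanSpace ℝ (Fin d)))‖} ⊆
      ⋃ m ∈ Finset.range (n + 1), T m := by
    intro θ hθ
    obtain ⟨-, t, ht, hsmall⟩ := hstep θ hθ
    have hta : 0 ≤ t - a := sub_nonneg.2 ht.1
    set m := ⌊(t - a) * Λ⌋₊ with hm
    have hmn : m ≤ n := Nat.floor_mono (by gcongr; exact ht.2)
    have hm1 : (m : ℝ) ≤ (t - a) * Λ := Nat.floor_le (by positivity)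
    have hm2 : (t - a) * Λ < m + 1 := Nat.lt_floor_add_one _
    have hm1' : (m : ℝ) / Λ ≤ t - a := (div_le_iff₀ hΛ0).2 hm1
    have hm2' : t - a < (m + 1) / Λ := (lt_div_iff₀ hΛ0).2 hm2
    rw [add_div] at hm2'
    have hm0 : (0 : ℝ) ≤ m / Λ := by positivity
    refine mem_biUnion (Finset.mem_coe.2 (Finset.mem_range.2 (Nat.lt_succ_of_le hmn))) fun j => ?_
    have h1 := H1 R hR θ (norm_eq_of_mem_sphere θ) Λ hΛ1 t ht hsmall (a + m / Λ)
      ⟨by linarith, by linarith [ht.2]⟩ (by rw [abs_le]; constructor <;> linarith)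
      ((j : ℕ) + 1) (by omega) (by have := j.2; omega)
    rw [le_div_iff₀ hR0, mul_comm]
    exact h1
  have hTm : ∀ m ∈ Finset.range (n + 1),
      (volume : Measure (EuclideanSpace ℝ (Fin d))).toSphere (T m) ≤
        ENNReal.ofReal (C₂ * ∏ j : Fin k, C₁ * Λ ^ ((j : ℕ) + 1) / R) := by
    intro m hm
    have hmn : m ≤ n := Nat.lt_succ_iff.1 (Finset.mem_range.1 hm)
    have h1 : (m : ℝ) ≤ (b - a) * Λ :=
      (Nat.cast_le.2 hmn).trans (Nat.floor_le (by positivity))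
    have h2 : (m : ℝ) / Λ ≤ b - a := (div_le_iff₀ hΛ0).2 h1
    have h3 : (0 : ℝ) ≤ m / Λ := by positivity
    exact H2 (a + m / Λ) ⟨by linarith, by linarith⟩ _ fun j => by positivity
  have hP : 0 ≤ C₂ * ∏ j : Fin k, C₁ * Λ ^ ((j : ℕ) + 1) / R := by positivity
  calc _ ≤ _ := measure_mono hcover
    _ ≤ ∑ m ∈ Finset.range (n + 1),
        (volume : Measure (EuclideanSpace ℝ (Fin d))).toSphere (T m) :=
      measure_biUnion_finset_le _ _
    _ ≤ ∑ m ∈ Finset.range (n + 1),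
        ENNReal.ofReal (C₂ * ∏ j : Fin k, C₁ * Λ ^ ((j : ℕ) + 1) / R) :=
      Finset.sum_le_sum hTm
    _ = ENNReal.ofReal ((n + 1) * (C₂ * ∏ j : Fin k, C₁ * Λ ^ ((j : ℕ) + 1) / R)) := by
      rw [Finset.sum_const, Finset.card_range, nsmul_eq_mul, ← Nat.cast_succ,
        ENNReal.ofReal_mul (Nat.cast_nonneg _), ENNReal.ofReal_natCast]
    _ ≤ ENNReal.ofReal ((b - a + 1) * Λ * (C₂ * ∏ j : Fin k, C₁ * Λ ^ ((j : ℕ) + 1) / R)) := by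
      apply ENNReal.ofReal_le_ofReal
      gcongr
      have : (n : ℝ) ≤ (b - a) * Λ := Nat.floor_le (by positivity)
      linarith
    _ = _ := by
      congr 1
      have h1 : ∏ j : Fin k, C₁ * Λ ^ ((j : ℕ) + 1) / R =
          C₁ ^ k * (∏ j : Fin k, Λ ^ ((j : ℕ) + 1)) * (R ^ k)⁻¹ := by
        rw [Finset.prod_div_distrib, Finset.prod_mul_distrib]
        simp [div_eq_mul_inv]
      have h2 := mul_prod_pow_succ_eq_pow_breakpoint Λ k
      have h3 : Λ ^ breakpoint k = A ^ breakpoint k * (l ^ breakpoint k)⁻¹ := by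
        rw [hΛ, div_pow, div_eq_mul_inv]
      rw [h1]
      calc _ = (b - a + 1) * C₂ * C₁ ^ k * (Λ * ∏ j : Fin k, Λ ^ ((j : ℕ) + 1)) * (R ^ k)⁻¹ := by
            ring
        _ = _ := by rw [h2, h3]; ring

/-- If `n` derivatives control every direction, the scale `Λ` at a degenerate point satisfies
`R ≲ Λ ^ n`. -/
theorem exists_norm_muHat_le_rpow (hΓ : IsDerivChain Γ a b) (hΓ0 : ∀ t ∈ Icc a b, Γ 0 t = γ t)
    (hab : a ≤ b) (hχ : ContDiff ℝ ∞ χ) (hsupp : tsupport χ ⊆ Ioo a b) {N n : ℕ} (hn : n ≠ 0)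
    (hnN : n ≤ N) (hdec : HasMultiscaleDecay Γ a b N) {c : ℝ} (hc : 0 < c)
    (hlow : ∀ t ∈ Icc a b, ∀ θ : EuclideanSpace ℝ (Fin d), ‖θ‖ = 1 →
      ∃ j, 1 ≤ j ∧ j ≤ n ∧ c ≤ |inner ℝ θ (Γ j t)|) :
    ∃ C : ℝ, 0 < C ∧ ∀ R : ℝ, 1 ≤ R → ∀ θ : EuclideanSpace ℝ (Fin d), ‖θ‖ = 1 →
      ‖muHat γ χ (R • θ)‖ ≤ C * R ^ (-(1 / (n : ℝ))) := by
  obtain ⟨A, hA, HA⟩ := exists_degenerate_point hΓ hΓ0 hab hχ hsupp hdec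
  refine ⟨A * c ^ (-(1 / (n : ℝ))), by positivity, fun R hR θ hθ => ?_⟩
  have hR0 : 0 < R := by linarith
  by_cases hz : muHat γ χ (R • θ) = 0
  · rw [hz, norm_zero]; positivity
  obtain ⟨h1, t, ht, h2⟩ := HA R hR θ hθ hz
  have hz0 := norm_pos_iff.2 hz
  set z := ‖muHat γ χ (R • θ)‖
  obtain ⟨j, hj1, hjn, hj⟩ := hlow t ht θ hθ
  have h3 : c * R ≤ (A / z) ^ n :=
    calc c * R ≤ R * |inner ℝ θ (Γ j t)| := by rw [mul_comm]; gcongr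
      _ ≤ (A / z) ^ j := h2 j hj1 (hjn.trans hnN)
      _ ≤ (A / z) ^ n := pow_le_pow_right₀ h1 hjn
  have h4 : (c * R) ^ (1 / (n : ℝ)) ≤ A / z := by
    rw [one_div]
    calc (c * R) ^ ((n : ℝ)⁻¹) ≤ ((A / z) ^ n) ^ ((n : ℝ)⁻¹) := by gcongr
      _ = A / z := Real.pow_rpow_inv_natCast (by positivity) hn
  rw [mul_assoc, ← Real.mul_rpow hc.le hR0.le, Real.rpow_neg (by positivity), ← div_eq_mul_inv]
  rw [le_div_iff₀ hz0] at h4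
  rw [le_div_iff₀ (by positivity)]
  linarith

end

/-! ### From level sets to moments -/

section LayerCake

theorem lintegral_Ioc_zero_rpow {B q s : ℝ} (hB : 0 ≤ B) (hq : 0 < q) (hs : 0 ≤ s) :
    ∫⁻ l in Ioc 0 s, ENNReal.ofReal (B * l ^ (q - 1)) = ENNReal.ofReal (B * s ^ q / q) := by
  have hint : IntegrableOn (fun l : ℝ => B * l ^ (q - 1)) (Ioc 0 s) := by
    have := (intervalIntegral.intervalIntegrable_rpow' (a := 0) (b := s)
      (by linarith : -1 < q - 1)).const_mul B
    rwa [intervalIntegrable_iff_integrableOn_Ioc_of_le hs] at this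
  rw [← ofReal_integral_eq_lintegral_ofReal hint]
  · congr 1
    rw [← intervalIntegral.integral_of_le hs, intervalIntegral.integral_const_mul,
      integral_rpow (Or.inl (by linarith))]
    simp [Real.zero_rpow hq.ne', mul_div_assoc]
  · filter_upwards [ae_restrict_mem measurableSet_Ioc] with l hl
    have := hl.1
    positivity

theorem lintegral_Ioi_rpow {B q s : ℝ} (hB : 0 ≤ B) (hq : 0 < q) (hs : 0 < s) :
    ∫⁻ l in Ioi s, ENNReal.ofReal (B * l ^ (-q - 1)) = ENNReal.ofReal (B * s ^ (-q) / q) := by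
  have hint : IntegrableOn (fun l : ℝ => B * l ^ (-q - 1)) (Ioi s) :=
    (integrableOn_Ioi_rpow_of_lt (by linarith) hs).const_mul B
  rw [← ofReal_integral_eq_lintegral_ofReal hint]
  · congr 1
    rw [integral_const_mul, integral_Ioi_rpow_of_lt (by linarith) hs]
    rw [sub_add_cancel, neg_div_neg_eq, mul_div_assoc]
  · filter_upwards [ae_restrict_mem measurableSet_Ioi] with l hl
    have : 0 < l := hs.trans hl
    positivity

theorem lintegral_Ioc_inv {B s M : ℝ} (hB : 0 ≤ B) (hs : 0 < s) (hsM : s ≤ M) :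
    ∫⁻ l in Ioc s M, ENNReal.ofReal (B * l⁻¹) = ENNReal.ofReal (B * Real.log (M / s)) := by
  have hM : 0 < M := hs.trans_le hsM
  have hint : IntegrableOn (fun l : ℝ => B * l⁻¹) (Ioc s M) := by
    have := (intervalIntegral.intervalIntegrable_inv (a := s) (b := M) (f := fun x => x)
      (μ := volume) (fun x hx => by
        rw [uIcc_of_le hsM] at hx
        exact (hs.trans_le hx.1).ne') continuousOn_id).const_mul B
    rwa [intervalIntegrable_iff_integrableOn_Ioc_of_le hsM] at this
  rw [← ofReal_integral_eq_lintegral_ofReal hint]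
  · congr 1
    rw [← intervalIntegral.integral_of_le hsM, intervalIntegral.integral_const_mul,
      integral_inv_of_pos hs hM]
  · filter_upwards [ae_restrict_mem measurableSet_Ioc] with l hl
    have : 0 < l := hs.trans hl.1
    positivity

variable {α : Type*} [MeasurableSpace α] {μ : Measure α} {f : α → ℝ}

/-- The part of the layer cake formula below the height `s`, where a level bound of order `r < p`
is integrable. -/
theorem lintegral_rpow_le_add (hf0 : ∀ x, 0 ≤ f x) (hf : AEMeasurable f μ) {p r B s : ℝ}
    (hp : 0 < p) (hr : r < p) (hB : 0 ≤ B) (hs : 0 ≤ s)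
    (h : ∀ l, 0 < l → μ {x | l < f x} ≤ ENNReal.ofReal (B * l ^ (-r))) :
    ∫⁻ x, ENNReal.ofReal (f x ^ p) ∂μ ≤ ENNReal.ofReal p *
      (ENNReal.ofReal (B * s ^ (p - r) / (p - r)) +
        ∫⁻ l in Ioi s, μ {x | l < f x} * ENNReal.ofReal (l ^ (p - 1))) := by
  rw [lintegral_rpow_eq_lintegral_meas_lt_mul μ (Eventually.of_forall hf0) hf hp,
    ← Ioc_union_Ioi_eq_Ioi hs, lintegral_union measurableSet_Ioi
      (Set.disjoint_left.2 fun x hx hx' => not_lt.2 hx.2 hx')]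
  gcongr
  rw [← lintegral_Ioc_zero_rpow hB (sub_pos.2 hr) hs]
  refine setLIntegral_mono' measurableSet_Ioc fun l hl => ?_
  have hl0 : 0 < l := hl.1
  calc _ ≤ ENNReal.ofReal (B * l ^ (-r)) * ENNReal.ofReal (l ^ (p - 1)) := by
        gcongr; exact h l hl0
    _ = _ := by
      rw [← ENNReal.ofReal_mul (by positivity), mul_assoc, ← Real.rpow_add hl0]
      congr 3
      ring

theorem lintegral_rpow_le_of_bounded (hf0 : ∀ x, 0 ≤ f x) (hf : AEMeasurable f μ) {p r B M : ℝ}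
    (hp : 0 < p) (hr : r < p) (hB : 0 ≤ B) (hM : 0 ≤ M) (hfM : ∀ x, f x ≤ M)
    (h : ∀ l, 0 < l → μ {x | l < f x} ≤ ENNReal.ofReal (B * l ^ (-r))) :
    ∫⁻ x, ENNReal.ofReal (f x ^ p) ∂μ ≤ ENNReal.ofReal (p * (B * M ^ (p - r) / (p - r))) := by
  refine (lintegral_rpow_le_add hf0 hf hp hr hB hM h).trans_eq ?_
  have : ∫⁻ l in Ioi M, μ {x | l < f x} * ENNReal.ofReal (l ^ (p - 1)) = 0 := by
    rw [← lintegral_zero (μ := volume.restrict (Ioi M))]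
    refine setLIntegral_congr_fun measurableSet_Ioi fun l hl => ?_
    have : {x | l < f x} = ∅ :=
      eq_empty_of_forall_notMem fun x (hx : l < f x) => absurd (hfM x) (not_le.2 (hl.trans hx))
    simp only [this, measure_empty, zero_mul]
  rw [this, add_zero, ENNReal.ofReal_mul hp.le]

theorem lintegral_rpow_le_of_two_levels (hf0 : ∀ x, 0 ≤ f x) (hf : AEMeasurable f μ)
    {p r₀ r₁ B₀ B₁ s : ℝ} (hp : 0 < p) (hr₀ : r₀ < p) (hr₁ : p < r₁) (hB₀ : 0 ≤ B₀) (hB₁ : 0 ≤ B₁)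
    (hs : 0 < s) (h₀ : ∀ l, 0 < l → μ {x | l < f x} ≤ ENNReal.ofReal (B₀ * l ^ (-r₀)))
    (h₁ : ∀ l, 0 < l → μ {x | l < f x} ≤ ENNReal.ofReal (B₁ * l ^ (-r₁))) :
    ∫⁻ x, ENNReal.ofReal (f x ^ p) ∂μ ≤ ENNReal.ofReal
      (p * (B₀ * s ^ (p - r₀) / (p - r₀) + B₁ * s ^ (p - r₁) / (r₁ - p))) := by
  have e₀ : 0 < p - r₀ := sub_pos.2 hr₀
  have e₁ : 0 < r₁ - p := sub_pos.2 hr₁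
  refine (lintegral_rpow_le_add hf0 hf hp hr₀ hB₀ hs.le h₀).trans ?_
  rw [ENNReal.ofReal_mul hp.le, ENNReal.ofReal_add (by positivity) (by positivity)]
  gcongr
  have : p - r₁ = -(r₁ - p) := by ring
  rw [this, ← lintegral_Ioi_rpow hB₁ e₁ hs]
  refine setLIntegral_mono' measurableSet_Ioi fun l hl => ?_
  have hl0 : 0 < l := hs.trans hl
  calc _ ≤ ENNReal.ofReal (B₁ * l ^ (-r₁)) * ENNReal.ofReal (l ^ (p - 1)) := by
        gcongr; exact h₁ l hl0
    _ = _ := by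
      rw [← ENNReal.ofReal_mul (by positivity), mul_assoc, ← Real.rpow_add hl0]
      congr 3
      ring

theorem lintegral_rpow_le_of_critical_level (hf0 : ∀ x, 0 ≤ f x) (hf : AEMeasurable f μ)
    {p r₀ B₀ B₁ s M : ℝ} (hp : 0 < p) (hr₀ : r₀ < p) (hB₀ : 0 ≤ B₀) (hB₁ : 0 ≤ B₁)
    (hs : 0 < s) (hsM : s ≤ M) (hfM : ∀ x, f x ≤ M)
    (h₀ : ∀ l, 0 < l → μ {x | l < f x} ≤ ENNReal.ofReal (B₀ * l ^ (-r₀)))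
    (h₁ : ∀ l, 0 < l → μ {x | l < f x} ≤ ENNReal.ofReal (B₁ * l ^ (-p))) :
    ∫⁻ x, ENNReal.ofReal (f x ^ p) ∂μ ≤ ENNReal.ofReal
      (p * (B₀ * s ^ (p - r₀) / (p - r₀) + B₁ * Real.log (M / s))) := by
  have e₀ : 0 < p - r₀ := sub_pos.2 hr₀
  have hlog : 0 ≤ Real.log (M / s) := Real.log_nonneg ((one_le_div hs).2 hsM)
  refine (lintegral_rpow_le_add hf0 hf hp hr₀ hB₀ hs.le h₀).trans ?_
  rw [ENNReal.ofReal_mul hp.le, ENNReal.ofReal_add (by positivity) (by positivity)]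
  gcongr
  rw [← Ioc_union_Ioi_eq_Ioi hsM, lintegral_union measurableSet_Ioi
      (Set.disjoint_left.2 fun x hx hx' => not_lt.2 hx.2 hx')]
  have hzero : ∫⁻ l in Ioi M, μ {x | l < f x} * ENNReal.ofReal (l ^ (p - 1)) = 0 := by
    rw [← lintegral_zero (μ := volume.restrict (Ioi M))]
    refine setLIntegral_congr_fun measurableSet_Ioi fun l hl => ?_
    have : {x | l < f x} = ∅ :=
      eq_empty_of_forall_notMem fun x (hx : l < f x) => absurd (hfM x) (not_le.2 (hl.trans hx))
    simp only [this, measure_empty, zero_mul]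
  rw [hzero, add_zero, ← lintegral_Ioc_inv hB₁ hs hsM]
  refine setLIntegral_mono' measurableSet_Ioc fun l hl => ?_
  have hl0 : 0 < l := hs.trans hl.1
  calc _ ≤ ENNReal.ofReal (B₁ * l ^ (-p)) * ENNReal.ofReal (l ^ (p - 1)) := by
        gcongr; exact h₁ l hl0
    _ = _ := by
      rw [← ENNReal.ofReal_mul (by positivity), mul_assoc, ← Real.rpow_add hl0]
      congr 2
      rw [← Real.rpow_neg_one]
      congr 1
      ring

end LayerCake

section Continuity

variable {d : ℕ} {γ : ℝ → EuclideanSpace ℝ (Fin d)} {χ : ℝ → ℂ} {a b : ℝ}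

/-- Only the values of the curve on `[a, b]` matter, so it may be assumed continuous on the line. -/
theorem exists_continuous_muHat_eq (hab : a ≤ b) (hγ : ContinuousOn γ (Icc a b))
    (hsupp : tsupport χ ⊆ Ioo a b) : ∃ γ' : ℝ → EuclideanSpace ℝ (Fin d), Continuous γ' ∧
      (∀ t ∈ Icc a b, γ' t = γ t) ∧ muHat γ χ = muHat γ' χ := by
  have heq : ∀ t ∈ Icc a b, IccExtend hab ((Icc a b).domRestrict γ) t = γ t := fun t ht => by
    rw [IccExtend_of_mem hab _ ht, domRestrict_apply]
  refine ⟨IccExtend hab ((Icc a b).domRestrict γ),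
    (continuousOn_iff_continuous_domRestrict.1 hγ).Icc_extend', heq, ?_⟩
  ext ξ
  rw [muHat, muHat]
  congr 1
  ext t
  by_cases ht : t ∈ Icc a b
  · rw [heq t ht]
  · have : χ t = 0 := by
      by_contra h
      exact ht (Ioo_subset_Icc_self (hsupp (subset_tsupport χ h)))
    rw [this, mul_zero, mul_zero]

theorem continuous_muHat (hγ : Continuous γ) (hχ : Continuous χ)
    (hsupp : tsupport χ ⊆ Ioo a b) : Continuous (muHat γ χ) := by
  have hcomp : HasCompactSupport χ :=
    isCompact_Icc.of_isClosed_subset (isClosed_tsupport χ) (hsupp.trans Ioo_subset_Icc_self)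
  have hjoint : ∀ ξ : EuclideanSpace ℝ (Fin d), Continuous fun t : ℝ =>
      Complex.exp (-(Complex.I * ((inner ℝ ξ (γ t) : ℝ) : ℂ))) * χ t := fun ξ =>
    (Complex.continuous_exp.comp (continuous_const.mul (Complex.continuous_ofReal.comp
      (continuous_const.inner hγ))).neg).mul hχ
  refine continuous_of_dominated (bound := fun t => ‖χ t‖) (fun ξ => ?_) (fun ξ => ?_) ?_ ?_
  · exact (hjoint ξ).aestronglyMeasurable
  · refine Eventually.of_forall fun t => ?_
    rw [norm_mul, ← mul_neg, mul_comm Complex.I, ← Complex.ofReal_neg,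
      Complex.norm_exp_ofReal_mul_I, one_mul]
  · exact (hχ.integrable_of_hasCompactSupport hcomp).norm
  · refine Eventually.of_forall fun t => ?_
    exact (Complex.continuous_exp.comp (continuous_const.mul (Complex.continuous_ofReal.comp
      (continuous_id.inner continuous_const))).neg).mul continuous_const

theorem G_le_of_lintegral_le {q : ENNReal} (hq0 : q ≠ 0) (hqt : q ≠ ⊤) {R X : ℝ} (hX : 0 ≤ X)
    (h : ∫⁻ θ : Metric.sphere (0 : EuclideanSpace ℝ (Fin d)) 1,
      ENNReal.ofReal (‖muHat γ χ (R • (θ : EuclideanSpace ℝ (Fin d)))‖ ^ q.toReal)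
        ∂(volume : Measure (EuclideanSpace ℝ (Fin d))).toSphere ≤ ENNReal.ofReal X) :
    G γ χ q R ≤ ENNReal.ofReal (X ^ (1 / q.toReal)) := by
  have hp : 0 < q.toReal := ENNReal.toReal_pos hq0 hqt
  rw [G, eLpNorm_eq_lintegral_rpow_enorm_toReal hq0 hqt,
    ← ENNReal.ofReal_rpow_of_nonneg hX (by positivity)]
  gcongr
  refine le_trans (le_of_eq ?_) h
  refine lintegral_congr fun θ => ?_
  rw [← ofReal_norm, ENNReal.ofReal_rpow_of_nonneg (norm_nonneg _) hp.le]

end Continuity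

/-! ### Rotations in a coordinate plane -/

section Rotation

variable {d : ℕ}

theorem norm_exp_I_mul_ofReal (x : ℝ) : ‖Complex.exp (Complex.I * (x : ℂ))‖ = 1 := by
  rw [mul_comm]; exact Complex.norm_exp_ofReal_mul_I _

/-- Integration by parts against `exp (i R p)` with an amplitude that vanishes at the end points. -/
theorem integral_mul_exp_eq {h h' p p₁ p₂ : ℝ → ℝ} {u v R : ℝ} (huv : u ≤ v) (hR : R ≠ 0)
    (hh : ∀ x ∈ Icc u v, HasDerivAt h (h' x) x) (hp : ∀ x ∈ Icc u v, HasDerivAt p (p₁ x) x)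
    (hp₁ : ∀ x ∈ Icc u v, HasDerivAt p₁ (p₂ x) x) (hh' : ContinuousOn h' (Icc u v))
    (hp₂ : ContinuousOn p₂ (Icc u v)) (hne : ∀ x ∈ Icc u v, p₁ x ≠ 0) (hu : h u = 0)
    (hv : h v = 0) :
    ∫ x in u..v, (h x : ℂ) * Complex.exp (Complex.I * ((R * p x : ℝ) : ℂ)) =
      Complex.I / R * ∫ x in u..v, ((h' x / p₁ x - h x * p₂ x / p₁ x ^ 2 : ℝ) : ℂ) *
        Complex.exp (Complex.I * ((R * p x : ℝ) : ℂ)) := by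
  have ch : ContinuousOn h (Icc u v) := fun x hx => (hh x hx).continuousAt.continuousWithinAt
  have cp : ContinuousOn p (Icc u v) := fun x hx => (hp x hx).continuousAt.continuousWithinAt
  have cp₁ : ContinuousOn p₁ (Icc u v) := fun x hx => (hp₁ x hx).continuousAt.continuousWithinAt
  have ce : ContinuousOn (fun x => Complex.exp (Complex.I * ((R * p x : ℝ) : ℂ))) (Icc u v) :=
    Complex.continuous_exp.comp_continuousOn (continuousOn_const.mul
      (Complex.continuous_ofReal.comp_continuousOn (continuousOn_const.mul cp)))
  have cg : ContinuousOn (fun x => h' x / p₁ x - h x * p₂ x / p₁ x ^ 2) (Icc u v) :=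
    (hh'.div cp₁ hne).sub ((ch.mul hp₂).div (cp₁.pow 2) fun x hx => pow_ne_zero _ (hne x hx))
  have i1 : IntervalIntegrable (fun x => ((h' x / p₁ x - h x * p₂ x / p₁ x ^ 2 : ℝ) : ℂ) *
      Complex.exp (Complex.I * ((R * p x : ℝ) : ℂ))) volume u v :=
    ((Complex.continuous_ofReal.comp_continuousOn cg).mul ce).intervalIntegrable_of_Icc huv
  have i2 : IntervalIntegrable (fun x => (h x : ℂ) *
      Complex.exp (Complex.I * ((R * p x : ℝ) : ℂ))) volume u v :=
    ((Complex.continuous_ofReal.comp_continuousOn ch).mul ce).intervalIntegrable_of_Icc huv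
  have hd : ∀ x ∈ Icc u v, HasDerivAt
      (fun x => ((h x / p₁ x : ℝ) : ℂ) * Complex.exp (Complex.I * ((R * p x : ℝ) : ℂ)))
      (((h' x / p₁ x - h x * p₂ x / p₁ x ^ 2 : ℝ) : ℂ) *
        Complex.exp (Complex.I * ((R * p x : ℝ) : ℂ)) + Complex.I * R * ((h x : ℂ) *
        Complex.exp (Complex.I * ((R * p x : ℝ) : ℂ)))) x := by
    intro x hx
    have h1 := ((hh x hx).div (hp₁ x hx) (hne x hx)).ofReal_comp
    have h2 := ((((hp x hx).const_mul R).ofReal_comp).const_mul Complex.I).cexp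
    refine (h1.mul h2).congr_deriv ?_
    have hc : (p₁ x : ℂ) ≠ 0 := by exact_mod_cast hne x hx
    push_cast
    simp only [Pi.div_apply]
    push_cast
    field_simp
  have hF := intervalIntegral.integral_eq_sub_of_hasDerivAt
    (fun x hx => hd x (by rwa [uIcc_of_le huv] at hx)) (i1.add (i2.const_mul _))
  rw [intervalIntegral.integral_add i1 (i2.const_mul _), intervalIntegral.integral_const_mul] at hF
  simp only [hu, hv, zero_div, Complex.ofReal_zero, zero_mul, sub_zero] at hF
  have hRc : (R : ℂ) ≠ 0 := by exact_mod_cast hR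
  rw [eq_neg_of_add_eq_zero_left hF, div_mul_eq_mul_div, eq_div_iff hRc]
  linear_combination ((R : ℂ) * ∫ x in u..v, (h x : ℂ) *
    Complex.exp (Complex.I * ((R * p x : ℝ) : ℂ))) * Complex.I_sq

/-- Two integrations by parts in the angle of rotation. The weight `(δ² - α²)²` vanishes to second
order at `±δ`, so that no boundary terms appear. -/
theorem norm_integral_angle_le {c L δ Q S R : ℝ} (hc : 0 < c) (hδ : 0 < δ) (hδ1 : δ ≤ 1)
    (hLδ : L * δ ≤ c / 4) (hQ : |Q| ≤ L) (hS : c ≤ |S|) (hSL : |S| ≤ L) (hR : 0 < R) :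
    ‖∫ α in -δ..δ, (((δ ^ 2 - α ^ 2) ^ 2 : ℝ) : ℂ) *
      Complex.exp (Complex.I * ((R * (Q * Real.cos α + S * Real.sin α) : ℝ) : ℂ))‖ ≤
      2 * (13 / (c / 4) ^ 2 + 24 * L / (c / 4) ^ 3 + 12 * L ^ 2 / (c / 4) ^ 4) / R ^ 2 := by
  have hL : 0 < L := hc.trans_le (hS.trans hSL)
  set k := c / 4 with hk
  have hk0 : 0 < k := by positivity
  set p : ℝ → ℝ := fun α => Q * Real.cos α + S * Real.sin α with hp
  set p₁ : ℝ → ℝ := fun α => -Q * Real.sin α + S * Real.cos α with hp₁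
  have dp : ∀ x, HasDerivAt p (p₁ x) x := fun x =>
    (((Real.hasDerivAt_cos x).const_mul Q).add ((Real.hasDerivAt_sin x).const_mul S)).congr_deriv
      (by simp only [hp₁]; ring)
  have dp₁ : ∀ x, HasDerivAt p₁ (-p x) x := fun x =>
    (((Real.hasDerivAt_sin x).const_mul (-Q)).add
      ((Real.hasDerivAt_cos x).const_mul S)).congr_deriv (by simp only [hp]; ring)
  have cp : Continuous p := by fun_prop
  have cp₁ : Continuous p₁ := by fun_prop
  have hsin : ∀ x, |Real.sin x| ≤ 1 := Real.abs_sin_le_one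
  have hcos : ∀ x, |Real.cos x| ≤ 1 := Real.abs_cos_le_one
  have bp : ∀ x, |p x| ≤ 2 * L := fun x => by
    have h1 := abs_add_le (Q * Real.cos x) (S * Real.sin x)
    rw [abs_mul, abs_mul] at h1
    have := hsin x
    have := hcos x
    nlinarith [abs_nonneg Q, abs_nonneg S]
  -- for small angles the term `S cos α` dominates the derivative of the phase
  have bp₁ : ∀ x ∈ Icc (-δ) δ, k ≤ |p₁ x| := by
    intro x hx
    have hxδ : |x| ≤ δ := abs_le.2 hx
    have h1 : 1 / 2 ≤ Real.cos x := by
      have := Real.one_sub_sq_div_two_le_cos (x := x)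
      have : x ^ 2 ≤ 1 := by rw [← sq_abs]; nlinarith [abs_nonneg x]
      linarith
    have h2 : |Real.sin x| ≤ δ := Real.abs_sin_le_abs.trans hxδ
    have h3 : |S * Real.cos x| - |Q * Real.sin x| ≤ |p₁ x| := by
      have := abs_sub_abs_le_abs_sub (S * Real.cos x) (Q * Real.sin x)
      have e : S * Real.cos x - Q * Real.sin x = p₁ x := by simp only [hp₁]; ring
      rwa [e] at this
    rw [abs_mul, abs_mul, abs_of_pos (by linarith : 0 < Real.cos x)] at h3
    have h4 : |Q| * |Real.sin x| ≤ L * δ := by gcongr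
    have h5 : c * (1 / 2) ≤ |S| * Real.cos x := by gcongr
    linarith
  have hne : ∀ x ∈ Icc (-δ) δ, p₁ x ≠ 0 := fun x hx h => by
    have := bp₁ x hx; rw [h, abs_zero] at this; linarith
  -- the weight and its first two derivatives
  set e₀ : ℝ → ℝ := fun α => (δ ^ 2 - α ^ 2) ^ 2 with he₀
  set e₁ : ℝ → ℝ := fun α => -4 * α * (δ ^ 2 - α ^ 2) with he₁
  set e₂ : ℝ → ℝ := fun α => 12 * α ^ 2 - 4 * δ ^ 2 with he₂
  have de₀ : ∀ x, HasDerivAt e₀ (e₁ x) x := fun x =>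
    ((((hasDerivAt_id x).pow 2).const_sub (δ ^ 2)).pow 2).congr_deriv
      (by simp only [he₁, Pi.pow_apply, id]; ring)
  have de₁ : ∀ x, HasDerivAt e₁ (e₂ x) x := fun x =>
    (((hasDerivAt_id x).const_mul (-4)).mul
      (((hasDerivAt_id x).pow 2).const_sub (δ ^ 2))).congr_deriv
      (by simp only [he₂, Pi.pow_apply, id]; ring)
  have ce₀ : Continuous e₀ := by fun_prop
  have ce₁ : Continuous e₁ := by fun_prop
  have ce₂ : Continuous e₂ := by fun_prop
  have hx2 : ∀ x ∈ Icc (-δ) δ, 0 ≤ x ^ 2 ∧ x ^ 2 ≤ δ ^ 2 ∧ δ ^ 2 ≤ 1 ∧ |x| ≤ 1 := fun x hx => by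
    have hxδ : |x| ≤ δ := abs_le.2 hx
    refine ⟨sq_nonneg _, ?_, by nlinarith, hxδ.trans hδ1⟩
    rw [← sq_abs]; gcongr
  have be₀ : ∀ x ∈ Icc (-δ) δ, |e₀ x| ≤ 1 := fun x hx => by
    obtain ⟨h1, h2, h3, -⟩ := hx2 x hx
    simp only [he₀]
    rw [abs_of_nonneg (sq_nonneg _)]
    nlinarith
  have be₁ : ∀ x ∈ Icc (-δ) δ, |e₁ x| ≤ 4 := fun x hx => by
    obtain ⟨h1, h2, h3, h4⟩ := hx2 x hx
    simp only [he₁]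
    rw [abs_mul, abs_mul, abs_of_nonneg (by linarith : 0 ≤ δ ^ 2 - x ^ 2)]
    have : |(-4 : ℝ)| = 4 := by norm_num
    rw [this]
    nlinarith [abs_nonneg x]
  have be₂ : ∀ x ∈ Icc (-δ) δ, |e₂ x| ≤ 12 := fun x hx => by
    obtain ⟨h1, h2, h3, -⟩ := hx2 x hx
    simp only [he₂]
    rw [abs_le]; constructor <;> nlinarith
  -- the amplitude after one integration by parts, and its derivative; `p` is minus its own
  -- second derivative
  set g₀ : ℝ → ℝ := fun x => e₁ x / p₁ x - e₀ x * -p x / p₁ x ^ 2 with hg₀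
  set g₁ : ℝ → ℝ := fun x => e₂ x / p₁ x + (2 * e₁ x * p x + e₀ x * p₁ x) / p₁ x ^ 2 +
    2 * e₀ x * p x ^ 2 / p₁ x ^ 3 with hg₁
  have dg₀ : ∀ x ∈ Icc (-δ) δ, HasDerivAt g₀ (g₁ x) x := fun x hx => by
    have hn := hne x hx
    refine (((de₁ x).div (dp₁ x) hn).sub (((de₀ x).mul (dp x).neg).div ((dp₁ x).pow 2)
      (pow_ne_zero _ hn))).congr_deriv ?_
    simp only [hg₁, Pi.mul_apply, Pi.neg_apply, Pi.pow_apply]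
    field_simp
    ring
  have cg₁ : ContinuousOn g₁ (Icc (-δ) δ) := by
    refine ((ce₂.continuousOn.div cp₁.continuousOn hne).add (ContinuousOn.div ?_ ?_ ?_)).add
      (ContinuousOn.div ?_ ?_ ?_)
    · fun_prop
    · fun_prop
    · exact fun x hx => pow_ne_zero _ (hne x hx)
    · fun_prop
    · fun_prop
    · exact fun x hx => pow_ne_zero _ (hne x hx)
  have hδδ : -δ ≤ δ := by linarith
  rw [integral_mul_exp_eq (h := e₀) (p := p) hδδ hR.ne' (fun x _ => de₀ x) (fun x _ => dp x)
    (fun x _ => dp₁ x) ce₁.continuousOn cp.neg.continuousOn hne (by simp [he₀]) (by simp [he₀]),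
    integral_mul_exp_eq (h := g₀) (p := p) hδδ hR.ne' dg₀ (fun x _ => dp x)
    (fun x _ => dp₁ x) cg₁ cp.neg.continuousOn hne (by simp [hg₀, he₀, he₁])
    (by simp [hg₀, he₀, he₁]), ← mul_assoc, norm_mul]
  have hn : ‖Complex.I / (R : ℂ) * (Complex.I / R)‖ = 1 / R ^ 2 := by
    simp only [norm_mul, norm_div, Complex.norm_I, Complex.norm_real, Real.norm_eq_abs,
      abs_of_pos hR]
    field_simp
  rw [hn]
  set D := 13 / k ^ 2 + 24 * L / k ^ 3 + 12 * L ^ 2 / k ^ 4 with hD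
  have hbound : ∀ x ∈ uIoc (-δ) δ, ‖((g₁ x / p₁ x - g₀ x * -p x / p₁ x ^ 2 : ℝ) : ℂ) *
      Complex.exp (Complex.I * ((R * p x : ℝ) : ℂ))‖ ≤ D := by
    intro x hx
    rw [uIoc_of_le hδδ] at hx
    have hx : x ∈ Icc (-δ) δ := Ioc_subset_Icc_self hx
    rw [norm_mul, norm_exp_I_mul_ofReal, mul_one, Complex.norm_real, Real.norm_eq_abs]
    have hn := hne x hx
    have hP := bp₁ x hx
    have hPpos : 0 < |p₁ x| := hk0.trans_le hP
    have e : g₁ x / p₁ x - g₀ x * -p x / p₁ x ^ 2 =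
        (e₂ x + e₀ x) / p₁ x ^ 2 + 3 * (e₁ x * p x) / p₁ x ^ 3 +
          3 * (e₀ x * p x ^ 2) / p₁ x ^ 4 := by
      simp only [hg₁, hg₀]
      field_simp
      ring
    have n1 : |e₂ x + e₀ x| ≤ 13 := by
      have := abs_add_le (e₂ x) (e₀ x)
      have := be₀ x hx
      have := be₂ x hx
      linarith
    have n2 : |3 * (e₁ x * p x)| ≤ 24 * L := by
      rw [abs_mul, abs_mul, abs_of_pos (by norm_num : (0 : ℝ) < 3)]
      calc 3 * (|e₁ x| * |p x|) ≤ 3 * (4 * (2 * L)) := by gcongr; exacts [be₁ x hx, bp x]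
        _ = 24 * L := by ring
    have n3 : |3 * (e₀ x * p x ^ 2)| ≤ 12 * L ^ 2 := by
      rw [abs_mul, abs_mul, abs_of_pos (by norm_num : (0 : ℝ) < 3),
        abs_of_nonneg (sq_nonneg (p x)), ← sq_abs (p x)]
      calc 3 * (|e₀ x| * |p x| ^ 2) ≤ 3 * (1 * (2 * L) ^ 2) := by gcongr; exacts [be₀ x hx, bp x]
        _ = 12 * L ^ 2 := by ring
    rw [e]
    calc _ ≤ |(e₂ x + e₀ x) / p₁ x ^ 2| + |3 * (e₁ x * p x) / p₁ x ^ 3| +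
          |3 * (e₀ x * p x ^ 2) / p₁ x ^ 4| := abs_add_three _ _ _
      _ ≤ D := by
        rw [abs_div, abs_div, abs_div, abs_pow, abs_pow, abs_pow, hD]
        gcongr
  have hI := intervalIntegral.norm_integral_le_of_norm_le_const hbound
  have h2 : |δ - -δ| ≤ 2 := by rw [abs_of_nonneg (by linarith)]; linarith
  have hD0 : 0 ≤ D := by positivity
  calc _ ≤ 1 / R ^ 2 * (D * 2) := by gcongr; exact hI.trans (by gcongr)
    _ = 2 * D / R ^ 2 := by ring

/-- The trivial bound, with the weight at most `1`. -/
theorem norm_integral_angle_le_two {δ : ℝ} (hδ : 0 < δ) (hδ1 : δ ≤ 1) (p : ℝ → ℝ) :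
    ‖∫ α in -δ..δ, (((δ ^ 2 - α ^ 2) ^ 2 : ℝ) : ℂ) * Complex.exp (Complex.I * (p α : ℂ))‖ ≤ 2 := by
  have hδδ : -δ ≤ δ := by linarith
  refine (intervalIntegral.norm_integral_le_of_norm_le_const (C := 1) fun x hx => ?_).trans ?_
  · rw [uIoc_of_le hδδ] at hx
    have hx2 : x ^ 2 ≤ δ ^ 2 := sq_le_sq' hx.1.le hx.2
    rw [norm_mul, norm_exp_I_mul_ofReal, mul_one, Complex.norm_real, Real.norm_eq_abs,
      abs_of_nonneg (sq_nonneg _)]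
    exact pow_le_one₀ (by linarith) (by nlinarith [sq_nonneg x])
  · rw [abs_of_nonneg (by linarith)]; linarith

/-- The kernel obtained by averaging over rotations by small angles decays quadratically. -/
theorem exists_norm_integral_angle_le {c L δ : ℝ} (hc : 0 < c) (hδ : 0 < δ) (hδ1 : δ ≤ 1)
    (hL : 0 ≤ L) (hLδ : L * δ ≤ c / 4) : ∃ C > 0, ∀ P Q S R T : ℝ, 0 ≤ T → 0 ≤ R →
      |Q| ≤ L * T → c * T ≤ |S| → |S| ≤ L * T →
      ‖∫ α in -δ..δ, (((δ ^ 2 - α ^ 2) ^ 2 : ℝ) : ℂ) *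
        Complex.exp (Complex.I * ((R * (P + Q * Real.cos α + S * Real.sin α) : ℝ) : ℂ))‖ ≤
        C * (1 + (R * T) ^ 2)⁻¹ := by
  set D := 2 * (13 / (c / 4) ^ 2 + 24 * L / (c / 4) ^ 3 + 12 * L ^ 2 / (c / 4) ^ 4) with hD
  have hD0 : 0 < D := by positivity
  refine ⟨2 * D + 4, by positivity, fun P Q S R T hT hR hQ hS hSL => ?_⟩
  rw [← div_eq_mul_inv, le_div_iff₀ (by positivity)]
  have htriv := norm_integral_angle_le_two hδ hδ1
    (fun α => R * (P + Q * Real.cos α + S * Real.sin α))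
  rcases le_total (R * T) 1 with hRT | hRT
  · have h1 : (R * T) ^ 2 ≤ 1 := pow_le_one₀ (by positivity) hRT
    calc _ ≤ 2 * (1 + (R * T) ^ 2) := by gcongr
      _ ≤ 2 * (1 + 1) := by gcongr
      _ ≤ 2 * D + 4 := by linarith
  · have hRT0 : 0 < R * T := by linarith
    have hT0 : 0 < T := lt_of_le_of_ne hT fun h => by rw [← h] at hRT0; simp at hRT0
    -- rescaling by `T` reduces to the case `T = 1`, and `P` only contributes a factor of modulus
    -- one
    have h1 := norm_integral_angle_le (c := c) (L := L) (Q := Q / T) (S := S / T) hc hδ hδ1 hLδ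
      (by rw [abs_div, abs_of_pos hT0, div_le_iff₀ hT0]; exact hQ)
      (by rw [abs_div, abs_of_pos hT0, le_div_iff₀ hT0]; exact hS)
      (by rw [abs_div, abs_of_pos hT0, div_le_iff₀ hT0]; exact hSL) hRT0
    have h2 : ∀ α : ℝ, (((δ ^ 2 - α ^ 2) ^ 2 : ℝ) : ℂ) *
        Complex.exp (Complex.I * ((R * (P + Q * Real.cos α + S * Real.sin α) : ℝ) : ℂ)) =
        Complex.exp (Complex.I * ((R * P : ℝ) : ℂ)) * ((((δ ^ 2 - α ^ 2) ^ 2 : ℝ) : ℂ) *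
        Complex.exp (Complex.I *
          ((R * T * (Q / T * Real.cos α + S / T * Real.sin α) : ℝ) : ℂ))) := by
      intro α
      have e : R * (P + Q * Real.cos α + S * Real.sin α) =
          R * P + R * T * (Q / T * Real.cos α + S / T * Real.sin α) := by
        field_simp
        ring
      rw [e, Complex.ofReal_add, mul_add, Complex.exp_add]
      ring
    simp_rw [h2]
    rw [intervalIntegral.integral_const_mul, norm_mul, norm_exp_I_mul_ofReal, one_mul]
    rw [← hD, le_div_iff₀ (by positivity)] at h1
    set N := ‖∫ α in -δ..δ, (((δ ^ 2 - α ^ 2) ^ 2 : ℝ) : ℂ) * Complex.exp (Complex.I *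
          ((R * T * (Q / T * Real.cos α + S / T * Real.sin α) : ℝ) : ℂ))‖
    have hN : 0 ≤ N := norm_nonneg _
    have h3 : 1 ≤ (R * T) ^ 2 := one_le_pow₀ hRT
    nlinarith

/-- The rotation by the angle `α` in the plane of the coordinates `i ≠ j`. -/
noncomputable def planeRotation {i j : Fin d} (hij : i ≠ j) (α : ℝ) :
    EuclideanSpace ℝ (Fin d) ≃ₗᵢ[ℝ] EuclideanSpace ℝ (Fin d) :=
  LinearIsometry.toLinearIsometryEquiv
    { toFun := fun x => x +
        (((Real.cos α - 1) * x i - Real.sin α * x j) • EuclideanSpace.single i (1 : ℝ) +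
          (Real.sin α * x i + (Real.cos α - 1) * x j) • EuclideanSpace.single j (1 : ℝ))
      map_add' := fun x y => by
        simp only [PiLp.add_apply]
        module
      map_smul' := fun r x => by
        simp only [PiLp.smul_apply, smul_eq_mul, RingHom.id_apply]
        module
      norm_map' := fun x => by
        rw [← sq_eq_sq₀ (norm_nonneg _) (norm_nonneg _)]
        simp only [LinearMap.coe_mk, AddHom.coe_mk]
        rw [← real_inner_self_eq_norm_sq, ← real_inner_self_eq_norm_sq]
        simp only [inner_add_left, inner_add_right, real_inner_smul_left, real_inner_smul_right,
          EuclideanSpace.inner_single_left, EuclideanSpace.inner_single_right]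
        simp [hij, hij.symm]
        linear_combination (x i ^ 2 + x j ^ 2) * Real.sin_sq_add_cos_sq α }
    rfl

theorem planeRotation_apply {i j : Fin d} (hij : i ≠ j) (α : ℝ) (x : EuclideanSpace ℝ (Fin d)) :
    planeRotation hij α x = x +
      (((Real.cos α - 1) * x i - Real.sin α * x j) • EuclideanSpace.single i (1 : ℝ) +
        (Real.sin α * x i + (Real.cos α - 1) * x j) • EuclideanSpace.single j (1 : ℝ)) := rfl

theorem inner_planeRotation {i j : Fin d} (hij : i ≠ j) (α : ℝ)
    (x y : EuclideanSpace ℝ (Fin d)) :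
    inner ℝ (planeRotation hij α x) y = inner ℝ x y - (x i * y i + x j * y j) +
      (x i * y i + x j * y j) * Real.cos α + (x i * y j - x j * y i) * Real.sin α := by
  rw [planeRotation_apply]
  simp only [inner_add_left, real_inner_smul_left, EuclideanSpace.inner_single_left]
  simp
  ring

theorem planeRotation_wedge {i j : Fin d} (hij : i ≠ j) (α : ℝ)
    (x y : EuclideanSpace ℝ (Fin d)) :
    planeRotation hij α x i * y j - planeRotation hij α x j * y i =
      (x i * y j - x j * y i) * Real.cos α - (x i * y i + x j * y j) * Real.sin α := by
  rw [planeRotation_apply]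
  simp [hij, hij.symm]
  ring

theorem continuous_planeRotation {i j : Fin d} (hij : i ≠ j) :
    Continuous fun z : ℝ × EuclideanSpace ℝ (Fin d) => planeRotation hij z.1 z.2 := by
  simp only [planeRotation_apply]
  fun_prop

attribute [irreducible] planeRotation

open scoped Pointwise in
/-- Linear isometries preserve the surface measure. -/
theorem lintegral_toSphere_comp (U : EuclideanSpace ℝ (Fin d) ≃ₗᵢ[ℝ] EuclideanSpace ℝ (Fin d))
    {g : EuclideanSpace ℝ (Fin d) → ENNReal} (hg : Measurable g) :
    ∫⁻ θ : Metric.sphere (0 : EuclideanSpace ℝ (Fin d)) 1, g (U θ)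
        ∂(volume : Measure (EuclideanSpace ℝ (Fin d))).toSphere =
      ∫⁻ θ : Metric.sphere (0 : EuclideanSpace ℝ (Fin d)) 1, g θ
        ∂(volume : Measure (EuclideanSpace ℝ (Fin d))).toSphere := by
  set V : Metric.sphere (0 : EuclideanSpace ℝ (Fin d)) 1 →
      Metric.sphere (0 : EuclideanSpace ℝ (Fin d)) 1 :=
    fun θ => ⟨U θ, by simp⟩ with hV
  have hVm : Measurable V :=
    ((U.continuous.comp continuous_subtype_val).subtype_mk _).measurable
  have hmap : Measure.map V (volume : Measure (EuclideanSpace ℝ (Fin d))).toSphere =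
      (volume : Measure (EuclideanSpace ℝ (Fin d))).toSphere := by
    ext s hs
    rw [Measure.map_apply hVm hs, Measure.toSphere_apply' _ hs,
      Measure.toSphere_apply' _ (hVm hs)]
    congr 1
    have hpre : (Ioo (0 : ℝ) 1 • (Subtype.val '' (V ⁻¹' s)) : Set (EuclideanSpace ℝ (Fin d))) =
        U.toMeasurableEquiv ⁻¹' (Ioo (0 : ℝ) 1 • (Subtype.val '' s)) := by
      ext x
      constructor
      · rintro ⟨r, hr, _, ⟨θ, hθ, rfl⟩, rfl⟩
        exact ⟨r, hr, U θ, ⟨V θ, hθ, rfl⟩, by simp⟩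
      · rintro ⟨r, hr, _, ⟨θ, hθ, rfl⟩, hx⟩
        refine ⟨r, hr, U.symm θ, ⟨⟨U.symm θ, by simp⟩, ?_, rfl⟩, ?_⟩
        · have : V ⟨U.symm θ, by simp⟩ = θ := Subtype.ext (by simp [hV])
          rw [mem_preimage, this]
          exact hθ
        · have h2 : r • (θ : EuclideanSpace ℝ (Fin d)) = U x := hx
          simp only
          rw [← map_smul, h2, U.symm_apply_apply]
    rw [hpre]
    exact U.measurePreserving.measure_preimage_equiv (f := U.toMeasurableEquiv) _
  conv_rhs => rw [← hmap]
  rw [lintegral_map (f := fun θ : Metric.sphere (0 : EuclideanSpace ℝ (Fin d)) 1 => g θ)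
     (hg.comp measurable_subtype_coe) hVm]

end Rotation

/-! ### Mean square over rotations -/

section Average

variable {d : ℕ}

theorem integral_inv_one_add_mul_sub_sq {R : ℝ} (hR : 0 < R) (s : ℝ) :
    ∫ t : ℝ, (1 + (R * (t - s)) ^ 2)⁻¹ = Real.pi / R := by
  rw [integral_sub_right_eq_self (fun t => (1 + (R * t) ^ 2)⁻¹) s,
    Measure.integral_comp_mul_left (fun t => (1 + t ^ 2)⁻¹) R, integral_univ_inv_one_add_sq,
    smul_eq_mul, abs_of_pos (by positivity)]
  ring

theorem integrable_inv_one_add_mul_sub_sq {R : ℝ} (hR : 0 < R) (s : ℝ) :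
    Integrable fun t : ℝ => (1 + (R * (t - s)) ^ 2)⁻¹ :=
  (integrable_inv_one_add_sq.comp_mul_left' hR.ne').comp_sub_right s

theorem prod_restrict_Ioc {u v : ℝ} :
    ((volume : Measure ℝ).restrict (Ioc u v)).prod ((volume : Measure ℝ).restrict (Ioc u v)) =
      (volume : Measure (ℝ × ℝ)).restrict (Ioc u v ×ˢ Ioc u v) := by
  rw [Measure.prod_restrict, Measure.volume_eq_prod]

theorem _root_.Continuous.integrable_prod_restrict_Ioc {E : Type*} [NormedAddCommGroup E]
    {F : ℝ × ℝ → E} (hF : Continuous F) (u v : ℝ) :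
    Integrable F (((volume : Measure ℝ).restrict (Ioc u v)).prod
      ((volume : Measure ℝ).restrict (Ioc u v))) := by
  rw [prod_restrict_Ioc]
  exact (hF.continuousOn.integrableOn_compact (isCompact_Icc.prod isCompact_Icc)).mono_set
    (prod_mono Ioc_subset_Icc_self Ioc_subset_Icc_self)

/-- The part of the Fourier transform coming from the arc of the curve over `[u, v]`. -/
noncomputable def arcHat (γ : ℝ → EuclideanSpace ℝ (Fin d)) (χ : ℝ → ℂ) (u v : ℝ)
    (ξ : EuclideanSpace ℝ (Fin d)) : ℂ :=
  ∫ t in u..v, χ t * Complex.exp (Complex.I * ((-inner ℝ ξ (γ t) : ℝ) : ℂ))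

variable {γ : ℝ → EuclideanSpace ℝ (Fin d)} {χ : ℝ → ℂ} {u v : ℝ}

theorem continuous_arcHat (hγ : Continuous γ) (hχ : Continuous χ) (u v : ℝ) :
    Continuous (arcHat γ χ u v) := by
  refine intervalIntegral.continuous_parametric_intervalIntegral_of_continuous' ?_ u v
  unfold Function.uncurry
  fun_prop

/-- Expanding the square in a weighted mean square of integrals `∫ h α t dt`. -/
theorem integral_mul_norm_sq_eq {h : ℝ → ℝ → ℂ} (hh : Continuous fun z : ℝ × ℝ => h z.1 z.2)
    {η : ℝ → ℝ} (hη : Continuous η) {p q : ℝ} (hpq : p ≤ q) (huv : u ≤ v) :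
    ((∫ α in p..q, η α * ‖∫ t in u..v, h α t‖ ^ 2 : ℝ) : ℂ) =
      ∫ x : ℝ × ℝ, (∫ α in p..q, (η α : ℂ) * (h α x.1 * (starRingEnd ℂ) (h α x.2)))
        ∂(((volume : Measure ℝ).restrict (Ioc u v)).prod
          ((volume : Measure ℝ).restrict (Ioc u v))) := by
  set ν : Measure ℝ := (volume : Measure ℝ).restrict (Ioc u v) with hν
  set F : ℝ → ℝ × ℝ → ℂ := fun α x => (η α : ℂ) *
    (h α x.1 * (starRingEnd ℂ) (h α x.2)) with hF
  have hFc : Continuous (Function.uncurry F) := by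
    have h1 : Continuous fun z : ℝ × ℝ × ℝ => h z.1 z.2.1 :=
      hh.comp (continuous_fst.prodMk (continuous_fst.comp continuous_snd))
    have h2 : Continuous fun z : ℝ × ℝ × ℝ => h z.1 z.2.2 :=
      hh.comp (continuous_fst.prodMk (continuous_snd.comp continuous_snd))
    exact (Complex.continuous_ofReal.comp (hη.comp continuous_fst)).mul
      (h1.mul (Complex.continuous_conj.comp h2))
  have hFi : Integrable (Function.uncurry F)
      (((volume : Measure ℝ).restrict (Ioc p q)).prod (ν.prod ν)) := by
    rw [hν, prod_restrict_Ioc, Measure.prod_restrict, ← Measure.volume_eq_prod]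
    exact (hFc.continuousOn.integrableOn_compact
      (isCompact_Icc.prod (isCompact_Icc.prod isCompact_Icc))).mono_set
      (prod_mono Ioc_subset_Icc_self (prod_mono Ioc_subset_Icc_self Ioc_subset_Icc_self))
  have hsq : ∀ α, ((η α * ‖∫ t in u..v, h α t‖ ^ 2 : ℝ) : ℂ) = ∫ x, F α x ∂(ν.prod ν) := by
    intro α
    simp only [hF]
    rw [integral_const_mul, integral_prod_mul (h α) (fun t => (starRingEnd ℂ) (h α t)),
      integral_conj, Complex.mul_conj, intervalIntegral.integral_of_le huv,
      Complex.normSq_eq_norm_sq]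
    push_cast
    rfl
  rw [← intervalIntegral.integral_ofReal]
  simp_rw [hsq]
  simp only [intervalIntegral.integral_of_le hpq]
  exact integral_integral_swap hFi

theorem integrable_prod_kernel (B R : ℝ) (u v : ℝ) :
    Integrable (fun x : ℝ × ℝ => B * (1 + (R * (x.2 - x.1)) ^ 2)⁻¹)
      (((volume : Measure ℝ).restrict (Ioc u v)).prod
        ((volume : Measure ℝ).restrict (Ioc u v))) := by
  refine Continuous.integrable_prod_restrict_Ioc ?_ u v
  refine continuous_const.mul (Continuous.inv₀ (by fun_prop) fun x => ?_)
  positivity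

theorem integral_prod_kernel_le {B R : ℝ} (hB : 0 ≤ B) (hR : 0 < R) (huv : u ≤ v) :
    ∫ x : ℝ × ℝ, B * (1 + (R * (x.2 - x.1)) ^ 2)⁻¹
      ∂(((volume : Measure ℝ).restrict (Ioc u v)).prod ((volume : Measure ℝ).restrict (Ioc u v))) ≤
      B * ((v - u) * (Real.pi / R)) := by
  have hKi := integrable_prod_kernel B R u v
  rw [integral_prod _ hKi]
  have h1 : ∀ s, ∫ t in Ioc u v, B * (1 + (R * (t - s)) ^ 2)⁻¹ ≤ B * (Real.pi / R) := by
    intro s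
    rw [integral_const_mul]
    gcongr
    rw [← integral_inv_one_add_mul_sub_sq hR s]
    exact setIntegral_le_integral (integrable_inv_one_add_mul_sub_sq hR s)
      (Eventually.of_forall fun t => by simp only [Pi.zero_apply]; positivity)
  refine (integral_mono hKi.integral_prod_left (integrable_const _) h1).trans_eq ?_
  rw [integral_const, smul_eq_mul, measureReal_restrict_apply_univ,
    Real.volume_real_Ioc_of_le huv]
  ring

/-- The `T T*` argument: averaged over small rotations in the plane of the coordinates `i, j`, the
mean square of the Fourier transform of an arc is `O(1 / R)` if the chords of the arc have
components of size comparable to `|s - t|` across the given direction in that plane. -/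
theorem integral_sq_arcHat_le (hγ : Continuous γ) (hχ : Continuous χ) (huv : u ≤ v)
    {M : ℝ} (hM : ∀ t, ‖χ t‖ ≤ M) {i j : Fin d} (hij : i ≠ j) {θ : EuclideanSpace ℝ (Fin d)}
    {c L δ C R : ℝ} (hδ : 0 < δ) (hR : 0 < R) (hC : 0 ≤ C)
    (hker : ∀ P Q S R T : ℝ, 0 ≤ T → 0 ≤ R → |Q| ≤ L * T → c * T ≤ |S| → |S| ≤ L * T →
      ‖∫ α in -δ..δ, (((δ ^ 2 - α ^ 2) ^ 2 : ℝ) : ℂ) *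
        Complex.exp (Complex.I * ((R * (P + Q * Real.cos α + S * Real.sin α) : ℝ) : ℂ))‖ ≤
        C * (1 + (R * T) ^ 2)⁻¹)
    (hQ : ∀ s ∈ Icc u v, ∀ t ∈ Icc u v,
      |θ i * (γ t - γ s) i + θ j * (γ t - γ s) j| ≤ L * |t - s|)
    (hS : ∀ s ∈ Icc u v, ∀ t ∈ Icc u v,
      c * |t - s| ≤ |θ i * (γ t - γ s) j - θ j * (γ t - γ s) i|)
    (hSL : ∀ s ∈ Icc u v, ∀ t ∈ Icc u v,
      |θ i * (γ t - γ s) j - θ j * (γ t - γ s) i| ≤ L * |t - s|) :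
    ∫ α in -δ..δ, (δ ^ 2 - α ^ 2) ^ 2 * ‖arcHat γ χ u v (R • planeRotation hij α θ)‖ ^ 2 ≤
      M ^ 2 * C * ((v - u) * (Real.pi / R)) := by
  have hδδ : -δ ≤ δ := by linarith
  have hM0 : 0 ≤ M := (norm_nonneg _).trans (hM 0)
  set h : ℝ → ℝ → ℂ := fun α t =>
    χ t * Complex.exp (Complex.I * ((-inner ℝ (R • planeRotation hij α θ) (γ t) : ℝ) : ℂ)) with hh
  have hhc : Continuous fun z : ℝ × ℝ => h z.1 z.2 := by
    have h1 : Continuous fun z : ℝ × ℝ => planeRotation hij z.1 θ :=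
      (continuous_planeRotation hij).comp (continuous_fst.prodMk continuous_const)
    have h2 : Continuous fun z : ℝ × ℝ => -inner ℝ (R • planeRotation hij z.1 θ) (γ z.2) :=
      ((h1.const_smul R).inner (hγ.comp continuous_snd)).neg
    exact (hχ.comp continuous_snd).mul
      (Complex.continuous_exp.comp (continuous_const.mul (Complex.continuous_ofReal.comp h2)))
  have hphase : ∀ s t α, h α s * (starRingEnd ℂ) (h α t) = χ s * (starRingEnd ℂ) (χ t) *
      Complex.exp (Complex.I * ((R * inner ℝ (planeRotation hij α θ) (γ t - γ s) : ℝ) : ℂ)) := by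
    intro s t α
    have e : Complex.exp (Complex.I * ((R * (inner ℝ (planeRotation hij α θ) (γ t) -
        inner ℝ (planeRotation hij α θ) (γ s)) : ℝ) : ℂ)) =
        Complex.exp (Complex.I * ((-(R * inner ℝ (planeRotation hij α θ) (γ s)) : ℝ) : ℂ)) *
        Complex.exp (-Complex.I * ((-(R * inner ℝ (planeRotation hij α θ) (γ t)) : ℝ) : ℂ)) := by
      rw [← Complex.exp_add]
      congr 1
      push_cast
      ring
    simp only [hh, map_mul, ← Complex.exp_conj, Complex.conj_I, Complex.conj_ofReal,
      real_inner_smul_left, inner_sub_right]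
    rw [e]
    ring
  have hinner : ∀ s t, ∫ α in -δ..δ, (((δ ^ 2 - α ^ 2) ^ 2 : ℝ) : ℂ) *
      (h α s * (starRingEnd ℂ) (h α t)) = χ s * (starRingEnd ℂ) (χ t) *
      ∫ α in -δ..δ, (((δ ^ 2 - α ^ 2) ^ 2 : ℝ) : ℂ) * Complex.exp (Complex.I * ((R *
        ((inner ℝ θ (γ t - γ s) - (θ i * (γ t - γ s) i + θ j * (γ t - γ s) j)) +
          (θ i * (γ t - γ s) i + θ j * (γ t - γ s) j) * Real.cos α +
          (θ i * (γ t - γ s) j - θ j * (γ t - γ s) i) * Real.sin α) : ℝ) : ℂ)) := by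
    intro s t
    rw [← intervalIntegral.integral_const_mul]
    refine intervalIntegral.integral_congr fun α _ => ?_
    simp only
    rw [hphase, ← inner_planeRotation hij]
    ring
  have hbound : ∀ᵐ x ∂(((volume : Measure ℝ).restrict (Ioc u v)).prod
      ((volume : Measure ℝ).restrict (Ioc u v))),
      ‖∫ α in -δ..δ, (((δ ^ 2 - α ^ 2) ^ 2 : ℝ) : ℂ) * (h α x.1 * (starRingEnd ℂ) (h α x.2))‖ ≤
        M ^ 2 * C * (1 + (R * (x.2 - x.1)) ^ 2)⁻¹ := by
    rw [prod_restrict_Ioc]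
    filter_upwards [ae_restrict_mem (measurableSet_Ioc.prod measurableSet_Ioc)] with x hx
    have hs : x.1 ∈ Icc u v := Ioc_subset_Icc_self hx.1
    have ht : x.2 ∈ Icc u v := Ioc_subset_Icc_self hx.2
    rw [hinner, norm_mul, norm_mul, RCLike.norm_conj]
    have h1 := hker (inner ℝ θ (γ x.2 - γ x.1) - (θ i * (γ x.2 - γ x.1) i +
      θ j * (γ x.2 - γ x.1) j)) _ _ R |x.2 - x.1| (abs_nonneg _) hR.le (hQ _ hs _ ht)
      (hS _ hs _ ht) (hSL _ hs _ ht)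
    have h2 : (R * |x.2 - x.1|) ^ 2 = (R * (x.2 - x.1)) ^ 2 := by
      rw [mul_pow, sq_abs, mul_pow]
    rw [h2] at h1
    have h3 : ‖χ x.1‖ * ‖χ x.2‖ ≤ M * M := mul_le_mul (hM _) (hM _) (norm_nonneg _) hM0
    refine (mul_le_mul h3 h1 (norm_nonneg _) (by positivity)).trans_eq ?_
    ring
  have hnn : 0 ≤ ∫ α in -δ..δ, (δ ^ 2 - α ^ 2) ^ 2 *
      ‖arcHat γ χ u v (R • planeRotation hij α θ)‖ ^ 2 :=
    intervalIntegral.integral_nonneg hδδ fun α _ => by positivity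
  have hmain := integral_mul_norm_sq_eq hhc (η := fun α => (δ ^ 2 - α ^ 2) ^ 2) (by fun_prop)
    hδδ huv
  rw [← Real.norm_of_nonneg hnn, ← Complex.norm_real]
  refine le_trans (le_of_eq (congrArg norm hmain)) ?_
  exact (norm_integral_le_of_norm_le (integrable_prod_kernel _ R u v) hbound).trans
    (integral_prod_kernel_le (by positivity) hR huv)

/-- Averaging over small rotations reduces the integral over a region of the sphere to integrals
along the orbits that meet the region. -/
theorem lintegral_indicator_toSphere_le {i j : Fin d} (hij : i ≠ j) {δ : ℝ}
    {A : Set (EuclideanSpace ℝ (Fin d))} (hA : MeasurableSet A)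
    {g : EuclideanSpace ℝ (Fin d) → ENNReal} (hg : Measurable g) {X : ENNReal}
    (hX : ∀ θ : EuclideanSpace ℝ (Fin d), ‖θ‖ = 1 →
      (∃ α ∈ Icc (-δ) δ, planeRotation hij α θ ∈ A) →
      ∫⁻ α in Ioc (-δ) δ, ENNReal.ofReal ((δ ^ 2 - α ^ 2) ^ 2) * g (planeRotation hij α θ) ≤ X) :
    (∫⁻ α in Ioc (-δ) δ, ENNReal.ofReal ((δ ^ 2 - α ^ 2) ^ 2)) *
      ∫⁻ θ : Metric.sphere (0 : EuclideanSpace ℝ (Fin d)) 1, A.indicator g θ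
        ∂(volume : Measure (EuclideanSpace ℝ (Fin d))).toSphere ≤
      X * (volume : Measure (EuclideanSpace ℝ (Fin d))).toSphere univ := by
  set k := A.indicator g with hk
  have hkm : Measurable k := hg.indicator hA
  have hη : Measurable fun α : ℝ => ENNReal.ofReal ((δ ^ 2 - α ^ 2) ^ 2) := by fun_prop
  have hjoint : Measurable fun z : ℝ × Metric.sphere (0 : EuclideanSpace ℝ (Fin d)) 1 =>
      k (planeRotation hij z.1 z.2) :=
    hkm.comp ((continuous_planeRotation hij).comp
      (continuous_fst.prodMk (continuous_subtype_val.comp continuous_snd))).measurable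
  rw [← lintegral_mul_const _ hη]
  have h1 : ∀ α : ℝ, ENNReal.ofReal ((δ ^ 2 - α ^ 2) ^ 2) *
      ∫⁻ θ : Metric.sphere (0 : EuclideanSpace ℝ (Fin d)) 1, k θ
        ∂(volume : Measure (EuclideanSpace ℝ (Fin d))).toSphere =
      ∫⁻ θ : Metric.sphere (0 : EuclideanSpace ℝ (Fin d)) 1,
        ENNReal.ofReal ((δ ^ 2 - α ^ 2) ^ 2) * k (planeRotation hij α θ)
        ∂(volume : Measure (EuclideanSpace ℝ (Fin d))).toSphere := by
    intro α
    rw [← lintegral_toSphere_comp (planeRotation hij α) hkm, lintegral_const_mul']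
    exact ENNReal.ofReal_ne_top
  simp_rw [h1]
  rw [lintegral_lintegral_swap ((hη.comp measurable_fst).mul hjoint).aemeasurable,
    ← lintegral_const]
  refine lintegral_mono fun θ => ?_
  by_cases hex : ∃ α ∈ Icc (-δ) δ, planeRotation hij α θ ∈ A
  · refine le_trans ?_ (hX θ (norm_eq_of_mem_sphere θ) hex)
    gcongr
    exact indicator_le_self _ _ _
  · push Not at hex
    have : ∫⁻ α in Ioc (-δ) δ, ENNReal.ofReal ((δ ^ 2 - α ^ 2) ^ 2) * k (planeRotation hij α θ) =
        ∫⁻ _ in Ioc (-δ) δ, 0 := by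
      refine setLIntegral_congr_fun measurableSet_Ioc fun α hα => ?_
      simp only [hk, indicator_of_notMem (hex α (Ioc_subset_Icc_self hα)), mul_zero]
    rw [this, lintegral_zero]
    exact zero_le

end Average

/-! ### The mean square estimate -/

section MeanSquare

variable {d : ℕ} {γ : ℝ → EuclideanSpace ℝ (Fin d)} {χ : ℝ → ℂ} {u v : ℝ}

/-- Lagrange's identity. -/
theorem sum_wedge_sq (x y : EuclideanSpace ℝ (Fin d)) :
    ∑ i, ∑ j, (x i * y j - x j * y i) ^ 2 = 2 * (‖x‖ ^ 2 * ‖y‖ ^ 2 - inner ℝ x y ^ 2) := by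
  have h1 : ∑ i, ∑ j, (x i * y j - x j * y i) ^ 2 =
      (∑ i, x i ^ 2) * (∑ j, y j ^ 2) + (∑ i, y i ^ 2) * (∑ j, x j ^ 2) -
        2 * ((∑ i, y i * x i) * ∑ j, y j * x j) := by
    simp only [Finset.sum_mul_sum]
    rw [← Finset.sum_add_distrib, Finset.mul_sum, ← Finset.sum_sub_distrib]
    refine Finset.sum_congr rfl fun i _ => ?_
    rw [← Finset.sum_add_distrib, Finset.mul_sum, ← Finset.sum_sub_distrib]
    exact Finset.sum_congr rfl fun j _ => by ring
  rw [h1, EuclideanSpace.real_norm_sq_eq, EuclideanSpace.real_norm_sq_eq, PiLp.inner_apply]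
  simp only [RCLike.inner_apply, conj_trivial]
  ring

theorem abs_apply_le_norm (x : EuclideanSpace ℝ (Fin d)) (i : Fin d) : |x i| ≤ ‖x‖ := by
  rw [← Real.norm_eq_abs]; exact PiLp.norm_apply_le x i

theorem abs_wedge_le (x y : EuclideanSpace ℝ (Fin d)) (i j : Fin d) :
    |x i * y j - x j * y i| ≤ 2 * (‖x‖ * ‖y‖) := by
  have h1 := abs_sub (x i * y j) (x j * y i)
  rw [abs_mul, abs_mul] at h1
  have h2 : |x i| * |y j| ≤ ‖x‖ * ‖y‖ := by gcongr <;> exact abs_apply_le_norm _ _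
  have h3 : |x j| * |y i| ≤ ‖x‖ * ‖y‖ := by gcongr <;> exact abs_apply_le_norm _ _
  linarith

theorem abs_dot_le (x y : EuclideanSpace ℝ (Fin d)) (i j : Fin d) :
    |x i * y i + x j * y j| ≤ 2 * (‖x‖ * ‖y‖) := by
  have h1 := abs_add_le (x i * y i) (x j * y j)
  rw [abs_mul, abs_mul] at h1
  have h2 : |x i| * |y i| ≤ ‖x‖ * ‖y‖ := by gcongr <;> exact abs_apply_le_norm _ _
  have h3 : |x j| * |y j| ≤ ‖x‖ * ‖y‖ := by gcongr <;> exact abs_apply_le_norm _ _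
  linarith

/-- A direction that has no large component across `w` in any coordinate plane is nearly parallel
to `w`. -/
theorem half_le_abs_inner_of_wedge_lt {x w : EuclideanSpace ℝ (Fin d)} {m : ℝ} (hx : ‖x‖ = 1)
    (hm : 0 < m) (hw : m ≤ ‖w‖) (h : ∀ i j, |x i * w j - x j * w i| < m / d) :
    m / 2 ≤ |inner ℝ x w| := by
  have hd : 0 < d := by
    rcases Nat.eq_zero_or_pos d with rfl | hd
    · have : x = 0 := Subsingleton.elim _ _
      rw [this, norm_zero] at hx
      exact absurd hx (by norm_num)
    · exact hd
  have hd' : (0 : ℝ) < d := by exact_mod_cast hd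
  have h1 : ∑ i : Fin d, ∑ j : Fin d, (x i * w j - x j * w i) ^ 2 ≤
      ∑ _i : Fin d, ∑ _j : Fin d, (m / d) ^ 2 := by
    refine Finset.sum_le_sum fun i _ => Finset.sum_le_sum fun j _ => ?_
    rw [← sq_abs]
    have := h i j
    gcongr
  rw [sum_wedge_sq, hx] at h1
  simp only [Finset.sum_const, Finset.card_univ, Fintype.card_fin, nsmul_eq_mul] at h1
  have h2 : (d : ℝ) * (d * (m / d) ^ 2) = m ^ 2 := by field_simp
  rw [h2] at h1
  have h3 : m ^ 2 ≤ ‖w‖ ^ 2 := by gcongr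
  by_contra hcon
  have h4 := pow_lt_pow_left₀ (not_le.1 hcon) (abs_nonneg _) two_ne_zero
  rw [sq_abs] at h4
  have h5 : 0 < m ^ 2 := by positivity
  nlinarith

variable {Γ : ℕ → ℝ → EuclideanSpace ℝ (Fin d)}

/-- The chords of a short arc are nearly parallel to its tangent. -/
theorem norm_chord_sub_le (hΓ : IsDerivChain Γ u v) (hΓ0 : ∀ t ∈ Icc u v, Γ 0 t = γ t)
    {w : EuclideanSpace ℝ (Fin d)} {ε : ℝ} (hε : ∀ t ∈ Icc u v, ‖Γ 1 t - w‖ ≤ ε) {s t : ℝ}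
    (hs : s ∈ Icc u v) (ht : t ∈ Icc u v) : ‖γ t - γ s - (t - s) • w‖ ≤ ε * |t - s| := by
  have h := (convex_Icc u v).norm_image_sub_le_of_norm_hasDerivWithin_le
    (f := fun t => Γ 0 t - t • w) (f' := fun t => Γ 1 t - (1 : ℝ) • w) (C := ε)
    (fun x hx => (hΓ 0 x hx).sub ((hasDerivWithinAt_id x _).smul_const w))
    (fun x hx => by rw [one_smul]; exact hε x hx) hs ht
  rw [hΓ0 s hs, hΓ0 t ht, Real.norm_eq_abs] at h
  have e : γ t - γ s - (t - s) • w = γ t - t • w - (γ s - s • w) := by module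
  rw [e]
  exact h

/-- The mean square over the directions that have a component across the tangent in the plane of
the coordinates `i, j`. -/
theorem exists_lintegral_indicator_arcHat_le (hγ : Continuous γ) (hχ : Continuous χ) (huv : u ≤ v)
    {M : ℝ} (hM : ∀ t, ‖χ t‖ ≤ M) (i j : Fin d) {w : EuclideanSpace ℝ (Fin d)} {k : ℝ}
    (hk : 0 < k) (hkw : k ≤ ‖w‖)
    (hchord : ∀ s ∈ Icc u v, ∀ t ∈ Icc u v, ‖γ t - γ s - (t - s) • w‖ ≤ k / 8 * |t - s|) :
    ∃ C : ℝ, 0 ≤ C ∧ ∀ R : ℝ, 1 ≤ R →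
      ∫⁻ θ : Metric.sphere (0 : EuclideanSpace ℝ (Fin d)) 1,
        {x : EuclideanSpace ℝ (Fin d) | k ≤ |x i * w j - x j * w i|}.indicator
          (fun x => ENNReal.ofReal (‖arcHat γ χ u v (R • x)‖ ^ 2)) θ
        ∂(volume : Measure (EuclideanSpace ℝ (Fin d))).toSphere ≤ ENNReal.ofReal (C / R) := by
  by_cases hij : i = j
  · refine ⟨0, le_rfl, fun R _ => ?_⟩
    have : {x : EuclideanSpace ℝ (Fin d) | k ≤ |x i * w j - x j * w i|} = ∅ := by
      refine eq_empty_of_forall_notMem fun x hx => ?_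
      have hx' : k ≤ |x i * w j - x j * w i| := hx
      rw [hij, sub_self, abs_zero] at hx'
      linarith
    simp [this]
  have hM0 : 0 ≤ M := (norm_nonneg _).trans (hM 0)
  have hw0 : 0 < ‖w‖ := hk.trans_le hkw
  -- `L` bounds the components of the chords per unit of parameter; the angle `δ` is so small that
  -- the rotation changes the component across `w` by at most `k / 2`
  set L := 4 * ‖w‖ with hL
  set δ := k / (16 * L) with hδ
  have hδ0 : 0 < δ := by positivity
  have hL0 : 0 < L := by positivity
  have hLδ : L * δ ≤ k / 4 / 4 := by
    have : L * δ = k / 16 := by rw [hδ]; field_simp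
    linarith
  have hδ1 : δ ≤ 1 := by rw [hδ, div_le_one (by positivity)]; linarith
  obtain ⟨C, hC, hker⟩ := exists_norm_integral_angle_le (c := k / 4) (L := L) (by positivity) hδ0
    hδ1 (by positivity) hLδ
  have hδδ : -δ ≤ δ := by linarith
  set W : ENNReal := ∫⁻ α in Ioc (-δ) δ, ENNReal.ofReal ((δ ^ 2 - α ^ 2) ^ 2) with hW
  have hηc : Continuous fun α : ℝ => (δ ^ 2 - α ^ 2) ^ 2 := by fun_prop
  have hW0 : W = ENNReal.ofReal (∫ α in -δ..δ, (δ ^ 2 - α ^ 2) ^ 2) := by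
    rw [intervalIntegral.integral_of_le hδδ, ofReal_integral_eq_lintegral_ofReal]
    · exact (hηc.intervalIntegrable _ _).1
    · exact Eventually.of_forall fun α => sq_nonneg _
  set W' := ∫ α in -δ..δ, (δ ^ 2 - α ^ 2) ^ 2 with hW'
  have hWpos : 0 < W' := by
    refine intervalIntegral.intervalIntegral_pos_of_pos_on (hηc.intervalIntegrable _ _)
      (fun x hx => ?_) (by linarith)
    have : x ^ 2 < δ ^ 2 := sq_lt_sq' hx.1 hx.2
    have : 0 < δ ^ 2 - x ^ 2 := by linarith
    positivity
  set σ := (volume : Measure (EuclideanSpace ℝ (Fin d))).toSphere univ with hσ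
  have hσt : σ ≠ ⊤ := measure_ne_top _ _
  set Y := M ^ 2 * C * ((v - u) * Real.pi) with hY
  have hY0 : 0 ≤ Y := by
    have := sub_nonneg.2 huv
    have := Real.pi_pos
    positivity
  refine ⟨Y * σ.toReal / W', by positivity, fun R hR => ?_⟩
  have hR0 : 0 < R := by linarith
  have hchordL : ∀ s ∈ Icc u v, ∀ t ∈ Icc u v, 2 * ‖γ t - γ s‖ ≤ L * |t - s| := by
    intro s hs t ht
    have h1 := hchord s hs t ht
    have h2 : ‖γ t - γ s‖ ≤ ‖γ t - γ s - (t - s) • w‖ + ‖(t - s) • w‖ := by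
      simpa using norm_add_le (γ t - γ s - (t - s) • w) ((t - s) • w)
    rw [norm_smul, Real.norm_eq_abs] at h2
    have h3 : k / 8 * |t - s| ≤ ‖w‖ * |t - s| := by gcongr; linarith
    rw [hL]
    linarith
  have key := lintegral_indicator_toSphere_le hij (δ := δ)
    (A := {x : EuclideanSpace ℝ (Fin d) | k ≤ |x i * w j - x j * w i|})
    (measurableSet_le measurable_const (by fun_prop))
    (g := fun x => ENNReal.ofReal (‖arcHat γ χ u v (R • x)‖ ^ 2))
    (X := ENNReal.ofReal (Y / R))
    (by
      have := continuous_arcHat hγ hχ u v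
      exact (ENNReal.continuous_ofReal.comp
        ((this.comp (continuous_const_smul R)).norm.pow 2)).measurable) ?_
  · rw [← hW, hW0, ← hσ, ← ENNReal.ofReal_toReal hσt,
      ← ENNReal.ofReal_mul (by positivity)] at key
    have h1 : ENNReal.ofReal (Y / R * σ.toReal) =
        ENNReal.ofReal W' * ENNReal.ofReal (Y * σ.toReal / W' / R) := by
      rw [← ENNReal.ofReal_mul hWpos.le]
      congr 1
      field_simp
    rw [h1] at key
    exact (ENNReal.mul_le_mul_iff_right (by simpa using hWpos) ENNReal.ofReal_ne_top).1 key
  -- a direction whose orbit meets the region has itself a component across `w`, and then so it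
  -- has across all chords of the arc
  · rintro θ hθ ⟨α, hα, hmem⟩
    have hS : k / 2 ≤ |θ i * w j - θ j * w i| := by
      have h1 : k ≤ |planeRotation hij α θ i * w j - planeRotation hij α θ j * w i| := hmem
      rw [planeRotation_wedge] at h1
      have h2 := abs_sub ((θ i * w j - θ j * w i) * Real.cos α)
        ((θ i * w i + θ j * w j) * Real.sin α)
      rw [abs_mul, abs_mul] at h2
      have h3 : |θ i * w j - θ j * w i| * |Real.cos α| ≤ |θ i * w j - θ j * w i| :=
        mul_le_of_le_one_right (abs_nonneg _) (Real.abs_cos_le_one _)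
      have h4 : |θ i * w i + θ j * w j| * |Real.sin α| ≤ 2 * (‖θ‖ * ‖w‖) * δ := by
        gcongr
        · exact abs_dot_le _ _ _ _
        · exact Real.abs_sin_le_abs.trans (abs_le.2 hα)
      have h5 : 2 * (‖θ‖ * ‖w‖) * δ = L * δ / 2 := by rw [hθ, hL]; ring
      linarith
    have hmain := integral_sq_arcHat_le hγ hχ huv hM hij (θ := θ) hδ0 hR0 hC.le hker
      (fun s hs t ht => (abs_dot_le _ _ _ _).trans (by
        rw [hθ, one_mul]; exact hchordL s hs t ht))
      (fun s hs t ht => ?_)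
      (fun s hs t ht => (abs_wedge_le _ _ _ _).trans (by
        rw [hθ, one_mul]; exact hchordL s hs t ht))
    · rw [intervalIntegral.integral_of_le hδδ] at hmain
      have hcont : Continuous fun α => (δ ^ 2 - α ^ 2) ^ 2 *
          ‖arcHat γ χ u v (R • planeRotation hij α θ)‖ ^ 2 := by
        have h1 : Continuous fun α => planeRotation hij α θ :=
          (continuous_planeRotation hij).comp (continuous_id.prodMk continuous_const)
        exact hηc.mul (((continuous_arcHat hγ hχ u v).comp (h1.const_smul R)).norm.pow 2)
      have h2 : Y / R = M ^ 2 * C * ((v - u) * (Real.pi / R)) := by rw [hY]; ring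
      rw [h2]
      refine le_trans (le_of_eq ?_) (ENNReal.ofReal_le_ofReal hmain)
      rw [ofReal_integral_eq_lintegral_ofReal]
      · refine lintegral_congr fun α => ?_
        rw [ENNReal.ofReal_mul (sq_nonneg _)]
      · exact (hcont.intervalIntegrable _ _).1
      · exact Eventually.of_forall fun α => by simp only [Pi.zero_apply]; positivity
    · have h1 := abs_wedge_le θ (γ t - γ s - (t - s) • w) i j
      rw [hθ, one_mul] at h1
      have h2 := hchord s hs t ht
      have e : θ i * (γ t - γ s) j - θ j * (γ t - γ s) i =
          (t - s) * (θ i * w j - θ j * w i) + (θ i * (γ t - γ s - (t - s) • w) j -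
            θ j * (γ t - γ s - (t - s) • w) i) := by
        simp only [PiLp.sub_apply, PiLp.smul_apply, smul_eq_mul]
        ring
      rw [e]
      set ρ := θ i * (γ t - γ s - (t - s) • w) j - θ j * (γ t - γ s - (t - s) • w) i
      have h3 := abs_sub_abs_le_abs_add ((t - s) * (θ i * w j - θ j * w i)) ρ
      rw [abs_mul] at h3
      have h4 : |t - s| * (k / 2) ≤ |t - s| * |θ i * w j - θ j * w i| := by gcongr
      linarith

/-- The bound at the directions nearly parallel to the tangent, for which the phase has no critical
point. -/
theorem norm_arcHat_le_of_inner_ge (hΓ : IsDerivChain Γ u v) (hΓ0 : ∀ t ∈ Icc u v, Γ 0 t = γ t)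
    (hχ : ContDiff ℝ ∞ χ) (huv : u ≤ v) {m C₀ R : ℝ} (hm : 0 < m) (hR : 1 ≤ R)
    {θ : EuclideanSpace ℝ (Fin d)} (hθ : ‖θ‖ = 1)
    (h1 : ∀ t ∈ Icc u v, m ≤ |inner ℝ θ (Γ 1 t)|) (h2 : ∀ t ∈ Icc u v, ‖Γ 2 t‖ ≤ C₀) :
    ‖arcHat γ χ u v (R • θ)‖ ≤
      (2 / m + C₀ / m ^ 2 * (v - u)) * (‖χ v‖ + ∫ t in u..v, ‖deriv χ t‖) / R := by
  have hR0 : 0 < R := by linarith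
  have hF := hΓ.inner_left (-R) θ
  have e : arcHat γ χ u v (R • θ) = ∫ t in u..v, χ t *
      Complex.exp (Complex.I * ((-R * inner ℝ θ (Γ 0 t) : ℝ) : ℂ)) := by
    rw [arcHat]
    refine intervalIntegral.integral_congr fun t ht => ?_
    rw [uIcc_of_le huv] at ht
    simp only [hΓ0 t ht, real_inner_smul_left, neg_mul]
  have habs : ∀ j t, |-R * inner ℝ θ (Γ j t)| = R * |inner ℝ θ (Γ j t)| := fun j t => by
    rw [abs_mul, abs_neg, abs_of_pos hR0]
  have hC0 : 0 ≤ C₀ := (norm_nonneg _).trans (h2 u ⟨le_rfl, huv⟩)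
  rw [e]
  refine (norm_integral_amplitude_le (B := (2 / m + C₀ / m ^ 2 * (v - u)) / R) huv
    (continuousOn_exp_phase hΓ R θ) hχ fun x hx => ?_).trans_eq (by ring)
  have hsub : Icc u x ⊆ Icc u v := Icc_subset_Icc_right hx.2
  have h3 := (hF.mono hsub).norm_integral_exp_le_of_bound hx.1 (μ := R * m) (M := R * C₀)
    (by positivity)
    (fun t ht => by rw [habs]; gcongr; exact h1 t (hsub ht))
    (fun t ht => by
      rw [habs]
      gcongr
      exact (abs_real_inner_le_norm _ _).trans (by rw [hθ, one_mul]; exact h2 t (hsub ht)))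
  refine h3.trans ?_
  have e2 : (2 / m + C₀ / m ^ 2 * (v - u)) / R =
      2 / (R * m) + R * C₀ / (R * m) ^ 2 * (v - u) := by
    field_simp
  rw [e2]
  gcongr
  exact hx.2

/-- The mean square estimate for a short arc. -/
theorem exists_lintegral_short_arcHat_le (hγ : Continuous γ) (hχ : ContDiff ℝ ∞ χ) (huv : u ≤ v)
    {M : ℝ} (hM : ∀ t, ‖χ t‖ ≤ M) (hΓ : IsDerivChain Γ u v)
    (hΓ0 : ∀ t ∈ Icc u v, Γ 0 t = γ t) {w : EuclideanSpace ℝ (Fin d)} {m C₀ : ℝ} (hd : 0 < d)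
    (hm : 0 < m) (hmw : m ≤ ‖w‖) (h1 : ∀ t ∈ Icc u v, ‖Γ 1 t - w‖ ≤ m / d / 8)
    (h2 : ∀ t ∈ Icc u v, ‖Γ 2 t‖ ≤ C₀) :
    ∃ C : ℝ, 0 ≤ C ∧ ∀ R : ℝ, 1 ≤ R →
      ∫⁻ θ : Metric.sphere (0 : EuclideanSpace ℝ (Fin d)) 1,
        ENNReal.ofReal (‖arcHat γ χ u v (R • (θ : EuclideanSpace ℝ (Fin d)))‖ ^ 2)
        ∂(volume : Measure (EuclideanSpace ℝ (Fin d))).toSphere ≤ ENNReal.ofReal (C / R) := by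
  have hd1 : (1 : ℝ) ≤ d := by exact_mod_cast hd
  have hmd : m / d ≤ m := div_le_self hm.le hd1
  have hpair := fun i j => exists_lintegral_indicator_arcHat_le hγ hχ.continuous huv hM i j
    (w := w) (k := m / d) (by positivity) (hmd.trans hmw)
    (fun s hs t ht => norm_chord_sub_le hΓ hΓ0 h1 hs ht)
  choose C hC0 hC using hpair
  have hC₀ : 0 ≤ C₀ := (norm_nonneg _).trans (h2 u ⟨le_rfl, huv⟩)
  set B := (2 / (m / 4) + C₀ / (m / 4) ^ 2 * (v - u)) * (‖χ v‖ + ∫ t in u..v, ‖deriv χ t‖) with hB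
  set σ := (volume : Measure (EuclideanSpace ℝ (Fin d))).toSphere univ with hσ
  have hσt : σ ≠ ⊤ := measure_ne_top _ _
  refine ⟨∑ i, ∑ j, C i j + B ^ 2 * σ.toReal, ?_, fun R hR => ?_⟩
  · have : 0 ≤ ∑ i, ∑ j, C i j :=
      Finset.sum_nonneg fun i _ => Finset.sum_nonneg fun j _ => hC0 i j
    positivity
  have hR0 : 0 < R := by linarith
  set g : EuclideanSpace ℝ (Fin d) → ENNReal :=
    fun x => ENNReal.ofReal (‖arcHat γ χ u v (R • x)‖ ^ 2) with hg
  have hgm : Measurable g := (ENNReal.continuous_ofReal.comp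
    (((continuous_arcHat hγ hχ.continuous u v).comp (continuous_const_smul R)).norm.pow 2)).measurable
  set A : Fin d → Fin d → Set (EuclideanSpace ℝ (Fin d)) :=
    fun i j => {x | m / d ≤ |x i * w j - x j * w i|} with hA
  have hAm : ∀ i j, MeasurableSet (A i j) := fun i j =>
    measurableSet_le measurable_const (by fun_prop)
  have hpt : ∀ θ : Metric.sphere (0 : EuclideanSpace ℝ (Fin d)) 1,
      g θ ≤ (∑ i, ∑ j, (A i j).indicator g θ) + ENNReal.ofReal (B ^ 2 / R) := by
    intro θ
    by_cases hex : ∃ i j, (θ : EuclideanSpace ℝ (Fin d)) ∈ A i j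
    · obtain ⟨i, j, hij⟩ := hex
      have e1 : g θ = (A i j).indicator g θ := (indicator_of_mem hij g).symm
      calc g θ = (A i j).indicator g θ := e1
        _ ≤ ∑ j, (A i j).indicator g θ :=
          Finset.single_le_sum (f := fun j => (A i j).indicator g θ) (fun _ _ => zero_le)
            (Finset.mem_univ j)
        _ ≤ ∑ i, ∑ j, (A i j).indicator g θ :=
          Finset.single_le_sum (f := fun i => ∑ j, (A i j).indicator g θ) (fun _ _ => zero_le)
            (Finset.mem_univ i)
        _ ≤ _ := le_self_add
    · push Not at hex
      have hθ : ‖(θ : EuclideanSpace ℝ (Fin d))‖ = 1 := norm_eq_of_mem_sphere θ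
      have h3 := half_le_abs_inner_of_wedge_lt hθ hm hmw fun i j => not_le.1 (hex i j)
      have h4 : ∀ t ∈ Icc u v, m / 4 ≤ |inner ℝ (θ : EuclideanSpace ℝ (Fin d)) (Γ 1 t)| := by
        intro t ht
        have h5 := abs_real_inner_le_norm (θ : EuclideanSpace ℝ (Fin d)) (Γ 1 t - w)
        rw [hθ, one_mul, inner_sub_right] at h5
        have h6 := h1 t ht
        have h7 := abs_sub_abs_le_abs_sub (inner ℝ (θ : EuclideanSpace ℝ (Fin d)) w)
          (inner ℝ (θ : EuclideanSpace ℝ (Fin d)) (Γ 1 t))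
        rw [abs_sub_comm] at h7
        linarith
      have h5 := norm_arcHat_le_of_inner_ge hΓ hΓ0 hχ huv (by positivity) hR hθ h4 h2
      refine le_trans (ENNReal.ofReal_le_ofReal ?_) le_add_self
      calc _ ≤ (B / R) ^ 2 := by gcongr
        _ = B ^ 2 / R / R := by rw [div_pow]; field_simp
        _ ≤ B ^ 2 / R := div_le_self (by positivity) hR
  have hind : ∀ i j, Measurable fun θ : Metric.sphere (0 : EuclideanSpace ℝ (Fin d)) 1 =>
      (A i j).indicator g θ := fun i j => (hgm.indicator (hAm i j)).comp measurable_subtype_coe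
  calc _ ≤ ∫⁻ θ : Metric.sphere (0 : EuclideanSpace ℝ (Fin d)) 1,
        ((∑ i, ∑ j, (A i j).indicator g θ) + ENNReal.ofReal (B ^ 2 / R))
        ∂(volume : Measure (EuclideanSpace ℝ (Fin d))).toSphere := lintegral_mono hpt
    _ = (∑ i, ∑ j, ∫⁻ θ : Metric.sphere (0 : EuclideanSpace ℝ (Fin d)) 1, (A i j).indicator g θ
        ∂(volume : Measure (EuclideanSpace ℝ (Fin d))).toSphere) +
          ENNReal.ofReal (B ^ 2 / R) * σ := by
      rw [lintegral_add_right _ measurable_const, lintegral_const,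
        lintegral_finsetSum _ fun i _ => Finset.measurable_sum _ fun j _ => hind i j]
      congr 1
      exact Finset.sum_congr rfl fun i _ => lintegral_finsetSum _ fun j _ => hind i j
    _ ≤ (∑ i, ∑ j, ENNReal.ofReal (C i j / R)) + ENNReal.ofReal (B ^ 2 / R) * σ := by
      gcongr with i _ j _
      exact hC i j R hR
    _ = ENNReal.ofReal ((∑ i, ∑ j, C i j + B ^ 2 * σ.toReal) / R) := by
      have e1 : ∑ i, ∑ j, ENNReal.ofReal (C i j / R) =
          ENNReal.ofReal (∑ i, ∑ j, C i j / R) := by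
        rw [ENNReal.ofReal_sum_of_nonneg fun i _ => Finset.sum_nonneg fun j _ =>
          div_nonneg (hC0 i j) hR0.le]
        exact Finset.sum_congr rfl fun i _ =>
          (ENNReal.ofReal_sum_of_nonneg fun j _ => div_nonneg (hC0 i j) hR0.le).symm
      have e2 : ENNReal.ofReal (B ^ 2 / R) * σ = ENNReal.ofReal (B ^ 2 / R * σ.toReal) := by
        rw [ENNReal.ofReal_mul (by positivity), ENNReal.ofReal_toReal hσt]
      rw [e1, e2, ← ENNReal.ofReal_add
        (Finset.sum_nonneg fun i _ => Finset.sum_nonneg fun j _ => div_nonneg (hC0 i j) hR0.le)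
        (by positivity)]
      congr 1
      rw [add_div, Finset.sum_div]
      simp_rw [Finset.sum_div]
      ring

/-- The mean square over the sphere decays like `R⁻¹`, as soon as the curve has no stationary
point. -/
theorem exists_lintegral_arcHat_le {a b : ℝ} (hγ : Continuous γ) (hχ : ContDiff ℝ ∞ χ) {M : ℝ}
    (hM : ∀ t, ‖χ t‖ ≤ M) (hΓ : IsDerivChain Γ a b) (hΓ0 : ∀ t ∈ Icc a b, Γ 0 t = γ t)
    (hd : 0 < d) (hab : a ≤ b) (hne : ∀ t ∈ Icc a b, Γ 1 t ≠ 0) :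
    ∃ C : ℝ, 0 ≤ C ∧ ∀ R : ℝ, 1 ≤ R →
      ∫⁻ θ : Metric.sphere (0 : EuclideanSpace ℝ (Fin d)) 1,
        ENNReal.ofReal (‖arcHat γ χ a b (R • (θ : EuclideanSpace ℝ (Fin d)))‖ ^ 2)
        ∂(volume : Measure (EuclideanSpace ℝ (Fin d))).toSphere ≤ ENNReal.ofReal (C / R) := by
  have h2 : ∀ x : ℝ, 2 * ENNReal.ofReal x = ENNReal.ofReal (2 * x) := fun x => by
    rw [ENNReal.ofReal_mul zero_le_two, ENNReal.ofReal_ofNat]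
  obtain ⟨t₀, ht₀, hmin⟩ := isCompact_Icc.exists_isMinOn (nonempty_Icc.2 hab)
    (hΓ.continuousOn 1).norm
  set m := ‖Γ 1 t₀‖ with hm
  have hm0 : 0 < m := norm_pos_iff.2 (hne t₀ ht₀)
  obtain ⟨C₀, hC1, hC₀⟩ := hΓ.exists_norm_le 2
  have hd' : (0 : ℝ) < d := by exact_mod_cast hd
  set δ := m / d / 8 / C₀ with hδ
  have hδ0 : 0 < δ := by positivity
  have key : ∀ n : ℕ, ∀ u v, a ≤ u → u ≤ v → v ≤ b → v - u ≤ (n + 1) * δ →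
      ∃ C : ℝ, 0 ≤ C ∧ ∀ R : ℝ, 1 ≤ R →
      ∫⁻ θ : Metric.sphere (0 : EuclideanSpace ℝ (Fin d)) 1,
        ENNReal.ofReal (‖arcHat γ χ u v (R • (θ : EuclideanSpace ℝ (Fin d)))‖ ^ 2)
        ∂(volume : Measure (EuclideanSpace ℝ (Fin d))).toSphere ≤ ENNReal.ofReal (C / R) := by
    have hshort : ∀ u v, a ≤ u → u ≤ v → v ≤ b → v - u ≤ δ →
        ∃ C : ℝ, 0 ≤ C ∧ ∀ R : ℝ, 1 ≤ R →
        ∫⁻ θ : Metric.sphere (0 : EuclideanSpace ℝ (Fin d)) 1,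
          ENNReal.ofReal (‖arcHat γ χ u v (R • (θ : EuclideanSpace ℝ (Fin d)))‖ ^ 2)
          ∂(volume : Measure (EuclideanSpace ℝ (Fin d))).toSphere ≤ ENNReal.ofReal (C / R) := by
      intro u v hu huv hv hlen
      have hsub : Icc u v ⊆ Icc a b := Icc_subset_Icc hu hv
      have hu' : u ∈ Icc u v := ⟨le_rfl, huv⟩
      have hΓ' := hΓ.mono hsub
      refine exists_lintegral_short_arcHat_le hγ hχ huv hM hΓ' (fun t ht => hΓ0 t (hsub ht))
        (w := Γ 1 u) hd hm0 (hmin (hsub hu')) (fun t ht => ?_)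
        (fun t ht => hC₀ 2 le_rfl t (hsub ht))
      have h1 := (convex_Icc u v).norm_image_sub_le_of_norm_hasDerivWithin_le
        (f := Γ 1) (f' := Γ 2) (C := C₀) (fun x hx => hΓ' 1 x hx)
        (fun x hx => hC₀ 2 le_rfl x (hsub hx)) hu' ht
      refine h1.trans ?_
      rw [Real.norm_eq_abs, abs_of_nonneg (sub_nonneg.2 ht.1)]
      calc C₀ * (t - u) ≤ C₀ * δ := by gcongr; linarith [ht.2]
        _ = m / d / 8 := by rw [hδ]; field_simp
    intro n
    induction n with
    | zero => intro u v h1 huv h3 h4; exact hshort u v h1 huv h3 (by simpa using h4)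
    | succ n ih =>
      intro u v h1 huv h3 h4
      push_cast at h4
      set p := max u (v - δ) with hp
      have hup : u ≤ p := le_max_left _ _
      have hpv : p ≤ v := max_le huv (by linarith)
      have hr : v - p ≤ δ := by have := le_max_right u (v - δ); linarith
      have hl : p - u ≤ (n + 1) * δ := by
        rcases max_cases u (v - δ) with ⟨h, -⟩ | ⟨h, -⟩ <;> rw [hp, h]
        · rw [sub_self]; positivity
        · linarith
      obtain ⟨C, hC, HC⟩ := ih u p h1 hup (hpv.trans h3) hl
      obtain ⟨C', hC', HC'⟩ := hshort p v (h1.trans hup) hpv h3 hr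
      refine ⟨2 * C + 2 * C', by positivity, fun R hR => ?_⟩
      have hR0 : 0 < R := by linarith
      have hsplit : ∀ ξ, arcHat γ χ u v ξ = arcHat γ χ u p ξ + arcHat γ χ p v ξ := by
        intro ξ
        have hc : Continuous fun t =>
            χ t * Complex.exp (Complex.I * ((-inner ℝ ξ (γ t) : ℝ) : ℂ)) :=
          hχ.continuous.mul (Complex.continuous_exp.comp (continuous_const.mul
            (Complex.continuous_ofReal.comp (continuous_const.inner hγ).neg)))
        exact (intervalIntegral.integral_add_adjacent_intervals (hc.intervalIntegrable _ _)
          (hc.intervalIntegrable _ _)).symm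
      have hmeas : ∀ p q : ℝ, Measurable fun θ : Metric.sphere (0 : EuclideanSpace ℝ (Fin d)) 1 =>
          ENNReal.ofReal (‖arcHat γ χ p q (R • (θ : EuclideanSpace ℝ (Fin d)))‖ ^ 2) := fun p q =>
        (ENNReal.continuous_ofReal.comp (((continuous_arcHat hγ hχ.continuous p q).comp
          (continuous_subtype_val.const_smul R)).norm.pow 2)).measurable
      calc _ ≤ ∫⁻ θ : Metric.sphere (0 : EuclideanSpace ℝ (Fin d)) 1,
            (2 * ENNReal.ofReal (‖arcHat γ χ u p (R • (θ : EuclideanSpace ℝ (Fin d)))‖ ^ 2) +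
              2 * ENNReal.ofReal (‖arcHat γ χ p v (R • (θ : EuclideanSpace ℝ (Fin d)))‖ ^ 2))
            ∂(volume : Measure (EuclideanSpace ℝ (Fin d))).toSphere := by
            refine lintegral_mono fun θ => ?_
            simp only
            rw [h2, h2,
              ← ENNReal.ofReal_add (by positivity) (by positivity)]
            apply ENNReal.ofReal_le_ofReal
            rw [hsplit]
            set x := arcHat γ χ u p (R • (θ : EuclideanSpace ℝ (Fin d)))
            set y := arcHat γ χ p v (R • (θ : EuclideanSpace ℝ (Fin d)))
            have h3 := norm_add_le x y
            nlinarith [norm_nonneg (x + y), sq_nonneg (‖x‖ - ‖y‖)]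
        _ = 2 * _ + 2 * _ := by
            rw [lintegral_add_left ((hmeas u p).const_mul 2), lintegral_const_mul _ (hmeas u p),
              lintegral_const_mul _ (hmeas p v)]
        _ ≤ 2 * ENNReal.ofReal (C / R) + 2 * ENNReal.ofReal (C' / R) := by
            gcongr
            · exact HC R hR
            · exact HC' R hR
        _ = _ := by
            rw [h2, h2,
              ← ENNReal.ofReal_add (by positivity) (by positivity)]
            congr 1
            ring
  obtain ⟨n, hn⟩ := exists_nat_ge ((b - a) / δ)
  refine key n a b le_rfl hab le_rfl ?_
  have h1 : b - a ≤ n * δ := (div_le_iff₀ hδ0).1 hn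
  linarith

end MeanSquare

/-! ### The two classes of curves -/

section Curves

variable {d : ℕ} {γ : ℝ → EuclideanSpace ℝ (Fin d)} {a b : ℝ}

theorem isDerivChain_iteratedDerivWithin (hab : a < b) (hγ : ContDiffOn ℝ ∞ γ (Icc a b)) :
    IsDerivChain (fun j => iteratedDerivWithin j γ (Icc a b)) a b := by
  intro j t ht
  have h := (hγ.differentiableOn_iteratedDerivWithin (m := j) (by exact_mod_cast WithTop.coe_lt_top _)
    (uniqueDiffOn_Icc hab) t ht).hasDerivWithinAt
  simp only [iteratedDerivWithin_succ]
  exact h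

/-- A vector orthogonal to a spanning set vanishes. -/
theorem eq_zero_of_forall_inner_eq_zero {S : Set (EuclideanSpace ℝ (Fin d))}
    (hS : Submodule.span ℝ S = ⊤) {θ : EuclideanSpace ℝ (Fin d)}
    (h : ∀ v ∈ S, inner ℝ θ v = 0) : θ = 0 := by
  have h1 : ∀ v ∈ Submodule.span ℝ S, inner ℝ θ v = 0 := by
    intro v hv
    induction hv using Submodule.span_induction with
    | mem x hx => exact h x hx
    | zero => exact inner_zero_right _
    | add x y _ _ hx hy => rw [inner_add_right, hx, hy, add_zero]
    | smul c x _ hx => rw [inner_smul_right, hx, mul_zero]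
  exact inner_self_eq_zero.1 (h1 θ (hS ▸ Submodule.mem_top))

theorem ne_zero_of_norm_eq_one {θ : EuclideanSpace ℝ (Fin d)} (hθ : ‖θ‖ = 1) : θ ≠ 0 := by
  rintro rfl
  simp at hθ

theorem IsFiniteType.exists_lower_bound (hft : IsFiniteType γ a b) (hab : a < b)
    (hγ : ContDiffOn ℝ ∞ γ (Icc a b)) : ∃ N : ℕ, ∃ c > 0, ∀ t ∈ Icc a b,
      ∀ θ : EuclideanSpace ℝ (Fin d), ‖θ‖ = 1 →
        ∃ n, 1 ≤ n ∧ n ≤ N ∧ c ≤ |inner ℝ θ (iteratedDerivWithin n γ (Icc a b) t)| := by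
  refine (isDerivChain_iteratedDerivWithin hab hγ).exists_uniform_lower_bound {n | 1 ≤ n}
    fun t ht θ hθ => ?_
  by_contra! hcon
  refine ne_zero_of_norm_eq_one hθ (eq_zero_of_forall_inner_eq_zero (hft t ht) ?_)
  rintro _ ⟨n, hn, rfl⟩
  exact hcon n hn

/-- The derivatives of a nondegenerate curve control every direction. -/
theorem exists_lower_bound_of_linearIndependent {Γ : ℕ → ℝ → EuclideanSpace ℝ (Fin d)}
    (hΓ : IsDerivChain Γ a b)
    (hind : ∀ t ∈ Icc a b, LinearIndependent ℝ (fun j : Fin d => Γ ((j : ℕ) + 1) t)) :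
    ∃ c > 0, ∀ t ∈ Icc a b, ∀ θ : EuclideanSpace ℝ (Fin d), ‖θ‖ = 1 →
      ∃ n, 1 ≤ n ∧ n ≤ d ∧ c ≤ |inner ℝ θ (Γ n t)| := by
  obtain ⟨N, c, hc, h⟩ := hΓ.exists_uniform_lower_bound {n | 1 ≤ n ∧ n ≤ d} fun t ht θ hθ => by
    by_contra! hcon
    refine ne_zero_of_norm_eq_one hθ (eq_zero_of_forall_inner_eq_zero
      ((hind t ht).span_eq_top_of_card_eq_finrank' (by simp)) ?_)
    rintro _ ⟨j, rfl⟩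
    exact hcon _ ⟨by omega, by omega⟩
  refine ⟨c, hc, fun t ht θ hθ => ?_⟩
  obtain ⟨n, hn, -, hcn⟩ := h t ht θ hθ
  exact ⟨n, hn.1, hn.2, hcn⟩

theorem IsPolynomialCurve.iteratedDerivWithin_apply {p : Fin d → Polynomial ℝ} (hab : a < b)
    (hγ : ContDiffOn ℝ ∞ γ (Icc a b)) (hp : ∀ t ∈ Icc a b, ∀ i, γ t i = (p i).eval t) (n : ℕ) :
    ∀ t ∈ Icc a b, ∀ i,
      iteratedDerivWithin n γ (Icc a b) t i = (Polynomial.derivative^[n] (p i)).eval t := by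
  induction n with
  | zero => intro t ht i; rw [iteratedDerivWithin_zero]; exact hp t ht i
  | succ n ih =>
    intro t ht i
    have h1 := isDerivChain_iteratedDerivWithin hab hγ n t ht
    have h2 : HasDerivWithinAt (fun s => iteratedDerivWithin n γ (Icc a b) s i)
        (iteratedDerivWithin (n + 1) γ (Icc a b) t i) (Icc a b) t :=
      (EuclideanSpace.proj (𝕜 := ℝ) i).hasFDerivAt.comp_hasDerivWithinAt t h1
    have h3 := ((Polynomial.derivative^[n] (p i)).hasDerivWithinAt t (Icc a b)).congr
      (fun s hs => ih s hs i) (ih t ht i)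
    rw [Function.iterate_succ_apply']
    exact (uniqueDiffOn_Icc hab t ht).eq_deriv _ h2 h3

theorem IsPolynomialCurve.exists_iteratedDerivWithin_eq_zero (hpoly : IsPolynomialCurve γ a b)
    (hab : a < b) (hγ : ContDiffOn ℝ ∞ γ (Icc a b)) :
    ∃ N : ℕ, ∀ n, N ≤ n → ∀ t ∈ Icc a b, iteratedDerivWithin n γ (Icc a b) t = 0 := by
  obtain ⟨p, hp⟩ := hpoly
  refine ⟨Finset.univ.sup (fun i => (p i).natDegree) + 1, fun n hn t ht => ?_⟩
  ext i
  have h1 : (p i).natDegree ≤ Finset.univ.sup (fun i => (p i).natDegree) :=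
    Finset.le_sup (f := fun i => (p i).natDegree) (Finset.mem_univ i)
  rw [IsPolynomialCurve.iteratedDerivWithin_apply hab hγ hp n t ht i,
    Polynomial.iterate_derivative_eq_zero (by omega)]
  simp

/-- Both classes of curves satisfy the two multiscale properties, with arbitrarily many
derivatives. -/
theorem exists_multiscale (hab : a < b) (hγ : ContDiffOn ℝ ∞ γ (Icc a b))
    (htype : IsFiniteType γ a b ∨ IsPolynomialCurve γ a b) (K : ℕ) : ∃ N, K ≤ N ∧
      HasMultiscaleDecay (fun j => iteratedDerivWithin j γ (Icc a b)) a b N ∧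
      HasMultiscaleStability (fun j => iteratedDerivWithin j γ (Icc a b)) a b N := by
  have hΓ := isDerivChain_iteratedDerivWithin hab hγ
  rcases htype with hft | hpoly
  · obtain ⟨N, c, hc, h⟩ := hft.exists_lower_bound hab hγ
    have h' : ∀ t ∈ Icc a b, ∀ θ : EuclideanSpace ℝ (Fin d), ‖θ‖ = 1 →
        ∃ n, 1 ≤ n ∧ n ≤ max N K ∧ c ≤ |inner ℝ θ (iteratedDerivWithin n γ (Icc a b) t)| :=
      fun t ht θ hθ => by
        obtain ⟨n, h1, h2, h3⟩ := h t ht θ hθ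
        exact ⟨n, h1, h2.trans (le_max_left _ _), h3⟩
    exact ⟨max N K, le_max_right _ _, hasMultiscaleDecay_of_lower_bound hΓ hc h',
      hasMultiscaleStability_of_lower_bound hΓ hc h'⟩
  · obtain ⟨N, h⟩ := hpoly.exists_iteratedDerivWithin_eq_zero hab hγ
    have h' : ∀ t ∈ Icc a b, iteratedDerivWithin (max N K + 1) γ (Icc a b) t = 0 :=
      h _ ((le_max_left _ _).trans (Nat.le_succ _))
    exact ⟨max N K, le_max_right _ _, hasMultiscaleDecay_of_eq_zero hΓ h',
      hasMultiscaleStability_of_eq_zero hΓ h'⟩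

end Curves

/-! ### From moments to the exponents -/

section Exponents

theorem breakpoint_cast (k : ℕ) : (breakpoint k : ℝ) = ((k : ℝ) ^ 2 + k + 2) / 2 := by
  induction k with
  | zero => norm_num [breakpoint]
  | succ k ih => rw [breakpoint_succ]; push_cast; rw [ih]; ring

/-- The exponent of the mean of order `p` in terms of the breakpoint to the left. -/
theorem sigmaLine_succ {q : ENNReal} (hq0 : q ≠ 0) (hqt : q ≠ ⊤) (k : ℕ) :
    sigmaLine (k + 1) q =
      (k + (q.toReal - breakpoint k) / ((k + 1 : ℕ) : ℝ)) / q.toReal := by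
  have hp : 0 < q.toReal := ENNReal.toReal_pos hq0 hqt
  rw [sigmaLine, ENNReal.toReal_inv, breakpoint_cast]
  have : (0 : ℝ) < ((k + 1 : ℕ) : ℝ) := by positivity
  push_cast at this ⊢
  field_simp
  ring

theorem sigmaLine_breakpoint_succ (k : ℕ) :
    sigmaLine (k + 1) (breakpoint (k + 1)) = ((k + 1 : ℕ) : ℝ) / breakpoint (k + 1) := by
  have h0 : breakpoint (k + 1) ≠ 0 := by rw [breakpoint_succ]; omega
  rw [sigmaLine_succ (by exact_mod_cast h0) (ENNReal.natCast_ne_top _), ENNReal.toReal_natCast]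
  congr 1
  rw [breakpoint_succ k]
  push_cast
  field_simp
  ring

theorem iInf_sigmaLine_le {n k : ℕ} (h2 : 2 ≤ k) (hk : k ≤ n) (q : ENNReal) :
    ⨅ j : Finset.Icc 2 n, sigmaLine j q ≤ sigmaLine k q :=
  ciInf_le (f := fun j : Finset.Icc 2 n => sigmaLine j q) (Set.finite_range _).bddBelow
    ⟨k, Finset.mem_Icc.2 ⟨h2, hk⟩⟩

theorem sigma_le_sigmaLine {d K k : ℕ} (h2 : 2 ≤ k) (hk : k ≤ K) (q : ENNReal) :
    sigma d K q ≤ sigmaLine k q := by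
  rw [sigma]
  split_ifs with h
  · exact iInf_sigmaLine_le h2 (h ▸ hk) q
  · exact (min_le_left _ _).trans (iInf_sigmaLine_le h2 hk q)

theorem sigma_le_mul_inv {d K : ℕ} (h : K ≠ d) (q : ENNReal) :
    sigma d K q ≤ K * (q⁻¹).toReal := by
  rw [sigma, if_neg h]
  exact min_le_right _ _

theorem exists_breakpoint_lt {p : ℝ} (hp : 2 < p) (n : ℕ) (hn : p ≤ breakpoint n) :
    ∃ k, 1 ≤ k ∧ k + 1 ≤ n ∧ (breakpoint k : ℝ) < p ∧ p ≤ breakpoint (k + 1) := by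
  induction n with
  | zero => norm_num [breakpoint] at hn; linarith
  | succ n ih =>
    rcases le_or_gt p (breakpoint n) with h | h
    · obtain ⟨k, h1, h2, h3⟩ := ih h
      exact ⟨k, h1, by omega, h3⟩
    · refine ⟨n, ?_, le_rfl, h, hn⟩
      by_contra h0
      obtain rfl : n = 0 := by omega
      norm_num [breakpoint] at hn
      linarith

end Exponents

section Means

variable {d : ℕ} {γ : ℝ → EuclideanSpace ℝ (Fin d)} {χ : ℝ → ℂ}

/-- The level sets of `μ̂` on the sphere of radius `R` have the size given by the order `k` at
every height. -/
def HasLevelBound (γ : ℝ → EuclideanSpace ℝ (Fin d)) (χ : ℝ → ℂ) (k : ℕ) : Prop :=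
  ∃ C : ℝ, 0 < C ∧ ∀ R : ℝ, 1 ≤ R → ∀ l : ℝ, 0 < l →
    (volume : Measure (EuclideanSpace ℝ (Fin d))).toSphere
      {θ | l < ‖muHat γ χ (R • (θ : EuclideanSpace ℝ (Fin d)))‖} ≤
        ENNReal.ofReal (C * R ^ (-(k : ℝ)) * l ^ (-(breakpoint k : ℝ)))

theorem measurable_norm_muHat (hm : Continuous (muHat γ χ)) (R : ℝ) :
    Measurable fun θ : Metric.sphere (0 : EuclideanSpace ℝ (Fin d)) 1 =>
      ‖muHat γ χ (R • (θ : EuclideanSpace ℝ (Fin d)))‖ :=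
  (hm.comp (continuous_subtype_val.const_smul R)).norm.measurable

theorem exists_G_le_of_lintegral_le {q : ENNReal} (hq0 : q ≠ 0) (hqt : q ≠ ⊤) {C E : ℝ}
    (h : ∀ R : ℝ, 1 ≤ R → ∫⁻ θ : Metric.sphere (0 : EuclideanSpace ℝ (Fin d)) 1,
      ENNReal.ofReal (‖muHat γ χ (R • (θ : EuclideanSpace ℝ (Fin d)))‖ ^ q.toReal)
        ∂(volume : Measure (EuclideanSpace ℝ (Fin d))).toSphere ≤ ENNReal.ofReal (C * R ^ (-E)))
    {σ : ℝ} (hσ : σ ≤ E / q.toReal) :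
    ∃ C : ℝ, 0 < C ∧ ∀ R : ℝ, 2 ≤ R → G γ χ q R ≤ ENNReal.ofReal (C * R ^ (-σ)) := by
  set C' := max C 1 with hC'
  have hC0 : 0 < C' := lt_max_of_lt_right one_pos
  refine ⟨C' ^ (1 / q.toReal), by positivity, fun R hR => ?_⟩
  have hR0 : 0 < R := by linarith
  have h1 := G_le_of_lintegral_le hq0 hqt (X := C' * R ^ (-E)) (by positivity)
    ((h R (by linarith)).trans (ENNReal.ofReal_le_ofReal (by gcongr; exact le_max_left _ _)))
  refine h1.trans (ENNReal.ofReal_le_ofReal ?_)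
  rw [Real.mul_rpow hC0.le (by positivity), ← Real.rpow_mul hR0.le]
  gcongr
  · linarith
  · rw [mul_one_div, neg_div]; linarith

/-- Strictly between two breakpoints, the two level set bounds meet at height `R ^ (-1 / (k + 1))`. -/
theorem exists_G_le_of_two_levels (hm : Continuous (muHat γ χ)) {k : ℕ}
    (h₀ : HasLevelBound γ χ k) (h₁ : HasLevelBound γ χ (k + 1)) {q : ENNReal} (hq0 : q ≠ 0)
    (hqt : q ≠ ⊤) (hk : breakpoint k < q.toReal) (hk' : q.toReal < breakpoint (k + 1)) {σ : ℝ}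
    (hσ : σ ≤ sigmaLine (k + 1) q) :
    ∃ C : ℝ, 0 < C ∧ ∀ R : ℝ, 2 ≤ R → G γ χ q R ≤ ENNReal.ofReal (C * R ^ (-σ)) := by
  obtain ⟨C₀, hC₀, H₀⟩ := h₀
  obtain ⟨C₁, hC₁, H₁⟩ := h₁
  rw [sigmaLine_succ hq0 hqt] at hσ
  have hp : 0 < q.toReal := ENNReal.toReal_pos hq0 hqt
  set p := q.toReal
  refine exists_G_le_of_lintegral_le hq0 hqt
    (C := p * (C₀ / (p - breakpoint k) + C₁ / (breakpoint (k + 1) - p))) (fun R hR => ?_) hσ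
  have hR0 : 0 < R := by linarith
  refine (lintegral_rpow_le_of_two_levels (fun θ => norm_nonneg _)
    (measurable_norm_muHat hm R).aemeasurable hp hk hk' (by positivity) (by positivity)
    (s := R ^ (-(1 / ((k + 1 : ℕ) : ℝ)))) (by positivity) (H₀ R hR) (H₁ R hR)).trans_eq ?_
  congr 1
  rw [mul_assoc C₀, mul_assoc C₁, ← Real.rpow_mul hR0.le, ← Real.rpow_mul hR0.le,
    ← Real.rpow_add hR0, ← Real.rpow_add hR0]
  have e₀ : -(k : ℝ) + -(1 / ((k + 1 : ℕ) : ℝ)) * (p - breakpoint k) =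
      -(k + (p - breakpoint k) / ((k + 1 : ℕ) : ℝ)) := by ring
  have e₁ : -((k + 1 : ℕ) : ℝ) + -(1 / ((k + 1 : ℕ) : ℝ)) * (p - breakpoint (k + 1)) =
      -(k + (p - breakpoint k) / ((k + 1 : ℕ) : ℝ)) := by
    rw [breakpoint_succ]
    have : ((k + 1 : ℕ) : ℝ) ≠ 0 := by positivity
    push_cast at this ⊢
    field_simp
    ring
  rw [e₀, e₁]
  ring

/-- At a breakpoint, the two level set bounds leave a logarithm. -/
theorem exists_G_breakpoint_le (hm : Continuous (muHat γ χ)) {k : ℕ} (h₀ : HasLevelBound γ χ k)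
    (h₁ : HasLevelBound γ χ (k + 1)) {σ : ℝ}
    (hσ : σ ≤ sigmaLine (k + 1) (breakpoint (k + 1))) :
    ∃ C : ℝ, 0 < C ∧ ∀ R : ℝ, 2 ≤ R → G γ χ (breakpoint (k + 1)) R ≤
      ENNReal.ofReal (C * R ^ (-σ) * Real.log R ^ (1 / (breakpoint (k + 1) : ℝ))) := by
  obtain ⟨C₀, hC₀, H₀⟩ := h₀
  obtain ⟨C₁, hC₁, H₁⟩ := h₁
  rw [sigmaLine_breakpoint_succ] at hσ
  set M := max 1 (∫ t, ‖χ t‖) with hM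
  have hM1 : 1 ≤ M := le_max_left _ _
  have hlogM : 0 ≤ Real.log M := Real.log_nonneg hM1
  have hlog2 : 0 < Real.log 2 := Real.log_pos one_lt_two
  have hq0 : 0 < breakpoint (k + 1) := by rw [breakpoint_succ]; omega
  have hp : (0 : ℝ) < breakpoint (k + 1) := by exact_mod_cast hq0
  set p := ((breakpoint (k + 1) : ℕ) : ℝ) with hpdef
  have hpk : p = breakpoint k + ((k + 1 : ℕ) : ℝ) := by
    rw [hpdef, breakpoint_succ]; push_cast; ring
  have hk0 : (0 : ℝ) < ((k + 1 : ℕ) : ℝ) := by positivity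
  have hkp : breakpoint k < p := by linarith
  have hkp' : p - breakpoint k = ((k + 1 : ℕ) : ℝ) := by linarith
  set D := p * (C₀ / ((k + 1 : ℕ) : ℝ) / Real.log 2 + C₁ * (Real.log M / Real.log 2 + 1)) with hD
  have hD0 : 0 < D := by positivity
  refine ⟨D ^ (1 / p), by positivity, fun R hR => ?_⟩
  have hR0 : 0 < R := by linarith
  have hR1 : 1 ≤ R := by linarith
  have hlog : Real.log 2 ≤ Real.log R := Real.log_le_log two_pos hR
  have hlogR : 0 < Real.log R := hlog2.trans_le hlog
  have h1 : 1 ≤ Real.log R / Real.log 2 := (one_le_div hlog2).2 hlog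
  have hs1 : R ^ (-(1 / ((k + 1 : ℕ) : ℝ))) ≤ 1 :=
    Real.rpow_le_one_of_one_le_of_nonpos hR1 (neg_nonpos.2 (by positivity))
  have hint := lintegral_rpow_le_of_critical_level (fun θ => norm_nonneg _)
    (measurable_norm_muHat hm R).aemeasurable hp hkp (by positivity) (by positivity)
    (s := R ^ (-(1 / ((k + 1 : ℕ) : ℝ)))) (by positivity) (hs1.trans hM1)
    (fun θ => (norm_muHat_le γ χ _).trans (le_max_right _ _)) (H₀ R hR1) (H₁ R hR1)
  have hbound : p * (C₀ * R ^ (-(k : ℝ)) * (R ^ (-(1 / ((k + 1 : ℕ) : ℝ)))) ^ (p - breakpoint k) /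
      (p - breakpoint k) + C₁ * R ^ (-((k + 1 : ℕ) : ℝ)) *
        Real.log (M / R ^ (-(1 / ((k + 1 : ℕ) : ℝ))))) ≤
      D * R ^ (-((k + 1 : ℕ) : ℝ)) * Real.log R := by
    have e₀ : C₀ * R ^ (-(k : ℝ)) * (R ^ (-(1 / ((k + 1 : ℕ) : ℝ)))) ^ (p - breakpoint k) =
        C₀ * R ^ (-((k + 1 : ℕ) : ℝ)) := by
      rw [hkp', mul_assoc, ← Real.rpow_mul hR0.le, ← Real.rpow_add hR0]
      congr 2
      rw [neg_mul, one_div_mul_cancel hk0.ne']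
      push_cast
      ring
    have e₁ : Real.log (M / R ^ (-(1 / ((k + 1 : ℕ) : ℝ)))) ≤
        (Real.log M / Real.log 2 + 1) * Real.log R := by
      rw [Real.log_div (by linarith) (by positivity), Real.log_rpow hR0]
      have h2 : 1 / ((k + 1 : ℕ) : ℝ) ≤ 1 := by
        rw [div_le_one hk0]; push_cast; linarith [(Nat.cast_nonneg k : (0 : ℝ) ≤ k)]
      have h3 : 1 / ((k + 1 : ℕ) : ℝ) * Real.log R ≤ 1 * Real.log R := by gcongr
      have h4 : Real.log M * 1 ≤ Real.log M * (Real.log R / Real.log 2) := by gcongr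
      have h5 : Real.log M * (Real.log R / Real.log 2) = Real.log M / Real.log 2 * Real.log R := by
        ring
      linarith
    rw [e₀, hkp']
    calc _ ≤ p * (C₀ * R ^ (-((k + 1 : ℕ) : ℝ)) / ((k + 1 : ℕ) : ℝ) *
          (Real.log R / Real.log 2) + C₁ * R ^ (-((k + 1 : ℕ) : ℝ)) *
            ((Real.log M / Real.log 2 + 1) * Real.log R)) := by
          gcongr
          exact le_mul_of_one_le_right (by positivity) h1
      _ = _ := by rw [hD]; ring
  have hG := G_le_of_lintegral_le (q := (breakpoint (k + 1) : ENNReal)) (R := R)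
    (by exact_mod_cast hq0.ne') (ENNReal.natCast_ne_top _)
    (X := D * R ^ (-((k + 1 : ℕ) : ℝ)) * Real.log R) (by positivity)
    (by rw [ENNReal.toReal_natCast]; exact hint.trans (ENNReal.ofReal_le_ofReal hbound))
  rw [ENNReal.toReal_natCast] at hG
  refine hG.trans (ENNReal.ofReal_le_ofReal ?_)
  rw [Real.mul_rpow (by positivity) hlogR.le, Real.mul_rpow hD0.le (by positivity),
    ← Real.rpow_mul hR0.le]
  gcongr
  rw [mul_one_div, neg_div]
  linarith

/-- Beyond the last available breakpoint, the level set bound is combined with a uniform bound. -/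
theorem exists_G_le_of_sup_le (hm : Continuous (muHat γ χ)) {k : ℕ} (h₀ : HasLevelBound γ χ k)
    {A e : ℝ} (hA : 0 ≤ A) (hsup : ∀ R : ℝ, 1 ≤ R → ∀ θ : EuclideanSpace ℝ (Fin d), ‖θ‖ = 1 →
      ‖muHat γ χ (R • θ)‖ ≤ A * R ^ (-e)) {q : ENNReal} (hq0 : q ≠ 0) (hqt : q ≠ ⊤)
    (hk : breakpoint k < q.toReal) {σ : ℝ}
    (hσ : σ ≤ (k + e * (q.toReal - breakpoint k)) / q.toReal) :
    ∃ C : ℝ, 0 < C ∧ ∀ R : ℝ, 2 ≤ R → G γ χ q R ≤ ENNReal.ofReal (C * R ^ (-σ)) := by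
  obtain ⟨C₀, hC₀, H₀⟩ := h₀
  have hp : 0 < q.toReal := ENNReal.toReal_pos hq0 hqt
  set p := q.toReal
  refine exists_G_le_of_lintegral_le hq0 hqt
    (C := p * (C₀ * A ^ (p - breakpoint k) / (p - breakpoint k))) (fun R hR => ?_) hσ
  have hR0 : 0 < R := by linarith
  refine (lintegral_rpow_le_of_bounded (fun θ => norm_nonneg _)
    (measurable_norm_muHat hm R).aemeasurable hp hk (by positivity) (by positivity)
    (M := A * R ^ (-e)) (fun θ => hsup R hR θ (norm_eq_of_mem_sphere θ)) (H₀ R hR)).trans_eq ?_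
  congr 1
  rw [Real.mul_rpow hA (by positivity), ← Real.rpow_mul hR0.le]
  have : -((k : ℝ) + e * (p - breakpoint k)) = -(k : ℝ) + -e * (p - breakpoint k) := by ring
  rw [this, Real.rpow_add hR0]
  ring

theorem exists_G_top_le {A e : ℝ} (hA : 0 < A) (hsup : ∀ R : ℝ, 1 ≤ R →
      ∀ θ : EuclideanSpace ℝ (Fin d), ‖θ‖ = 1 → ‖muHat γ χ (R • θ)‖ ≤ A * R ^ (-e)) {σ : ℝ}
    (hσ : σ ≤ e) :
    ∃ C : ℝ, 0 < C ∧ ∀ R : ℝ, 2 ≤ R → G γ χ ⊤ R ≤ ENNReal.ofReal (C * R ^ (-σ)) := by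
  refine ⟨A, hA, fun R hR => ?_⟩
  rw [G, eLpNorm_exponent_top]
  refine eLpNormEssSup_le_of_ae_bound (Eventually.of_forall fun θ => ?_)
  refine (hsup R (by linarith) θ (norm_eq_of_mem_sphere θ)).trans ?_
  gcongr
  linarith

end Means

section Assembly

variable {d K : ℕ} {γ : ℝ → EuclideanSpace ℝ (Fin d)} {χ : ℝ → ℂ} {a b : ℝ}

/-- The mean of order `2`, and the means of order between `2` and the breakpoint of order `n`. -/
theorem exists_G_le_of_lt_breakpoint (hm : Continuous (muHat γ χ)) {n : ℕ} (hn : 2 ≤ n)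
    (hlev : ∀ k, k ≤ n → HasLevelBound γ χ k)
    (hL2 : ∃ C : ℝ, 0 ≤ C ∧ ∀ R : ℝ, 1 ≤ R →
      ∫⁻ θ : Metric.sphere (0 : EuclideanSpace ℝ (Fin d)) 1,
        ENNReal.ofReal (‖muHat γ χ (R • (θ : EuclideanSpace ℝ (Fin d)))‖ ^ 2)
        ∂(volume : Measure (EuclideanSpace ℝ (Fin d))).toSphere ≤ ENNReal.ofReal (C / R))
    {q : ENNReal} (hq : 2 ≤ q) (hqt : q ≠ ⊤) (hqn : q.toReal < breakpoint n)
    (hne : ∀ k : ℕ, 2 ≤ k → k ≤ n → q ≠ breakpoint k) {σ : ℝ}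
    (hσ : ∀ k, 2 ≤ k → k ≤ n → σ ≤ sigmaLine k q) :
    ∃ C : ℝ, 0 < C ∧ ∀ R : ℝ, 2 ≤ R → G γ χ q R ≤ ENNReal.ofReal (C * R ^ (-σ)) := by
  have hq0 : q ≠ 0 := (two_pos.trans_le hq).ne'
  rcases hq.eq_or_lt with rfl | hlt
  · obtain ⟨C, -, HC⟩ := hL2
    have h2 : (2 : ENNReal).toReal = 2 := ENNReal.toReal_ofNat 2
    refine exists_G_le_of_lintegral_le hq0 hqt (C := C) (E := 1) (fun R hR => ?_) ?_
    · rw [Real.rpow_neg_one, ← div_eq_mul_inv, h2]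
      simpa only [Real.rpow_ofNat] using HC R hR
    · refine (hσ 2 le_rfl hn).trans_eq ?_
      rw [sigmaLine, h2]
      norm_num
  · have hlt' : 2 < q.toReal := by
      rw [← ENNReal.toReal_ofNat 2]
      exact (ENNReal.toReal_lt_toReal ENNReal.ofNat_ne_top hqt).2 hlt
    obtain ⟨k, h1, h2, h3, h4⟩ := exists_breakpoint_lt hlt' n hqn.le
    refine exists_G_le_of_two_levels hm (hlev k (by omega)) (hlev (k + 1) h2) hq0 hqt h3
      (lt_of_le_of_ne h4 fun h => hne (k + 1) (by omega) h2 ?_) (hσ (k + 1) (by omega) h2)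
    rw [← ENNReal.ofReal_toReal hqt, h, ENNReal.ofReal_natCast]

theorem ne_toReal_breakpoint {q : ENNReal} (hqt : q ≠ ⊤) {k : ℕ} (h : q ≠ breakpoint k) :
    q.toReal ≠ breakpoint k := fun h' =>
  h (by rw [← ENNReal.ofReal_toReal hqt, h', ENNReal.ofReal_natCast])

/-- The three analytic facts about the curve: the level set bounds, the mean square bound, and,
for a nondegenerate curve, the uniform bound. -/
theorem muHat_bounds (hK : 2 ≤ K) (hab : a < b) (hγ : ContDiffOn ℝ ∞ γ (Icc a b))
    (hχ : ContDiff ℝ ∞ χ) (hsupp : tsupport χ ⊆ Ioo a b)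
    (htype : IsFiniteType γ a b ∨ IsPolynomialCurve γ a b)
    (hind : ∀ t ∈ Icc a b, LinearIndependent ℝ
      (fun j : Fin K => iteratedDerivWithin ((j : ℕ) + 1) γ (Icc a b) t)) :
    Continuous (muHat γ χ) ∧ (∀ k, k ≤ K → HasLevelBound γ χ k) ∧
    (∃ C : ℝ, 0 ≤ C ∧ ∀ R : ℝ, 1 ≤ R →
      ∫⁻ θ : Metric.sphere (0 : EuclideanSpace ℝ (Fin d)) 1,
        ENNReal.ofReal (‖muHat γ χ (R • (θ : EuclideanSpace ℝ (Fin d)))‖ ^ 2)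
        ∂(volume : Measure (EuclideanSpace ℝ (Fin d))).toSphere ≤ ENNReal.ofReal (C / R)) ∧
    (K = d → ∃ C : ℝ, 0 < C ∧ ∀ R : ℝ, 1 ≤ R → ∀ θ : EuclideanSpace ℝ (Fin d), ‖θ‖ = 1 →
      ‖muHat γ χ (R • θ)‖ ≤ C * R ^ (-(1 / (d : ℝ)))) := by
  obtain ⟨γ', hγ', heq, hmu⟩ := exists_continuous_muHat_eq hab.le hγ.continuousOn hsupp
  have hΓ := isDerivChain_iteratedDerivWithin hab hγ
  have hΓ0 : ∀ t ∈ Icc a b, iteratedDerivWithin 0 γ (Icc a b) t = γ t := fun t _ => by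
    rw [iteratedDerivWithin_zero]
  obtain ⟨N, hKN, hdec, hstab⟩ := exists_multiscale hab hγ htype K
  refine ⟨hmu ▸ continuous_muHat hγ' hχ.continuous hsupp, fun k hk => ?_, ?_, ?_⟩
  · obtain ⟨C, hC, h⟩ := exists_toSphere_level_le hΓ hΓ0 hab hχ hsupp hdec hstab (hk.trans hKN)
      fun t ht => (hind t ht).comp (Fin.castLE hk) (Fin.castLE_injective hk)
    refine ⟨C, hC, fun R hR l hl => (h R hR l hl).trans_eq ?_⟩
    rw [Real.rpow_neg (by linarith), Real.rpow_neg hl.le, Real.rpow_natCast, Real.rpow_natCast]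
  · have hcomp : HasCompactSupport χ :=
      isCompact_Icc.of_isClosed_subset (isClosed_tsupport χ) (hsupp.trans Ioo_subset_Icc_self)
    obtain ⟨M, hM⟩ := hχ.continuous.bounded_above_of_compact_support hcomp
    have hd : 0 < d := by
      rcases Nat.eq_zero_or_pos d with rfl | h
      · exact absurd (Subsingleton.elim _ _)
          ((hind a ⟨le_rfl, hab.le⟩).ne_zero (⟨0, by omega⟩ : Fin K))
      · exact h
    obtain ⟨C, hC, h⟩ := exists_lintegral_arcHat_le (γ := γ') hγ' hχ hM hΓ
      (fun t ht => (hΓ0 t ht).trans (heq t ht).symm) hd hab.le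
      (fun t ht => (hind t ht).ne_zero (⟨0, by omega⟩ : Fin K))
    refine ⟨C, hC, fun R hR => ?_⟩
    have harc : ∀ ξ, muHat γ χ ξ = arcHat γ' χ a b ξ := fun ξ => by
      have h1 := muHat_smul_eq (γ := γ') (Γ := fun _ => γ') (χ := χ) (fun _ _ => rfl) hab.le
        hsupp 1 ξ
      simp only [one_smul, neg_mul, one_mul] at h1
      rw [hmu, h1, arcHat]
    simp only [harc]
    exact h R hR
  · rintro rfl
    obtain ⟨c, hc, hlow⟩ := exists_lower_bound_of_linearIndependent hΓ hind
    exact exists_norm_muHat_le_rpow hΓ hΓ0 hab.le hχ hsupp (by omega) hKN hdec hc hlow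

end Assembly

end CurveDecay

theorem theorem4 (d K : ℕ) (hd : 2 < d) (hK : 2 ≤ K) (a b : ℝ) (hab : a < b)
    (γ : ℝ → EuclideanSpace ℝ (Fin d)) (hγ : ContDiffOn ℝ ∞ γ (Set.Icc a b))
    (χ : ℝ → ℂ) (hχ : ContDiff ℝ ∞ χ) (hsupp : tsupport χ ⊆ Set.Ioo a b)
    (htype : CurveDecay.IsFiniteType γ a b ∨ CurveDecay.IsPolynomialCurve γ a b)
    (hind : ∀ t ∈ Set.Icc a b, LinearIndependent ℝ
      (fun j : Fin K => iteratedDerivWithin ((j : ℕ) + 1) γ (Set.Icc a b) t)) :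
    (K = d →
      (∀ q : ENNReal, 2 ≤ q →
        (∀ k : ℕ, 2 ≤ k → k ≤ d - 1 → q ≠ (CurveDecay.breakpoint k : ENNReal)) →
        ∃ C : ℝ, 0 < C ∧ ∀ R : ℝ, 2 ≤ R →
          CurveDecay.G γ χ q R ≤ ENNReal.ofReal (C * R ^ (-CurveDecay.sigma d d q))) ∧
      (∀ q : ℕ, (∃ k : ℕ, 2 ≤ k ∧ k ≤ d - 1 ∧ q = CurveDecay.breakpoint k) →
        ∃ C : ℝ, 0 < C ∧ ∀ R : ℝ, 2 ≤ R →
          CurveDecay.G γ χ q R ≤ ENNReal.ofReal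
            (C * R ^ (-CurveDecay.sigma d d q) * Real.log R ^ (1 / (q : ℝ))))) ∧
    (K ≤ d - 1 →
      (∀ q : ENNReal, 2 ≤ q →
        (∀ k : ℕ, 2 ≤ k → k ≤ K → q ≠ (CurveDecay.breakpoint k : ENNReal)) →
        ∃ C : ℝ, 0 < C ∧ ∀ R : ℝ, 2 ≤ R →
          CurveDecay.G γ χ q R ≤ ENNReal.ofReal (C * R ^ (-CurveDecay.sigma d K q))) ∧
      (∀ q : ℕ, (∃ k : ℕ, 2 ≤ k ∧ k ≤ K ∧ q = CurveDecay.breakpoint k) →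
        ∃ C : ℝ, 0 < C ∧ ∀ R : ℝ, 2 ≤ R →
          CurveDecay.G γ χ q R ≤ ENNReal.ofReal
            (C * R ^ (-CurveDecay.sigma d K q) * Real.log R ^ (1 / (q : ℝ))))) := by

  obtain ⟨hm, hlev, hL2, hsup⟩ :=
    CurveDecay.muHat_bounds hK hab hγ hχ hsupp htype hind
  refine ⟨fun hKd => ?_, fun hKd => ?_⟩
  · subst hKd
    obtain ⟨A, hA, hsup⟩ := hsup rfl
    have hd1 : K - 1 + 1 = K := by omega
    refine ⟨fun q hq hne => ?_, ?_⟩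
    · have hq0 : q ≠ 0 := (two_pos.trans_le hq).ne'
      by_cases hqt : q = ⊤
      · subst hqt
        refine CurveDecay.exists_G_top_le hA hsup
          ((CurveDecay.sigma_le_sigmaLine hK le_rfl _).trans_eq ?_)
        simp [CurveDecay.sigmaLine]
      rcases lt_or_gt_of_ne (CurveDecay.ne_toReal_breakpoint hqt
        (hne (K - 1) (by omega) le_rfl)) with h | h
      · exact CurveDecay.exists_G_le_of_lt_breakpoint hm (by omega)
          (fun k hk => hlev k (by omega)) hL2 hq hqt h hne
          fun k h2 hk => CurveDecay.sigma_le_sigmaLine h2 (by omega) q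
      · refine CurveDecay.exists_G_le_of_sup_le hm (hlev (K - 1) (by omega)) hA.le hsup hq0 hqt h
          ((CurveDecay.sigma_le_sigmaLine hK le_rfl q).trans_eq ?_)
        have h1 := CurveDecay.sigmaLine_succ hq0 hqt (K - 1)
        rw [hd1] at h1
        rw [h1]
        ring
    · rintro q ⟨k, h2, hk, rfl⟩
      obtain ⟨k, rfl⟩ : ∃ j, k = j + 1 := ⟨k - 1, by omega⟩
      exact CurveDecay.exists_G_breakpoint_le hm (hlev k (by omega)) (hlev (k + 1) (by omega))
        (CurveDecay.sigma_le_sigmaLine h2 (by omega) _)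
  · have hKd' : K ≠ d := by omega
    have hbdd : ∀ R : ℝ, 1 ≤ R → ∀ θ : EuclideanSpace ℝ (Fin d), ‖θ‖ = 1 →
        ‖CurveDecay.muHat γ χ (R • θ)‖ ≤ ((∫ t, ‖χ t‖) + 1) * R ^ (-(0 : ℝ)) := fun R _ θ _ => by
      rw [neg_zero, Real.rpow_zero, mul_one]
      linarith [CurveDecay.norm_muHat_le γ χ (R • θ)]
    have hA : 0 < (∫ t, ‖χ t‖) + 1 := by
      have : 0 ≤ ∫ t, ‖χ t‖ := MeasureTheory.integral_nonneg fun t => norm_nonneg _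
      linarith
    refine ⟨fun q hq hne => ?_, ?_⟩
    · have hq0 : q ≠ 0 := (two_pos.trans_le hq).ne'
      by_cases hqt : q = ⊤
      · subst hqt
        refine CurveDecay.exists_G_top_le hA hbdd
          ((CurveDecay.sigma_le_mul_inv hKd' _).trans_eq ?_)
        simp
      rcases lt_or_gt_of_ne (CurveDecay.ne_toReal_breakpoint hqt (hne K hK le_rfl)) with h | h
      · exact CurveDecay.exists_G_le_of_lt_breakpoint hm hK hlev hL2 hq hqt h hne
          fun k h2 hk => CurveDecay.sigma_le_sigmaLine h2 hk q
      · refine CurveDecay.exists_G_le_of_sup_le hm (hlev K le_rfl) hA.le hbdd hq0 hqt h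
          ((CurveDecay.sigma_le_mul_inv hKd' q).trans_eq ?_)
        rw [ENNReal.toReal_inv]
        ring
    · rintro q ⟨k, h2, hk, rfl⟩
      obtain ⟨k, rfl⟩ : ∃ j, k = j + 1 := ⟨k - 1, by omega⟩
      exact CurveDecay.exists_G_breakpoint_le hm (hlev k (by omega)) (hlev (k + 1) hk)
        (CurveDecay.sigma_le_sigmaLine h2 hk _)
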